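/- **Definitions.** An *embedded graph* $G$ in an open set $U\subseteq\mathbb R^n$ is a collection of edges, locally finite in $U$ (each compact subset of $U$ meets finitely many). Each edge has as its closure a smoothly embedded compact arc whose relative interior lies in $U$. Edges meet only at boundary points. The boundary points lying in $U$ are the vertices. At every vertex at least three edges meet, with pairwise distinct outward-pointing unit tangents. Let $B_r(x)$ be the open ball and $B_r=B_r(0)$. The set $\hat{\mathcal G}^n_r$ of embedded graphs in $B_r$ carries the smooth topology of topological types: it is the disjoint union of the combinatorial isomorphism classes, in each of which graphs converge when the closures of their edges converge in $C^\infty$ up to reparametrization. For an embedded graph $G$ in $\mathbb R^n$ and bounded $K\subset\mathbb R^n$, let $P_r(G,K)$ be the law on $\hat{\mathcal G}^n_r$ of $(G-x)\cap B_r$ for $x$ uniform in $K$. An infinite $G$ has a *smooth geometric cloth* if for every $r\in\mathbb N$ the laws $P_r(G,B_i)$ converge weakly to a probability measure $\mathcal P_r(G)$ as $i\to\infty$; for finite $G$ put $\mathcal P_r(G)=P_r(G,\mathrm{conv}\,G)$. A sequence $\{G_j\}$ is *locally geometrically convergent* if every $G_j$ has a smooth geometric cloth and for every $r\in\mathbb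 N$ the measures $\mathcal P_r(G_j)$ converge weakly on $\hat{\mathcal G}^n_r$ to a probability measure as $j\to\infty$. The *swatch* of radius $k$ at a vertex $v$ of a finite graph is the ball of radius $k$ about $v$ in the bipartite incidence graph of its vertices and edges; its *type* is its isomorphism class as a rooted bipartite graph. A family of finite graphs *converges in the Benjamini–Schramm sense* if for every $k$ the distributions of the radius-$k$ swatch type at a uniformly random vertex converge to a probability distribution on the set of swatch types. Let $I_s(G)$ be the finite graph of the vertices and edges of $G$ contained in $B_s$. $G$ has an *inner-regular topological cloth* if $I_s(G)$ converges in the Benjamini–Schramm sense as $s\to\infty$; the family of limits is the cloth. Let $V(\cdot)$, $E(\cdot)$ denote vertex and edge sets, let $e(G,s,M)$ be the fraction of edges of $I_s(G)$ of length greater than $M$, and let $\rho(G,s,r,M)$ be the fraction of vertices $v$ of $I_s(G)$ such that $B_r(v)$ contains more than $M$ vertices of $G$. **Proposition.** Let $\{G_j\}$ be a locally geometrically convergent sequence of embedded graphs in $\mathbb R^n$. Assume that for some $D$ the vertex degrees of the $G_j$ are bounded above by $D$ with probability one with respect to all local distributions $\mathcal P_r(G_j)$, and that for some $B$ one has $|E(I_s(G_j))|\le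 B\,|V(I_s(G_j))|$ for every $j$ and all sufficiently large $s$ (if all vertices of all $G_j$ have degree at most $D$, both hold, with $B=D$). Let $C_1>0$ and $r>0$ be constants, and $M(\epsilon)$, $N(\epsilon)$ real-valued functions of $\epsilon>0$. Consider the conditions $$(1)\ \left|\frac{|V(I_s(G_j))|}{\mathrm{vol}(B_s)}-C_1\right|<\epsilon,\qquad (2)\ e(G_j,s,M(\epsilon))<\epsilon,\qquad (3)\ \rho(G_j,s,r,N(\epsilon))<\epsilon .$$ Assume that for every $\epsilon>0$ there is $J(\epsilon)$ such that for each $j\ge J(\epsilon)$ conditions (1)–(3) hold for all sufficiently large $s$. Then: (a) Each $G_j$ for which (1)–(3) hold for every $\epsilon>0$ and all $s\ge s_0(j,\epsilon)$ has an inner-regular topological cloth. In particular, if $J(\epsilon)=J$ can be chosen independently of $\epsilon$, every $G_j$ with $j\ge J$ has one. (b) $\lim_{j\to\infty}\lim_{s\to\infty}I_s(G_j)$ converges in the Benjamini–Schramm sense: there are probability distributions $\tau_k$ on swatch types such that for all $k$, all types $S$ and all $\eta>0$, for all sufficiently large $j$ the frequency of $S$ among the radius-$k$ swatches of $I_s(G_j)$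 is within $\eta$ of $\tau_k(S)$ for all sufficiently large $s$. In particular, if $G_j$ has an inner-regular topological cloth for all large $j$, these cloths converge to $(\tau_k)_k$ as $j\to\infty$. -/

import Mathlib

open Set Filter Topology MeasureTheory
open scoped ContDiff

noncomputable section

namespace EmbeddedGraphs

/-- Euclidean `n`-space. -/
abbrev Space (n : ℕ) := EuclideanSpace ℝ (Fin n)

variable {n : ℕ}

/-! ### Smooth arcs -/

/-- `γ`, restricted to `[0,1]`, is a smooth embedding with image `e`. -/
structure IsParam (γ : ℝ → Space n) (e : Set (Space n)) : Prop where
  smooth : ContDiffOn ℝ ∞ γ (Icc 0 1)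
  inj : InjOn γ (Icc 0 1)
  immersed : ∀ t ∈ Icc (0 : ℝ) 1, derivWithin γ (Icc 0 1) t ≠ 0
  image : γ '' Icc 0 1 = e

/-- A smoothly embedded compact connected curve with (two) boundary points. -/
def IsSmoothArc (e : Set (Space n)) : Prop := ∃ γ, IsParam γ e

/-- The boundary points of a smooth arc. -/
def endpoints (e : Set (Space n)) : Set (Space n) := {v | ∃ γ, IsParam γ e ∧ γ 0 = v}

/-- The initial unit tangent vector of a parametrization; it points from `γ 0` into the curve. -/
def unitTangent (γ : ℝ → Space n) : Space n :=
  ‖derivWithin γ (Icc 0 1) 0‖⁻¹ • derivWithin γ (Icc 0 1) 0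

/-- The unit tangent vectors of the arc `e` at its boundary point `v` that point into `e`
(there is exactly one). -/
def tangents (e : Set (Space n)) (v : Space n) : Set (Space n) :=
  {u | ∃ γ, IsParam γ e ∧ γ 0 = v ∧ unitTangent γ = u}

theorem IsParam.affine {γ : ℝ → Space n} {e : Set (Space n)} (h : IsParam γ e) {p q : ℝ}
    (hp : p ∈ Icc (0 : ℝ) 1) (hq : q ∈ Icc (0 : ℝ) 1) (hpq : p ≠ q) :
    IsParam (fun t => γ (p + t * (q - p))) (γ '' uIcc p q) := by
  have hmaps : MapsTo (fun t : ℝ => p + t * (q - p)) (Icc 0 1) (Icc 0 1) := by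
    rintro t ⟨h0, h1⟩
    refine ⟨?_, ?_⟩
    · have := hp.1; have := hq.1; nlinarith
    · have := hp.2; have := hq.2; nlinarith
  have hd : ∀ t, HasDerivAt (fun t : ℝ => p + t * (q - p)) (q - p) t := fun t => by
    simpa using ((hasDerivAt_id t).mul_const (q - p)).const_add p
  refine ⟨?_, ?_, ?_, ?_⟩
  · have : ContDiff ℝ ∞ (fun t : ℝ => p + t * (q - p)) := by fun_prop
    exact h.smooth.comp this.contDiffOn hmaps
  · intro s hs t ht hst
    have h1 := h.inj (hmaps hs) (hmaps ht) hst
    have h2 : (s - t) * (q - p) = 0 := by simp only at h1; linarith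
    rcases mul_eq_zero.1 h2 with h3 | h3
    · linarith
    · exact absurd (by linarith) hpq
  · intro t ht
    have h1 : HasDerivWithinAt γ (derivWithin γ (Icc 0 1) (p + t * (q - p))) (Icc 0 1)
        (p + t * (q - p)) :=
      ((h.smooth.differentiableOn (by simp)) _ (hmaps ht)).hasDerivWithinAt
    have h2 := (h1.scomp t (hd t).hasDerivWithinAt hmaps).derivWithin
      (uniqueDiffOn_Icc zero_lt_one t ht)
    have h3 : derivWithin (fun t => γ (p + t * (q - p))) (Icc 0 1) t =
      (q - p) • derivWithin γ (Icc 0 1) (p + t * (q - p)) := h2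
    rw [h3]
    exact smul_ne_zero (sub_ne_zero.2 hpq.symm) (h.immersed _ (hmaps ht))
  · have : (fun t : ℝ => p + t * (q - p)) '' Icc 0 1 = uIcc p q := by
      rw [← segment_eq_uIcc, segment_eq_image']
      simp [smul_eq_mul]
    rw [← this, image_image]

theorem IsParam.translate {γ : ℝ → Space n} {e : Set (Space n)} (h : IsParam γ e) (x : Space n) :
    IsParam (fun t => γ t + x) ((· + x) '' e) := by
  refine ⟨h.smooth.add contDiffOn_const, ?_, ?_, ?_⟩
  · intro s hs t ht hst
    exact h.inj hs ht (add_right_cancel hst)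
  · intro t ht
    rw [derivWithin_add_const]
    exact h.immersed t ht
  · rw [← h.image, image_image]

theorem IsParam.isCompact {γ : ℝ → Space n} {e : Set (Space n)} (h : IsParam γ e) :
    IsCompact e := by
  rw [← h.image]; exact isCompact_Icc.image_of_continuousOn h.smooth.continuousOn

/-- Change of parameter along a subarc. -/
theorem IsParam.exists_lift {γ δ : ℝ → Space n} {e c : Set (Space n)} (h : IsParam γ e)
    (h' : IsParam δ c) (hce : c ⊆ e) :
    ∃ g : ℝ → ℝ, ContinuousOn g (Icc 0 1) ∧ InjOn g (Icc 0 1) ∧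
      ∀ t ∈ Icc (0 : ℝ) 1, g t ∈ Icc (0 : ℝ) 1 ∧ γ (g t) = δ t := by
  have hex : ∀ t ∈ Icc (0 : ℝ) 1, ∃ s ∈ Icc (0 : ℝ) 1, γ s = δ t := fun t ht => by
    have h1 : δ t ∈ e := hce (h'.image ▸ mem_image_of_mem _ ht)
    rw [← h.image] at h1
    exact h1
  choose! g hg1 hg2 using hex
  refine ⟨g, ?_, ?_, fun t ht => ⟨hg1 t ht, hg2 t ht⟩⟩
  · have hF : IsClosedEmbedding ((Icc (0 : ℝ) 1).domRestrict γ) :=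
      h.smooth.continuousOn.domRestrict.isClosedEmbedding h.inj.injective
    have h1 : Continuous (fun t : Icc (0 : ℝ) 1 => (⟨g t, hg1 t t.2⟩ : Icc (0 : ℝ) 1)) := by
      rw [hF.isEmbedding.continuous_iff]
      have : ((Icc (0 : ℝ) 1).domRestrict γ ∘
          fun t : Icc (0 : ℝ) 1 => (⟨g t, hg1 t t.2⟩ : Icc (0 : ℝ) 1)) =
          (Icc (0 : ℝ) 1).domRestrict δ := by
        funext t; exact hg2 t t.2
      rw [this]
      exact h'.smooth.continuousOn.domRestrict
    exact continuousOn_iff_continuous_domRestrict.2 (continuous_subtype_val.comp h1)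
  · intro s hs t ht hst
    exact h'.inj hs ht (by rw [← hg2 s hs, ← hg2 t ht, hst])

theorem IsParam.exists_interval {γ δ : ℝ → Space n} {e c : Set (Space n)} (h : IsParam γ e)
    (h' : IsParam δ c) (hce : c ⊆ e) :
    ∃ a b : ℝ, 0 ≤ a ∧ a < b ∧ b ≤ 1 ∧ γ '' Icc a b = c ∧
      ((δ 0 = γ a ∧ δ 1 = γ b) ∨ (δ 0 = γ b ∧ δ 1 = γ a)) := by
  obtain ⟨g, hgc, hgi, hg⟩ := h.exists_lift h' hce
  have h0 : (0 : ℝ) ∈ Icc (0 : ℝ) 1 := ⟨le_rfl, zero_le_one⟩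
  have h1 : (1 : ℝ) ∈ Icc (0 : ℝ) 1 := ⟨zero_le_one, le_rfl⟩
  have key : ∀ a b, g '' Icc 0 1 = Icc a b → γ '' Icc a b = c := by
    intro a b hab
    rw [← hab, image_image, ← h'.image]
    exact image_congr fun t ht => (hg t ht).2
  rcases hgc.strictMonoOn_of_injOn_Icc' zero_le_one hgi with hm | hm
  · refine ⟨g 0, g 1, (hg 0 h0).1.1, hm h0 h1 zero_lt_one, (hg 1 h1).1.2, key _ _ ?_,
      Or.inl ⟨(hg 0 h0).2.symm, (hg 1 h1).2.symm⟩⟩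
    apply Subset.antisymm
    · rintro _ ⟨t, ht, rfl⟩
      exact ⟨hm.monotoneOn h0 ht ht.1, hm.monotoneOn ht h1 ht.2⟩
    · exact intermediate_value_Icc zero_le_one hgc
  · refine ⟨g 1, g 0, (hg 1 h1).1.1, hm h0 h1 zero_lt_one, (hg 0 h0).1.2, key _ _ ?_,
      Or.inr ⟨(hg 0 h0).2.symm, (hg 1 h1).2.symm⟩⟩
    apply Subset.antisymm
    · rintro _ ⟨t, ht, rfl⟩
      exact ⟨hm.antitoneOn ht h1 ht.2, hm.antitoneOn h0 ht ht.1⟩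
    · exact intermediate_value_Icc' zero_le_one hgc

theorem IsParam.endpoints_image {γ : ℝ → Space n} {e : Set (Space n)} (h : IsParam γ e) {a b : ℝ}
    (ha : 0 ≤ a) (hab : a < b) (hb : b ≤ 1) : endpoints (γ '' Icc a b) = {γ a, γ b} := by
  have hA : a ∈ Icc (0 : ℝ) 1 := ⟨ha, hab.le.trans hb⟩
  have hB : b ∈ Icc (0 : ℝ) 1 := ⟨ha.trans hab.le, hb⟩
  have hsub : Icc a b ⊆ Icc (0 : ℝ) 1 := Icc_subset_Icc ha hb
  ext v
  constructor
  · rintro ⟨δ, hδ, rfl⟩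
    obtain ⟨a', b', ha', hab', hb', him, hor⟩ := h.exists_interval hδ
      ((image_mono hsub).trans h.image.le)
    have h1 : Icc a' b' = Icc a b := (h.inj.image_eq_image_iff (Icc_subset_Icc ha' hb') hsub).1 him
    obtain ⟨rfl, rfl⟩ := (Icc_eq_Icc_iff hab'.le).1 h1
    rcases hor with hh | hh
    · left; exact hh.1
    · right; exact hh.1
  · rintro (rfl | rfl)
    · refine ⟨_, by simpa [uIcc_of_le hab.le] using h.affine hA hB hab.ne, by simp⟩
    · refine ⟨_, by simpa [uIcc_of_ge hab.le] using h.affine hB hA hab.ne', by simp⟩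

theorem IsParam.endpoints_eq {γ : ℝ → Space n} {e : Set (Space n)} (h : IsParam γ e) :
    endpoints e = {γ 0, γ 1} := by
  rw [← h.image]; exact h.endpoints_image le_rfl zero_lt_one le_rfl

theorem endpoints_subset (e : Set (Space n)) : endpoints e ⊆ e := by
  rintro v ⟨γ, h, rfl⟩
  rw [← h.image]; exact mem_image_of_mem _ ⟨le_rfl, zero_le_one⟩

theorem IsParam.exists_mem_sdiff {γ : ℝ → Space n} {e : Set (Space n)} (h : IsParam γ e) :
    ∃ p ∈ e, p ∉ endpoints e := by
  have hh : (1 / 2 : ℝ) ∈ Icc (0 : ℝ) 1 := by norm_num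
  refine ⟨γ (1 / 2), h.image ▸ mem_image_of_mem _ hh, ?_⟩
  rw [h.endpoints_eq]
  rintro (h1 | h1)
  · have := h.inj hh ⟨le_rfl, zero_le_one⟩ h1; norm_num at this
  · have := h.inj hh ⟨zero_le_one, le_rfl⟩ h1; norm_num at this

/-- The unit tangent at an endpoint depends only on the germ of the arc. -/
theorem IsParam.unitTangent_eq {γ δ : ℝ → Space n} {e c : Set (Space n)} (h : IsParam γ e)
    (h' : IsParam δ c) (hce : c ⊆ e) (h0 : γ 0 = δ 0) : unitTangent γ = unitTangent δ := by
  have key : ∀ {η : ℝ → Space n} {f : Set (Space n)}, IsParam η f →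
      Tendsto (fun t => ‖η t - η 0‖⁻¹ • (η t - η 0)) (𝓝[Ioc 0 1] 0) (𝓝 (unitTangent η)) := by
    intro η f hη
    have z : (0 : ℝ) ∈ Icc (0 : ℝ) 1 := ⟨le_rfl, zero_le_one⟩
    have h1 := hasDerivWithinAt_iff_tendsto_slope.1
      ((hη.smooth.differentiableOn (by simp)) 0 z).hasDerivWithinAt
    have h2 : Icc (0 : ℝ) 1 \ {0} = Ioc 0 1 := Icc_sdiff_left
    rw [h2] at h1
    have h3 := (h1.norm.inv₀ (norm_ne_zero_iff.2 (hη.immersed 0 z))).smul h1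
    refine h3.congr' ?_
    filter_upwards [self_mem_nhdsWithin] with t ht
    have ht0 : 0 < t := ht.1
    simp only [slope_def_module, sub_zero, norm_smul, norm_inv, Real.norm_eq_abs, abs_of_pos ht0]
    rw [smul_smul, mul_inv, inv_inv]
    congr 1
    field_simp
  obtain ⟨g, hgc, hgi, hg⟩ := h.exists_lift h' hce
  have z : (0 : ℝ) ∈ Icc (0 : ℝ) 1 := ⟨le_rfl, zero_le_one⟩
  have g0 : g 0 = 0 := h.inj (hg 0 z).1 z (by rw [(hg 0 z).2, h0])
  have hgt : Tendsto g (𝓝[Ioc 0 1] 0) (𝓝[Ioc 0 1] 0) := by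
    refine tendsto_nhdsWithin_iff.2 ⟨?_, ?_⟩
    · have := (hgc 0 z).mono_left (nhdsWithin_mono (0 : ℝ) Ioc_subset_Icc_self)
      rwa [g0] at this
    · filter_upwards [self_mem_nhdsWithin] with t ht
      have ht' := (hg t (Ioc_subset_Icc_self ht)).1
      refine ⟨lt_of_le_of_ne ht'.1 fun h1 => ?_, ht'.2⟩
      have := hgi z (Ioc_subset_Icc_self ht) (by rw [g0]; exact h1)
      exact ht.1.ne this
  have h1 := (key h).comp hgt
  have hne : (𝓝[Ioc (0 : ℝ) 1] 0).NeBot := by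
    rw [nhdsWithin_Ioc_eq_nhdsGT zero_lt_one]; infer_instance
  refine tendsto_nhds_unique (h1.congr' ?_) (key h')
  filter_upwards [self_mem_nhdsWithin] with t ht
  have ht' := (hg t (Ioc_subset_Icc_self ht)).2
  simp [ht', h0]

/-! ### Embedded graphs -/

/-- An embedded graph in the open set `U`. Edges are recorded as compact smooth arcs, namely as the
closures of the edges in `U`; their relative interiors lie in `U`, and a boundary point of an
arc that lies outside `U` is not a vertex (the edge leaves `U` there). -/
structure EmbeddedGraph (U : Set (Space n)) where
  edges : Set (Set (Space n))
  isSmoothArc : ∀ e ∈ edges, IsSmoothArc e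
  interior_subset : ∀ e ∈ edges, e \ endpoints e ⊆ U
  inter_subset : ∀ e ∈ edges, ∀ e' ∈ edges, e ≠ e' → e ∩ e' ⊆ endpoints e ∩ endpoints e'
  three_le_degree : ∀ v ∈ U, (∃ e ∈ edges, v ∈ endpoints e) →
    3 ≤ {e ∈ edges | v ∈ endpoints e}.encard
  tangents_disjoint : ∀ v ∈ U, ∀ e ∈ edges, ∀ e' ∈ edges, e ≠ e' →
    Disjoint (tangents e v) (tangents e' v)
  locallyFinite : ∀ K ⊆ U, IsCompact K → {e ∈ edges | (e ∩ K).Nonempty}.Finite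

namespace EmbeddedGraph

variable {U : Set (Space n)}

/-- The vertices: boundary points of edges that lie in `U`. -/
def vertices (G : EmbeddedGraph U) : Set (Space n) := {v ∈ U | ∃ e ∈ G.edges, v ∈ endpoints e}

/-- The degree of a vertex. -/
def degree (G : EmbeddedGraph U) (v : Space n) : ℕ∞ := {e ∈ G.edges | v ∈ endpoints e}.encard

end EmbeddedGraph

/-! ### Translation and restriction -/

theorem image_add_neg (e : Set (Space n)) (x : Space n) : (· + -x) '' ((· + x) '' e) = e := by
  rw [image_image]; simp

theorem IsParam.of_translate {γ : ℝ → Space n} {e : Set (Space n)} {x : Space n}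
    (h : IsParam γ ((· + x) '' e)) : IsParam (fun t => γ t + -x) e := by
  have := h.translate (-x)
  rwa [image_add_neg] at this

theorem endpoints_translate (e : Set (Space n)) (x v : Space n) :
    v ∈ endpoints ((· + x) '' e) ↔ v + -x ∈ endpoints e := by
  constructor
  · rintro ⟨γ, h, rfl⟩
    exact ⟨_, h.of_translate, rfl⟩
  · rintro ⟨γ, h, h0⟩
    exact ⟨_, h.translate x, by simp [h0]⟩

theorem unitTangent_translate (γ : ℝ → Space n) (x : Space n) :
    unitTangent (fun t => γ t + x) = unitTangent γ := by
  simp only [unitTangent, derivWithin_add_const]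

theorem tangents_translate (e : Set (Space n)) (x v : Space n) :
    tangents ((· + x) '' e) v ⊆ tangents e (v + -x) := by
  rintro u ⟨γ, h, rfl, rfl⟩
  exact ⟨_, h.of_translate, rfl, unitTangent_translate _ _⟩

namespace EmbeddedGraph

/-- The translate `G + x` of an embedded graph in `ℝⁿ`. -/
def translate (G : EmbeddedGraph (univ : Set (Space n))) (x : Space n) :
    EmbeddedGraph (univ : Set (Space n)) where
  edges := (fun e => (· + x) '' e) '' G.edges
  isSmoothArc := by
    rintro _ ⟨e, he, rfl⟩
    obtain ⟨γ, h⟩ := G.isSmoothArc e he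
    exact ⟨_, h.translate x⟩
  interior_subset := fun _ _ => subset_univ _
  inter_subset := by
    rintro _ ⟨e, he, rfl⟩ _ ⟨e', he', rfl⟩ hne v ⟨⟨p, hp, hpv⟩, ⟨q, hq, hqv⟩⟩
    have hpq : p = q := add_right_cancel (hpv.trans hqv.symm)
    subst hpq
    have hv : v + -x = p := by rw [← hpv]; simp
    have h := G.inter_subset e he e' he' (fun h => hne (by rw [h])) ⟨hp, hq⟩
    exact ⟨(endpoints_translate _ _ _).2 (hv ▸ h.1), (endpoints_translate _ _ _).2 (hv ▸ h.2)⟩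
  three_le_degree := by
    rintro v - ⟨_, ⟨e, he, rfl⟩, hv⟩
    refine (G.three_le_degree (v + -x) (mem_univ _)
      ⟨e, he, (endpoints_translate _ _ _).1 hv⟩).trans ?_
    refine encard_le_encard_of_injOn (f := fun e => (· + x) '' e) ?_ ?_
    · rintro e' ⟨he', hv'⟩
      exact ⟨mem_image_of_mem _ he', (endpoints_translate _ _ _).2 hv'⟩
    · intro a _ b _ hab
      exact (add_left_injective x).image_injective hab
  tangents_disjoint := by
    rintro v - _ ⟨e, he, rfl⟩ _ ⟨e', he', rfl⟩ hne
    exact (G.tangents_disjoint (v + -x) (mem_univ _) e he e' he' (fun h => hne (by rw [h]))).mono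
      (tangents_translate _ _ _) (tangents_translate _ _ _)
  locallyFinite := by
    intro K _ hK
    have hK' : IsCompact ((· + -x) '' K) := hK.image (continuous_add_const (-x))
    refine ((G.locallyFinite _ (subset_univ _) hK').image (fun e => (· + x) '' e)).subset ?_
    rintro _ ⟨⟨e, he, rfl⟩, ⟨_, ⟨p, hp, rfl⟩, hpK⟩⟩
    exact ⟨e, ⟨he, p, hp, p + x, hpK, by simp⟩, rfl⟩

end EmbeddedGraph

/-- `c` is the closure of a connected component of `e ∩ U`: a subarc of `e` with relative interior
in `U` that cannot be prolonged, as each of its boundary points ends `e` or lies outside `U`. -/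
structure IsPiece (U e c : Set (Space n)) : Prop where
  isSmoothArc : IsSmoothArc c
  subset : c ⊆ e
  interior_subset : c \ endpoints c ⊆ U
  endpoints_subset : endpoints c ⊆ endpoints e ∪ Uᶜ

section Pieces

variable {U e c c' : Set (Space n)} {γ : ℝ → Space n}

theorem IsPiece.exists_interval (hc : IsPiece U e c) (h : IsParam γ e) :
    ∃ a b : ℝ, 0 ≤ a ∧ a < b ∧ b ≤ 1 ∧ γ '' Icc a b = c ∧ (∀ t ∈ Ioo a b, γ t ∈ U) ∧
      (a = 0 ∨ γ a ∉ U) ∧ (b = 1 ∨ γ b ∉ U) := by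
  obtain ⟨δ, hδ⟩ := hc.isSmoothArc
  obtain ⟨a, b, ha, hab, hb, him, -⟩ := h.exists_interval hδ hc.subset
  have hA : a ∈ Icc (0 : ℝ) 1 := ⟨ha, hab.le.trans hb⟩
  have hB : b ∈ Icc (0 : ℝ) 1 := ⟨ha.trans hab.le, hb⟩
  have hend : endpoints c = {γ a, γ b} := him ▸ h.endpoints_image ha hab hb
  have z : (0 : ℝ) ∈ Icc (0 : ℝ) 1 := ⟨le_rfl, zero_le_one⟩
  have o : (1 : ℝ) ∈ Icc (0 : ℝ) 1 := ⟨zero_le_one, le_rfl⟩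
  refine ⟨a, b, ha, hab, hb, him, ?_, ?_, ?_⟩
  · intro t ht
    have hT : t ∈ Icc (0 : ℝ) 1 := ⟨ha.trans ht.1.le, ht.2.le.trans hb⟩
    refine hc.interior_subset ⟨him ▸ mem_image_of_mem _ (Ioo_subset_Icc_self ht), ?_⟩
    rw [hend]
    rintro (h1 | h1)
    · exact ht.1.ne' (h.inj hT hA h1)
    · exact ht.2.ne (h.inj hT hB h1)
  · have := hc.endpoints_subset (hend ▸ Or.inl rfl : γ a ∈ endpoints c)
    rw [h.endpoints_eq] at this
    rcases this with (h1 | h1) | h1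
    · exact Or.inl (h.inj hA z h1)
    · have := h.inj hA o h1; linarith
    · exact Or.inr h1
  · have := hc.endpoints_subset (hend ▸ Or.inr rfl : γ b ∈ endpoints c)
    rw [h.endpoints_eq] at this
    rcases this with (h1 | h1) | h1
    · have := h.inj hB z h1; linarith
    · exact Or.inl (h.inj hB o h1)
    · exact Or.inr h1

theorem IsPiece.of_interval (h : IsParam γ e) {a b : ℝ} (ha : 0 ≤ a) (hab : a < b) (hb : b ≤ 1)
    (hU : ∀ t ∈ Ioo a b, γ t ∈ U) (h0 : a = 0 ∨ γ a ∉ U) (h1 : b = 1 ∨ γ b ∉ U) :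
    IsPiece U e (γ '' Icc a b) := by
  have hA : a ∈ Icc (0 : ℝ) 1 := ⟨ha, hab.le.trans hb⟩
  have hB : b ∈ Icc (0 : ℝ) 1 := ⟨ha.trans hab.le, hb⟩
  have hend : endpoints (γ '' Icc a b) = {γ a, γ b} := h.endpoints_image ha hab hb
  refine ⟨?_, ?_, ?_, ?_⟩
  · exact ⟨_, by simpa [uIcc_of_le hab.le] using h.affine hA hB hab.ne⟩
  · rw [← h.image]; exact image_mono (Icc_subset_Icc ha hb)
  · rintro _ ⟨⟨t, ht, rfl⟩, hn⟩
    rw [hend] at hn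
    refine hU t ⟨lt_of_le_of_ne ht.1 fun h => hn (Or.inl (by rw [h])),
      lt_of_le_of_ne ht.2 fun h => hn (Or.inr (by rw [h]; rfl))⟩
  · rw [hend, h.endpoints_eq]
    rintro _ (rfl | rfl)
    · rcases h0 with rfl | h0
      · exact Or.inl (Or.inl rfl)
      · exact Or.inr h0
    · rcases h1 with rfl | h1
      · exact Or.inl (Or.inr rfl)
      · exact Or.inr h1

/-- Two pieces of the same arc that meet in `U` agree. -/
theorem IsPiece.eq_of_mem (hc : IsPiece U e c) (hc' : IsPiece U e c') (he : IsSmoothArc e)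
    {p : Space n} (hp : p ∈ c) (hp' : p ∈ c') (hU : p ∈ U) : c = c' := by
  obtain ⟨γ, h⟩ := he
  obtain ⟨a, b, ha, hab, hb, rfl, hin, h0, h1⟩ := hc.exists_interval h
  obtain ⟨a', b', ha', hab', hb', rfl, hin', h0', h1'⟩ := hc'.exists_interval h
  obtain ⟨t, ht, rfl⟩ := hp
  obtain ⟨t', ht', htt⟩ := hp'
  have : t' = t := h.inj ⟨ha'.trans ht'.1, ht'.2.trans hb'⟩ ⟨ha.trans ht.1, ht.2.trans hb⟩ htt
  subst this
  have hl : ∀ {s : ℝ}, γ s ∉ U → s ≠ t' := fun hs h => hs (h ▸ hU)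
  have haa : a = a' := by
    rcases lt_trichotomy a a' with hlt | heq | hlt
    · have hn : γ a' ∉ U := h0'.resolve_left (by linarith)
      have := lt_of_le_of_ne ht'.1 (hl hn)
      exact absurd (hin a' ⟨hlt, by linarith [ht.2]⟩) hn
    · exact heq
    · have hn : γ a ∉ U := h0.resolve_left (by linarith)
      have := lt_of_le_of_ne ht.1 (hl hn)
      exact absurd (hin' a ⟨hlt, by linarith [ht'.2]⟩) hn
  have hbb : b = b' := by
    rcases lt_trichotomy b b' with hlt | heq | hlt
    · have hn : γ b ∉ U := h1.resolve_left (by linarith)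
      have := lt_of_le_of_ne ht.2 (hl hn).symm
      exact absurd (hin' b ⟨by linarith [ht'.1], hlt⟩) hn
    · exact heq
    · have hn : γ b' ∉ U := h1'.resolve_left (by linarith)
      have := lt_of_le_of_ne ht'.2 (hl hn).symm
      exact absurd (hin b' ⟨by linarith [ht.1], hlt⟩) hn
  rw [haa, hbb]

theorem IsPiece.exists_of_endpoint {v : Space n} (hU : IsOpen U) (hv : v ∈ endpoints e)
    (hvU : v ∈ U) : ∃ c, IsPiece U e c ∧ v ∈ endpoints c := by
  obtain ⟨γ, h, rfl⟩ := hv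
  set S : Set ℝ := {t ∈ Icc (0 : ℝ) 1 | γ t ∉ U} with hS
  have hSc : IsCompact S := by
    have : S = Icc 0 1 ∩ γ ⁻¹' Uᶜ := rfl
    rw [this]
    exact isCompact_Icc.of_isClosed_subset
      (h.smooth.continuousOn.preimage_isClosed_of_isClosed isClosed_Icc hU.isClosed_compl)
      inter_subset_left
  have hex : ∃ b : ℝ, 0 < b ∧ b ≤ 1 ∧ (∀ t ∈ Ioo 0 b, γ t ∈ U) ∧ (b = 1 ∨ γ b ∉ U) := by
    rcases S.eq_empty_or_nonempty with he | hne
    · refine ⟨1, zero_lt_one, le_rfl, fun t ht => ?_, Or.inl rfl⟩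
      by_contra hn
      exact he.subset (⟨Ioo_subset_Icc_self ht, hn⟩ : t ∈ S)
    · obtain ⟨b, hbS, hb⟩ := hSc.exists_isLeast hne
      refine ⟨b, lt_of_le_of_ne hbS.1.1 fun h0 => hbS.2 (h0 ▸ hvU), hbS.1.2, fun t ht => ?_,
        Or.inr hbS.2⟩
      by_contra hn
      exact absurd (hb ⟨⟨ht.1.le, ht.2.le.trans hbS.1.2⟩, hn⟩) (not_le.2 ht.2)
  obtain ⟨b, hb0, hb1, hin, hend⟩ := hex
  refine ⟨γ '' Icc 0 b, IsPiece.of_interval h le_rfl hb0 hb1 hin (Or.inl rfl) hend, ?_⟩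
  rw [h.endpoints_image le_rfl hb0 hb1]
  exact Or.inl rfl

theorem IsPiece.finite (hU : IsOpen U) (he : IsSmoothArc e) {K : Set (Space n)} (hKU : K ⊆ U)
    (hK : IsCompact K) : {c | IsPiece U e c ∧ (c ∩ K).Nonempty}.Finite := by
  obtain ⟨γ, h⟩ := id he
  -- near a parameter in `K`, at distance `< η`, the curve stays in `U`
  have hη : ∃ η > 0, ∀ t ∈ Icc (0 : ℝ) 1, γ t ∈ K → ∀ s ∈ Icc (0 : ℝ) 1, |s - t| < η → γ s ∈ U := by
    have hT : IsCompact {t ∈ Icc (0 : ℝ) 1 | γ t ∈ K} :=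
      isCompact_Icc.of_isClosed_subset
        (h.smooth.continuousOn.preimage_isClosed_of_isClosed isClosed_Icc hK.isClosed)
        inter_subset_left
    obtain ⟨O, hO, hOU⟩ := (continuousOn_iff'.1 h.smooth.continuousOn) U hU
    have hsub : {t ∈ Icc (0 : ℝ) 1 | γ t ∈ K} ⊆ O := fun t ht =>
      (hOU.subset ⟨hKU ht.2, ht.1⟩).1
    obtain ⟨η, hη, hηO⟩ := hT.exists_thickening_subset_open hO hsub
    refine ⟨η, hη, fun t ht htK s hs hst => (hOU.symm.subset ⟨hηO ?_, hs⟩).1⟩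
    exact Metric.mem_thickening_iff.2 ⟨t, ⟨ht, htK⟩, by rwa [Real.dist_eq]⟩
  obtain ⟨η, hη0, hη⟩ := hη
  obtain ⟨N, hN⟩ := exists_nat_gt (1 / η)
  have hN0 : (0 : ℝ) < N := lt_trans (by positivity) hN
  have hNη : 1 / (N : ℝ) < η := by
    rw [div_lt_iff₀ hN0]; rw [div_lt_iff₀ hη0] at hN; linarith
  -- every such piece contains one of finitely many points of `U`
  have key : ∀ c, IsPiece U e c ∧ (c ∩ K).Nonempty →
      ∃ i : ℕ, i ∈ Iic N ∧ γ (i / N) ∈ c ∧ γ (i / N) ∈ U := by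
    rintro c ⟨hc, p, hpc, hpK⟩
    obtain ⟨a, b, ha, hab, hb, rfl, hin, h0, h1⟩ := hc.exists_interval h
    obtain ⟨t, ht, rfl⟩ := hpc
    have ht01 : t ∈ Icc (0 : ℝ) 1 := ⟨ha.trans ht.1, ht.2.trans hb⟩
    have hf1 : ((⌊t * N⌋₊ : ℕ) : ℝ) ≤ t * N := Nat.floor_le (by nlinarith [ht01.1])
    have hf2 : t * N < (⌊t * N⌋₊ : ℕ) + 1 := Nat.lt_floor_add_one _
    set s : ℝ := (⌊t * N⌋₊ : ℕ) / N with hs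
    have hst : s ≤ t := by rw [hs, div_le_iff₀ hN0]; exact hf1
    have hts : t - s < η := by
      have : t < s + 1 / N := by rw [hs, ← add_div, lt_div_iff₀ hN0]; exact hf2
      linarith
    have hs0 : 0 ≤ s := by positivity
    have hs01 : s ∈ Icc (0 : ℝ) 1 := ⟨hs0, hst.trans ht01.2⟩
    have hsU : γ s ∈ U := hη t ht01 hpK s hs01 (by rw [abs_lt]; constructor <;> linarith)
    refine ⟨⌊t * N⌋₊, ?_, mem_image_of_mem _ ⟨?_, hst.trans ht.2⟩, hsU⟩
    · have : ((⌊t * N⌋₊ : ℕ) : ℝ) ≤ N := hf1.trans (by nlinarith [ht01.2])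
      exact_mod_cast this
    · rcases h0 with rfl | h0
      · exact hs0
      · by_contra hlt
        push Not at hlt
        exact h0 (hη t ht01 hpK a ⟨ha, hab.le.trans hb⟩
          (by rw [abs_lt]; constructor <;> linarith [ht.1]))
  choose! i hi1 hi2 hi3 using key
  refine Set.Finite.of_finite_image ((finite_Iic N).subset (image_subset_iff.2 hi1)) (f := i) ?_
  intro c hc c' hc' hcc
  refine hc.1.eq_of_mem hc'.1 he (hi2 c hc) ?_ (hi3 c hc)
  rw [hcc]; exact hi2 c' hc'

end Pieces

namespace EmbeddedGraph

/-- The intersection `G ∩ U` of an embedded graph in `ℝⁿ` with an open set `U`. Its edges are the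
connected components of the sets `e ∩ U`, where `e` is an edge of `G`. -/
def restrict (G : EmbeddedGraph (univ : Set (Space n))) (U : Set (Space n)) (hU : IsOpen U) :
    EmbeddedGraph U where
  edges := {c | ∃ e ∈ G.edges, IsPiece U e c}
  isSmoothArc := fun _ ⟨_, _, hc⟩ => hc.isSmoothArc
  interior_subset := fun _ ⟨_, _, hc⟩ => hc.interior_subset
  inter_subset := by
    rintro c ⟨e, he, hc⟩ c' ⟨e', he', hc'⟩ hne p ⟨hp, hp'⟩
    by_cases hpU : p ∈ U
    · by_cases hee : e = e'
      · subst hee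
        exact absurd (hc.eq_of_mem hc' (G.isSmoothArc e he) hp hp' hpU) hne
      · have hpe := G.inter_subset e he e' he' hee ⟨hc.subset hp, hc'.subset hp'⟩
        have key : ∀ {e c : Set (Space n)}, e ∈ G.edges → IsPiece U e c → p ∈ c →
            p ∈ endpoints e → p ∈ endpoints c := by
          intro e c he hc hpc hpe
          obtain ⟨d, hd, hpd⟩ := IsPiece.exists_of_endpoint hU hpe hpU
          rwa [hc.eq_of_mem hd (G.isSmoothArc e he) hpc (endpoints_subset _ hpd) hpU]
        exact ⟨key he hc hp hpe.1, key he' hc' hp' hpe.2⟩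
    · constructor
      · by_contra hn; exact hpU (hc.interior_subset ⟨hp, hn⟩)
      · by_contra hn; exact hpU (hc'.interior_subset ⟨hp', hn⟩)
  three_le_degree := by
    rintro v hvU ⟨c, ⟨e, he, hc⟩, hvc⟩
    have hve : v ∈ endpoints e := (hc.endpoints_subset hvc).resolve_right (fun h => h hvU)
    refine (G.three_le_degree v (mem_univ _) ⟨e, he, hve⟩).trans ?_
    have hex : ∀ e' ∈ {e ∈ G.edges | v ∈ endpoints e}, ∃ c, IsPiece U e' c ∧ v ∈ endpoints c :=
      fun e' he' => IsPiece.exists_of_endpoint hU he'.2 hvU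
    choose! f hf1 hf2 using hex
    refine encard_le_encard_of_injOn (f := f) (fun e' he' => ⟨⟨e', he'.1, hf1 e' he'⟩, hf2 e' he'⟩) ?_
    intro e₁ h₁ e₂ h₂ h12
    by_contra hne
    obtain ⟨γ, hγ⟩ := (hf1 e₁ h₁).isSmoothArc
    obtain ⟨δ, hδ⟩ := G.isSmoothArc e₁ h₁.1
    have hsub : f e₁ ⊆ endpoints e₁ := fun p hp =>
      (G.inter_subset e₁ h₁.1 e₂ h₂.1 hne
        ⟨(hf1 e₁ h₁).subset hp, (hf1 e₂ h₂).subset (h12 ▸ hp)⟩).1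
    have hinf : (f e₁).Infinite := by
      rw [← hγ.image]
      exact (Icc_infinite zero_lt_one).image hγ.inj
    refine hinf (Finite.subset ?_ hsub)
    rw [hδ.endpoints_eq]
    exact (finite_singleton _).insert _
  tangents_disjoint := by
    rintro v hvU c ⟨e, he, hc⟩ c' ⟨e', he', hc'⟩ hne
    have key : ∀ {e c : Set (Space n)}, IsPiece U e c → tangents c v ⊆ tangents e v := by
      rintro e c hc _ ⟨δ, hδ, rfl, rfl⟩
      obtain ⟨γ, hγ, h0⟩ := (hc.endpoints_subset ⟨δ, hδ, rfl⟩).resolve_right (fun h => h hvU)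
      exact ⟨γ, hγ, h0, hγ.unitTangent_eq hδ hc.subset h0⟩
    by_cases hee : e = e'
    · subst hee
      rw [Set.disjoint_left]
      rintro _ ⟨δ, hδ, h0, -⟩ ⟨δ', hδ', h0', -⟩
      exact hne (hc.eq_of_mem hc' (G.isSmoothArc e he) (endpoints_subset _ ⟨δ, hδ, h0⟩)
        (endpoints_subset _ ⟨δ', hδ', h0'⟩) hvU)
    · exact (G.tangents_disjoint v (mem_univ _) e he e' he' hee).mono (key hc) (key hc')
  locallyFinite := by
    intro K hKU hK
    refine ((G.locallyFinite K (subset_univ _) hK).biUnion fun e he =>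
      IsPiece.finite hU (G.isSmoothArc e he.1) hKU hK).subset ?_
    rintro c ⟨⟨e, he, hc⟩, p, hpc, hpK⟩
    exact mem_biUnion (⟨he, p, hc.subset hpc, hpK⟩ : e ∈ {e ∈ G.edges | (e ∩ K).Nonempty})
      ⟨hc, p, hpc, hpK⟩

end EmbeddedGraph

/-! ### The smooth topology of topological types -/

/-- `W'` has the same topological type as `W`, through an isomorphism (matching edges by `Φ` and
vertices by `Ψ`) under which each edge of `W'` is `ε`-close in `C^k` to the corresponding edge of
`W`, the latter being parametrized by `γ`. -/
def SmoothlyClose {U : Set (Space n)} (W : EmbeddedGraph U) (γ : W.edges → ℝ → Space n) (k : ℕ)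
    (ε : ℝ) (W' : EmbeddedGraph U) : Prop :=
  ∃ (Φ : W.edges ≃ W'.edges) (Ψ : W.vertices ≃ W'.vertices) (γ' : W.edges → ℝ → Space n),
    (∀ e, IsParam (γ' e) (Φ e : Set (Space n))) ∧
    (∀ e (v : W.vertices), (γ e 0 = v ↔ γ' e 0 = Ψ v) ∧ (γ e 1 = v ↔ γ' e 1 = Ψ v)) ∧
    (∀ e, ∀ i ≤ k, ∀ t ∈ Icc (0 : ℝ) 1,
      ‖iteratedDerivWithin i (γ e) (Icc 0 1) t - iteratedDerivWithin i (γ' e) (Icc 0 1) t‖ < ε)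

theorem SmoothlyClose.mono {U : Set (Space n)} {W W' : EmbeddedGraph U}
    {γ : W.edges → ℝ → Space n} {k k' : ℕ} {ε ε' : ℝ} (h : SmoothlyClose W γ k ε W')
    (hk : k' ≤ k) (hε : ε ≤ ε') : SmoothlyClose W γ k' ε' W' := by
  obtain ⟨Φ, Ψ, γ', h1, h2, h3⟩ := h
  exact ⟨Φ, Ψ, γ', h1, h2, fun e i hi t ht => (h3 e i (hi.trans hk) t ht).trans_le hε⟩

/-- The smooth topology of topological types: the disjoint union of the topological types, in each
of which graphs converge when their edges converge smoothly, up to reparametrization. -/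
instance {U : Set (Space n)} : TopologicalSpace (EmbeddedGraph U) where
  IsOpen O := ∀ W ∈ O, ∀ γ : W.edges → ℝ → Space n, (∀ e, IsParam (γ e) (e : Set (Space n))) →
    ∃ (k : ℕ) (ε : ℝ), 0 < ε ∧ ∀ W', SmoothlyClose W γ k ε W' → W' ∈ O
  isOpen_univ := fun _ _ _ _ => ⟨0, 1, zero_lt_one, fun _ _ => mem_univ _⟩
  isOpen_inter := by
    intro O O' hO hO' W hW γ hγ
    obtain ⟨k, ε, hε, h⟩ := hO W hW.1 γ hγ
    obtain ⟨k', ε', hε', h'⟩ := hO' W hW.2 γ hγ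
    exact ⟨max k k', min ε ε', lt_min hε hε', fun W' hW' =>
      ⟨h W' (hW'.mono (le_max_left _ _) (min_le_left _ _)),
        h' W' (hW'.mono (le_max_right _ _) (min_le_right _ _))⟩⟩
  isOpen_sUnion := by
    rintro S hS W ⟨O, hO, hW⟩ γ hγ
    obtain ⟨k, ε, hε, h⟩ := hS O hO W hW γ hγ
    exact ⟨k, ε, hε, fun W' hW' => ⟨O, hO, h W' hW'⟩⟩

instance {U : Set (Space n)} : MeasurableSpace (EmbeddedGraph U) := borel _

instance {U : Set (Space n)} : BorelSpace (EmbeddedGraph U) := ⟨rfl⟩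

/-! ### Geometric cloths and local geometric convergence -/

/-- An embedded graph in `ℝⁿ`. -/
abbrev EucGraph (n : ℕ) := EmbeddedGraph (univ : Set (Space n))

/-- The embedded graphs in the open ball of radius `r` about the origin. -/
abbrev BallGraph (n : ℕ) (r : ℝ) := EmbeddedGraph (Metric.ball (0 : Space n) r)

/-- The part of `G` in the open ball of radius `r` about `x`, moved to the origin. -/
def EmbeddedGraph.window (G : EucGraph n) (r : ℝ) (x : Space n) : BallGraph n r :=
  (G.translate (-x)).restrict (Metric.ball 0 r) Metric.isOpen_ball

/-- The law of the window of radius `r` about a uniformly random point of `K`. -/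
def EmbeddedGraph.windowLaw (G : EucGraph n) (r : ℝ) (K : Set (Space n)) :
    Measure (BallGraph n r) :=
  (ProbabilityTheory.cond volume K).map (G.window r)

/-- Weak convergence of measures: convergence of the integrals of bounded continuous functions. -/
def WeaklyConverges {X : Type*} [TopologicalSpace X] [MeasurableSpace X] (μ : ℕ → Measure X)
    (ν : Measure X) : Prop :=
  ∀ f : BoundedContinuousFunction X ℝ, Tendsto (fun i => ∫ x, f x ∂(μ i)) atTop (𝓝 (∫ x, f x ∂ν))

/-- `G` has a smooth geometric cloth, with local distributions `P r`. If `G` is infinite, these are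
the weak limits (for the smooth topology of topological types) of the window laws in the balls
`B_i`; if `G` is finite, they are its window laws in its convex hull. -/
def EmbeddedGraph.HasSmoothGeometricCloth (G : EucGraph n)
    (P : ∀ r : ℕ, Measure (BallGraph n r)) : Prop :=
  (G.edges.Infinite → ∀ r : ℕ, IsProbabilityMeasure (P r) ∧
    WeaklyConverges (fun i : ℕ => G.windowLaw r (Metric.ball 0 i)) (P r)) ∧
  (G.edges.Finite → ∀ r : ℕ, P r = G.windowLaw r (convexHull ℝ (⋃₀ G.edges)))

/-- Local geometric convergence of a sequence of embedded graphs. -/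
def LocallyGeometricallyConvergent (G : ℕ → EucGraph n) : Prop :=
  ∃ P : ∀ _ r : ℕ, Measure (BallGraph n r),
    (∀ j, (G j).HasSmoothGeometricCloth (P j)) ∧
    ∃ Ξ : ∀ r : ℕ, Measure (BallGraph n r),
      ∀ r, IsProbabilityMeasure (Ξ r) ∧ WeaklyConverges (fun j => P j r) (Ξ r)

/-- Vertex degrees are at most `D` with probability one with respect to the local distributions of
the smooth geometric cloth. -/
def EmbeddedGraph.DegreesAlmostSurelyLE (G : EucGraph n) (D : ℕ) : Prop :=
  ∀ P, G.HasSmoothGeometricCloth P → ∀ r, ∀ᵐ W ∂(P r), ∀ v ∈ W.vertices, W.degree v ≤ (D : ℕ∞)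

/-! ### Swatches and topological cloths -/

/-- A graph with a root and a distinguished colour class. -/
structure RootedBipartiteGraph (α : Type*) where
  graph : SimpleGraph α
  vertexCells : Set α
  root : α

/-- Isomorphism of rooted two-coloured graphs. -/
def RootedBipartiteGraph.Isomorphic {α β : Type*} (A : RootedBipartiteGraph α)
    (B : RootedBipartiteGraph β) : Prop :=
  ∃ φ : A.graph ≃g B.graph, (∀ a, a ∈ A.vertexCells ↔ φ a ∈ B.vertexCells) ∧ φ A.root = B.root

/-- Isomorphism, on the finite rooted two-coloured graphs whose cells are numbered. -/
instance swatchSetoid : Setoid (Σ m : ℕ, RootedBipartiteGraph (Fin m)) where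
  r A B := A.2.Isomorphic B.2
  iseqv :=
    { refl := fun _ => ⟨SimpleGraph.Iso.refl, fun _ => Iff.rfl, rfl⟩
      symm := by
        rintro A B ⟨φ, h1, h2⟩
        exact ⟨φ.symm, fun b => by rw [h1]; simp, by rw [← h2]; simp⟩
      trans := by
        rintro A B C ⟨φ, h1, h2⟩ ⟨ψ, h3, h4⟩
        exact ⟨ψ.comp φ, fun a => by rw [h1, h3]; rfl, by rw [← h4, ← h2]; rfl⟩ }

/-- Swatch types: isomorphism classes of finite rooted two-coloured graphs. -/
abbrev SwatchType := Quotient swatchSetoid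

section Swatches

variable {α β : Type*}

/-- The bipartite graph of a multigraph `H`, on its vertices and edges. -/
def cellGraph (H : Graph α β) : SimpleGraph (α ⊕ β) :=
  SimpleGraph.fromRel fun c d => ∃ v e, c = Sum.inl v ∧ d = Sum.inr e ∧ H.Inc e v

/-- The swatch of radius `k` at `v`: the ball of radius `k` about `v` in the cell graph. -/
def swatch (H : Graph α β) (k : ℕ) (v : α) :
    RootedBipartiteGraph {c // (cellGraph H).edist (Sum.inl v) c ≤ k} where
  graph := (cellGraph H).comap Subtype.val
  vertexCells := {c | c.1.isLeft}
  root := ⟨Sum.inl v, by simp⟩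

/-- The proportion of the vertices of `H` whose swatch of radius `k` has type `S`. -/
def swatchFrequency (H : Graph α β) (k : ℕ) (S : SwatchType) : ℝ :=
  ({v ∈ H.vertexSet | ∃ A, Quotient.mk swatchSetoid A = S ∧
    (swatch H k v).Isomorphic A.2}.ncard : ℝ) / (H.vertexSet.ncard : ℝ)

/-- A family of probability distributions on swatch types, one for each radius. -/
abbrev TopologicalCloth := ℕ → PMF SwatchType

/-- Local topological (Benjamini-Schramm) convergence of finite graphs: for each radius, the
distribution of swatch types converges to a probability distribution. -/
def LocallyTopologicallyConverges {ι : Type*} (H : ι → Graph α β) (l : Filter ι)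
    (σ : TopologicalCloth) : Prop :=
  ∀ k S, Tendsto (fun i => swatchFrequency (H i) k S) l (𝓝 (σ k S).toReal)

end Swatches

namespace EmbeddedGraph

/-- `I_s(G)`: the vertices and edges of `G` contained in the open ball of radius `s`. -/
def inner (G : EucGraph n) (s : ℝ) : Graph (Space n) (Set (Space n)) where
  vertexSet := G.vertices ∩ Metric.ball 0 s
  IsLink e x y := e ∈ G.edges ∧ e ⊆ Metric.ball 0 s ∧ endpoints e = {x, y}
  edgeSet := {e ∈ G.edges | e ⊆ Metric.ball 0 s}
  isLink_symm := fun _ _ => ⟨fun _ _ h => ⟨h.1, h.2.1, h.2.2.trans (pair_comm _ _)⟩⟩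
  eq_or_eq_of_isLink_of_isLink := by
    rintro e x y v w ⟨-, -, h⟩ ⟨-, -, h'⟩
    have : x ∈ ({v, w} : Set (Space n)) := by rw [← h', h]; exact Or.inl rfl
    exact this
  edge_mem_iff_exists_isLink := by
    refine fun e => ⟨fun ⟨he, hs⟩ => ?_, fun ⟨_, _, he, hs, _⟩ => ⟨he, hs⟩⟩
    obtain ⟨γ, h⟩ := G.isSmoothArc e he
    exact ⟨_, _, he, hs, h.endpoints_eq⟩
  left_mem_of_isLink := by
    rintro e x y ⟨he, hs, h⟩
    have hx : x ∈ endpoints e := h ▸ Or.inl rfl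
    exact ⟨⟨mem_univ _, e, he, hx⟩, hs (endpoints_subset e hx)⟩

/-- `G` has the inner-regular topological cloth `σ`. -/
def HasInnerRegularCloth (G : EucGraph n) (σ : TopologicalCloth) : Prop :=
  LocallyTopologicallyConverges (fun s : ℝ => G.inner s) atTop σ

/-- The proportion of the edges of `I_s(G)` of length greater than `M`. -/
def longEdgeFraction (G : EucGraph n) (s M : ℝ) : ℝ :=
  ({e ∈ (G.inner s).edgeSet | ENNReal.ofReal M < μH[1] e}.ncard : ℝ) / ((G.inner s).edgeSet.ncard : ℝ)

/-- The proportion of the vertices `v` of `I_s(G)` such that the ball of radius `r` about `v`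
contains more than `N` vertices of `G`. -/
def crowdedVertexFraction (G : EucGraph n) (s r N : ℝ) : ℝ :=
  ({v ∈ (G.inner s).vertexSet | N < ((G.vertices ∩ Metric.ball v r).ncard : ℝ)}.ncard : ℝ) /
    ((G.inner s).vertexSet.ncard : ℝ)

/-- At scale `s` and up to `ε`: the vertex density is `C`, edges have length at most `M`, and balls
of radius `r` about vertices contain at most `N` vertices. -/
structure ControlledAt (G : EucGraph n) (C M N r ε s : ℝ) : Prop where
  density : |((G.inner s).vertexSet.ncard : ℝ) / volume.real (Metric.ball (0 : Space n) s) - C| < ε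
  edgeLength : G.longEdgeFraction s M < ε
  crowding : G.crowdedVertexFraction s r N < ε

end EmbeddedGraph

end EmbeddedGraphs

end

namespace EmbeddedGraphs

variable {n : ℕ}

/-! ### Balls in simple graphs -/

/-! Counting the vertices of `I_s(G)` with a given swatch type is turned into integrating a bounded
continuous function of the window. Let φ be a Lipschitz bump of integral 1 supported within radius
r/2. For a window about x, sum φ(v - x) over the vertices v whose swatch, as seen in the window, has
type S. Integrated over x in a ball, this counts each such v once, up to boundary effects
(`setIntegral_sum_le`, `setIntegral_sum_eq`). The sum is continuous in the smooth topology of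
topological types, because swatch types are constant on a topological type and φ is Lipschitz
(`continuous_markedSum`). Truncation makes it bounded, so its averages converge by the definition of
the cloth. Division by the vertex density C gives the swatch frequency up to δ
(`exists_swatchFrequency_approx`).

Three kinds of vertices are miscounted (`abs_ncard_sub_setIntegral_le`). Those in a shell at the
boundary of the ball are few by the density condition. Crowded ones, where the truncation may act,
are few by assumption. The third kind can reach, along at most k edges, an end of a long edge or a
vertex of degree above D, so that the window may fail to show the swatch or the swatch may be large.
Long edges are few by assumption and the edge bound B. Vertices of high degree are few because the
local distributions almost surely have none (`eventually_ncard_highDegree_le`).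

It remains to see that few irregular vertices spoil few swatches. Passing to neighbours multiplies
the number of vertices of degree at most D by a bounded factor. A vertex of high degree may have any
number of neighbours, but short edges lead only to nearby vertices, and a covering argument bounds
the uncrowded ones among these (`exists_ncard_uncrowded_le`). That bound depends on M(ε) and N(ε),
so vertices of high degree are controlled by a second, much smaller ε'
(`exists_forall_eventually_ncard_reach_le`).

All other swatches have at most (D + 3)^k cells, hence finitely many types, so the frequencies are
tight. Tightness and approximation of each frequency give a limiting probability distribution along
any nontrivial filter (`exists_pmf_tendsto`). For (a) the filter is s → ∞. For (b) it is the
iterated filter `Filter.curry atTop atTop`; there the test functions do not depend on j, and their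
integrals against the local distributions of the j-th graph converge. -/

theorem edist_le_succ_iff {X : Type*} (A : SimpleGraph X) (v c : X) (m : ℕ) :
    A.edist v c ≤ (m + 1 : ℕ) ↔ ∃ d, A.edist v d ≤ m ∧ (d = c ∨ A.Adj d c) := by
  constructor
  · intro h
    -- The walk is taken from `c` to `v`, so that case analysis exposes the step at `c`.
    rw [SimpleGraph.edist_comm] at h
    obtain ⟨p, hp⟩ := SimpleGraph.exists_walk_of_edist_ne_top
      (ne_top_of_le_ne_top (ENat.natCast_ne_top _) h)
    rw [← hp] at h
    cases p with
    | nil => exact ⟨v, by simp, Or.inl rfl⟩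
    | @cons _ d _ hcd q =>
      refine ⟨d, ?_, Or.inr hcd.symm⟩
      rw [SimpleGraph.edist_comm]
      refine (SimpleGraph.edist_le q).trans ?_
      have : q.length + 1 ≤ m + 1 := by exact_mod_cast h
      exact_mod_cast Nat.le_of_succ_le_succ this
  · rintro ⟨d, hd, rfl | hdc⟩
    · exact hd.trans (by exact_mod_cast Nat.le_succ m)
    · refine (SimpleGraph.edist_triangle (v := d)).trans ?_
      rw [SimpleGraph.edist_eq_one_iff_adj.2 hdc]
      push_cast
      gcongr

/-- A path of length at most `k` from `i z` stays in the ball, hence in the range of `i`, so it can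
be carried over step by step. Injectivity makes the index of each point on it unambiguous. -/
theorem edist_le_of_partial_map {X X' Z : Type*} {A : SimpleGraph X} {A' : SimpleGraph X'}
    {i : Z → X} {i' : Z → X'} (hi : Function.Injective i)
    (hadj : ∀ c d, A.Adj (i c) (i d) → A'.Adj (i' c) (i' d))
    {z : Z} {k : ℕ} (hball : ∀ c, A.edist (i z) c ≤ k → c ∈ range i) {c : Z}
    (hc : A.edist (i z) (i c) ≤ k) : A'.edist (i' z) (i' c) ≤ k := by
  have key : ∀ m : ℕ, m ≤ k → ∀ c, A.edist (i z) (i c) ≤ m → A'.edist (i' z) (i' c) ≤ m := by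
    intro m
    induction m with
    | zero =>
      intro _ c hc
      have : i z = i c := SimpleGraph.edist_eq_zero_iff.1 (le_antisymm hc zero_le)
      rw [hi this]; simp
    | succ m ih =>
      intro hm c hc
      obtain ⟨d, hd, hdc⟩ := (edist_le_succ_iff _ _ _ _).1 hc
      obtain ⟨d, rfl⟩ := hball d (hd.trans (by exact_mod_cast (Nat.le_of_succ_le hm)))
      refine (edist_le_succ_iff _ _ _ _).2 ⟨i' d, ih (Nat.le_of_succ_le hm) d hd, ?_⟩
      exact hdc.imp (fun h => by rw [hi h]) (hadj d c)
  exact key k le_rfl c hc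

/-- Each step multiplies the size of the ball by at most `d + 1`: every point is kept and
contributes its neighbours. -/
theorem finite_ball {X : Type*} {A : SimpleGraph X} {v : X} {k d : ℕ}
    (hd : ∀ c, A.edist v c ≤ k → {x | A.Adj c x}.encard ≤ d) :
    {c | A.edist v c ≤ k}.encard ≤ ((d + 1) ^ k : ℕ) := by
  have key : ∀ m : ℕ, m ≤ k → {c | A.edist v c ≤ m}.encard ≤ ((d + 1) ^ m : ℕ) := by
    intro m
    induction m with
    | zero =>
      intro _
      have : {c | A.edist v c ≤ (0 : ℕ)} = {v} := by
        ext c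
        simp only [Nat.cast_zero, nonpos_iff_eq_zero, SimpleGraph.edist_eq_zero_iff]
        exact eq_comm
      rw [this]; simp
    | succ m ih =>
      intro hm
      have hm' := ih (Nat.le_of_succ_le hm)
      have hfin : {c | A.edist v c ≤ m}.Finite :=
        finite_of_encard_le_coe hm'
      have hsub : {c | A.edist v c ≤ (m + 1 : ℕ)} ⊆
          ⋃ c ∈ hfin.toFinset, insert c {x | A.Adj c x} := by
        intro c hc
        obtain ⟨b, hb, hbc⟩ := (edist_le_succ_iff _ _ _ _).1 hc
        simp only [mem_iUnion, Set.Finite.mem_toFinset]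
        exact ⟨b, hb, hbc.imp Eq.symm id⟩
      have hone : ∀ c ∈ hfin.toFinset, (insert c {x | A.Adj c x}).encard ≤ ((d + 1 : ℕ) : ℕ∞) := by
        intro c hc
        refine (encard_insert_le _ _).trans ?_
        push_cast
        gcongr
        exact hd c ((hfin.mem_toFinset.1 hc).trans (by exact_mod_cast (Nat.le_of_succ_le hm)))
      calc _ ≤ _ := encard_le_encard hsub
        _ ≤ ∑ c ∈ hfin.toFinset, (insert c {x | A.Adj c x}).encard :=
          Finset.set_encard_biUnion_le _ _
        _ ≤ ∑ _c ∈ hfin.toFinset, ((d + 1 : ℕ) : ℕ∞) := Finset.sum_le_sum hone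
        _ = (hfin.toFinset.card : ℕ∞) * ((d + 1 : ℕ) : ℕ∞) := by
          rw [Finset.sum_const, nsmul_eq_mul]
        _ ≤ (((d + 1) ^ m : ℕ) : ℕ∞) * ((d + 1 : ℕ) : ℕ∞) := by
          gcongr
          rw [hfin.encard_eq_coe_toFinset_card] at hm'
          exact_mod_cast hm'
        _ = _ := by rw [pow_succ]; push_cast; rfl
  exact key k le_rfl

/-! ### Swatches -/

section

variable {α β α' β' : Type*}

@[simp] theorem cellGraph_adj_inl_inr {H : Graph α β} {v : α} {e : β} :
    (cellGraph H).Adj (Sum.inl v) (Sum.inr e) ↔ H.Inc e v := by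
  simp [cellGraph]

@[simp] theorem cellGraph_adj_inr_inl {H : Graph α β} {v : α} {e : β} :
    (cellGraph H).Adj (Sum.inr e) (Sum.inl v) ↔ H.Inc e v := by
  simp [cellGraph]

@[simp] theorem not_cellGraph_adj_inl_inl {H : Graph α β} {v w : α} :
    ¬ (cellGraph H).Adj (Sum.inl v) (Sum.inl w) := by
  simp [cellGraph]

@[simp] theorem not_cellGraph_adj_inr_inr {H : Graph α β} {e f : β} :
    ¬ (cellGraph H).Adj (Sum.inr e) (Sum.inr f) := by
  simp [cellGraph]

theorem RootedBipartiteGraph.Isomorphic.symm {α β : Type*} {A : RootedBipartiteGraph α}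
    {B : RootedBipartiteGraph β} (h : A.Isomorphic B) : B.Isomorphic A := by
  obtain ⟨φ, h1, h2⟩ := h
  exact ⟨φ.symm, fun b => by rw [h1]; simp, by rw [← h2]; simp⟩

theorem RootedBipartiteGraph.Isomorphic.trans {α β δ : Type*} {A : RootedBipartiteGraph α}
    {B : RootedBipartiteGraph β} {C : RootedBipartiteGraph δ} (h : A.Isomorphic B)
    (h' : B.Isomorphic C) : A.Isomorphic C := by
  obtain ⟨φ, h1, h2⟩ := h
  obtain ⟨ψ, h3, h4⟩ := h'
  exact ⟨ψ.comp φ, fun a => by rw [h1, h3]; rfl, by rw [← h4, ← h2]; rfl⟩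

/-- The swatch of radius `k` at `v` has type `S`. -/
def HasSwatchType (H : Graph α β) (k : ℕ) (S : SwatchType) (v : α) : Prop :=
  ∃ A, Quotient.mk swatchSetoid A = S ∧ (swatch H k v).Isomorphic A.2

theorem HasSwatchType.unique {H : Graph α β} {k : ℕ} {S S' : SwatchType} {v : α}
    (h : HasSwatchType H k S v) (h' : HasSwatchType H k S' v) : S = S' := by
  obtain ⟨A, rfl, hA⟩ := h
  obtain ⟨B, rfl, hB⟩ := h'
  exact Quotient.sound (hA.symm.trans hB)

/-- Two cell graphs with a common part, indexed by `Z`, that contains the balls of radius `k`. -/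
theorem swatch_isomorphic {Z : Type*} {H : Graph α β} {H' : Graph α' β'} {k : ℕ}
    {i : Z → α ⊕ β} {i' : Z → α' ⊕ β'} (hi : Function.Injective i) (hi' : Function.Injective i')
    (hadj : ∀ c d, (cellGraph H).Adj (i c) (i d) ↔ (cellGraph H').Adj (i' c) (i' d))
    (hleft : ∀ c, (i c).isLeft = (i' c).isLeft) {z : Z} {v : α} {v' : α'}
    (hz : i z = Sum.inl v) (hz' : i' z = Sum.inl v')
    (hball : ∀ c, (cellGraph H).edist (Sum.inl v) c ≤ k → c ∈ range i)
    (hball' : ∀ c, (cellGraph H').edist (Sum.inl v') c ≤ k → c ∈ range i') :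
    (swatch H k v).Isomorphic (swatch H' k v') := by
  have hto : ∀ c, (cellGraph H).edist (Sum.inl v) (i c) ≤ k ↔
      (cellGraph H').edist (Sum.inl v') (i' c) ≤ k := by
    rw [← hz] at hball ⊢
    rw [← hz'] at hball' ⊢
    exact fun c => ⟨edist_le_of_partial_map hi (fun c d => (hadj c d).1) hball,
      edist_le_of_partial_map hi' (fun c d => (hadj c d).2) hball'⟩
  have : Nonempty Z := ⟨z⟩
  -- `f` and `f'` recover the index in `Z` of a cell in the respective ball; the isomorphism goes
  -- through these indices.
  choose! f hf using hball
  choose! f' hf' using hball'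
  have hto1 : ∀ c, (cellGraph H).edist (Sum.inl v) c ≤ k →
      (cellGraph H').edist (Sum.inl v') (i' (f c)) ≤ k := fun c hc => by
    rw [← hto, hf c hc]; exact hc
  have hto2 : ∀ c, (cellGraph H').edist (Sum.inl v') c ≤ k →
      (cellGraph H).edist (Sum.inl v) (i (f' c)) ≤ k := fun c hc => by
    rw [hto, hf' c hc]; exact hc
  let φ : {c // (cellGraph H).edist (Sum.inl v) c ≤ k} ≃
      {c // (cellGraph H').edist (Sum.inl v') c ≤ k} :=
    { toFun := fun c => ⟨i' (f c.1), hto1 c.1 c.2⟩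
      invFun := fun c => ⟨i (f' c.1), hto2 c.1 c.2⟩
      left_inv := fun c => Subtype.ext <| by
        have : f' (i' (f c.1)) = f c.1 := hi' (hf' _ (hto1 c.1 c.2))
        simp only [this, hf c.1 c.2]
      right_inv := fun c => Subtype.ext <| by
        have : f (i (f' c.1)) = f' c.1 := hi (hf _ (hto2 c.1 c.2))
        simp only [this, hf' c.1 c.2] }
  have hφ : ∀ c, (φ c).1 = i' (f c.1) := fun _ => rfl
  refine ⟨⟨φ, ?_⟩, ?_, ?_⟩
  · intro a b
    change (cellGraph H').Adj (φ a).1 (φ b).1 ↔ (cellGraph H).Adj a.1 b.1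
    rw [hφ, hφ, ← hadj, hf _ a.2, hf _ b.2]
  · intro a
    change a.1.isLeft = true ↔ (φ a).1.isLeft = true
    rw [hφ, ← hleft, hf _ a.2]
  · apply Subtype.ext
    change i' (f (Sum.inl v)) = Sum.inl v'
    rw [← hz']
    congr 1
    exact hi ((hf _ (by simp)).trans hz.symm)

theorem finite_swatchTypes (m : ℕ) :
    (Quotient.mk swatchSetoid '' {A : Σ m : ℕ, RootedBipartiteGraph (Fin m) | A.1 ≤ m}).Finite := by
  apply Set.Finite.image
  have hfin : ∀ a : ℕ, Finite (RootedBipartiteGraph (Fin a)) := fun a => by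
    refine Finite.of_injective
      (fun A : RootedBipartiteGraph (Fin a) => (A.graph, A.vertexCells, A.root)) ?_
    rintro ⟨a, b, c⟩ ⟨a', b', c'⟩ h
    simpa using h
  have : {A : Σ m : ℕ, RootedBipartiteGraph (Fin m) | A.1 ≤ m} =
      ⋃ a ∈ Iic m, range (Sigma.mk a) := by
    ext ⟨a, A⟩
    simp only [mem_ofPred_eq, mem_iUnion, mem_Iic, mem_range, exists_prop]
    constructor
    · exact fun h => ⟨a, h, A, rfl⟩
    · rintro ⟨b, hb, B, h⟩
      cases h; exact hb
  rw [this]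
  exact (finite_Iic m).biUnion fun a _ => finite_range _

/-- The swatch types with at most `m` cells. -/
noncomputable def swatchTypesLE (m : ℕ) : Finset SwatchType := (finite_swatchTypes m).toFinset

/-- Types are classes of graphs on some `Fin m`, so a swatch has a type once it is finite: number
its cells and transport the structure. -/
theorem exists_hasSwatchType {H : Graph α β} {k m : ℕ} {v : α}
    (h : {c | (cellGraph H).edist (Sum.inl v) c ≤ k}.encard ≤ m) :
    ∃ S ∈ swatchTypesLE m, HasSwatchType H k S v := by
  have hfin : {c | (cellGraph H).edist (Sum.inl v) c ≤ k}.Finite := finite_of_encard_le_coe h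
  have : Finite {c // (cellGraph H).edist (Sum.inl v) c ≤ k} := hfin
  let e := Finite.equivFin {c // (cellGraph H).edist (Sum.inl v) c ≤ k}
  let A := swatch H k v
  let A' : RootedBipartiteGraph (Fin (Nat.card {c // (cellGraph H).edist (Sum.inl v) c ≤ k})) :=
    ⟨A.graph.comap e.symm, e.symm ⁻¹' A.vertexCells, e A.root⟩
  have hcard : Nat.card {c // (cellGraph H).edist (Sum.inl v) c ≤ k} ≤ m := by
    have h1 : Nat.card {c // (cellGraph H).edist (Sum.inl v) c ≤ k} =
      {c | (cellGraph H).edist (Sum.inl v) c ≤ k}.ncard := rfl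
    rw [h1, ← Nat.cast_le (α := ℕ∞), hfin.cast_ncard_eq]
    exact h
  refine ⟨Quotient.mk swatchSetoid ⟨_, A'⟩, ?_, ⟨_, A'⟩, rfl, ⟨e, ?_⟩, ?_, rfl⟩
  · exact (finite_swatchTypes m).mem_toFinset.2 ⟨_, hcard, rfl⟩
  · intro a b
    change A.graph.Adj (e.symm (e a)) (e.symm (e b)) ↔ _
    simp [A]
  · intro a
    change _ ↔ e.symm (e a) ∈ A.vertexCells
    simp [A]

theorem swatchFrequency_eq (H : Graph α β) (k : ℕ) (S : SwatchType) :
    swatchFrequency H k S = ({v ∈ H.vertexSet | HasSwatchType H k S v}.ncard : ℝ) /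
      (H.vertexSet.ncard : ℝ) := rfl

end

/-! ### Incidence and local finiteness -/

theorem IsSmoothArc.exists_endpoints {e : Set (Space n)} (h : IsSmoothArc e) :
    ∃ a b, endpoints e = {a, b} := by
  obtain ⟨γ, hγ⟩ := h
  exact ⟨_, _, hγ.endpoints_eq⟩

theorem IsSmoothArc.exists_endpoints_of_mem {e : Set (Space n)} (h : IsSmoothArc e) {v : Space n}
    (hv : v ∈ endpoints e) : ∃ w, endpoints e = {v, w} := by
  obtain ⟨a, b, hab⟩ := h.exists_endpoints
  rw [hab] at hv ⊢
  rcases hv with rfl | rfl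
  · exact ⟨b, rfl⟩
  · exact ⟨a, pair_comm _ _⟩

theorem IsSmoothArc.encard_endpoints_le {e : Set (Space n)} (h : IsSmoothArc e) :
    (endpoints e).encard ≤ 2 := by
  obtain ⟨a, b, hab⟩ := h.exists_endpoints
  rw [hab]
  exact (encard_insert_le _ _).trans (by rw [encard_singleton]; norm_num)

theorem IsSmoothArc.finite_endpoints {e : Set (Space n)} (h : IsSmoothArc e) :
    (endpoints e).Finite := by
  obtain ⟨a, b, hab⟩ := h.exists_endpoints
  rw [hab]
  exact toFinite _

namespace EmbeddedGraph

variable {U : Set (Space n)}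

theorem finite_vertices_inter (W : EmbeddedGraph U) {K : Set (Space n)} (hKU : K ⊆ U)
    (hK : IsCompact K) : (W.vertices ∩ K).Finite := by
  refine ((W.locallyFinite K hKU hK).biUnion fun e he =>
    (W.isSmoothArc e he.1).finite_endpoints).subset ?_
  rintro v ⟨⟨-, e, he, hv⟩, hvK⟩
  exact mem_biUnion (⟨he, v, endpoints_subset e hv, hvK⟩ : e ∈ {e ∈ W.edges | (e ∩ K).Nonempty}) hv

/-- The vertices of an embedded graph together with the edges that have both ends in `U`. -/
def interiorGraph (W : EmbeddedGraph U) : Graph (Space n) (Set (Space n)) where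
  vertexSet := W.vertices
  IsLink e x y := e ∈ W.edges ∧ endpoints e ⊆ U ∧ endpoints e = {x, y}
  edgeSet := {e ∈ W.edges | endpoints e ⊆ U}
  isLink_symm := fun _ _ => ⟨fun _ _ h => ⟨h.1, h.2.1, h.2.2.trans (pair_comm _ _)⟩⟩
  eq_or_eq_of_isLink_of_isLink := by
    rintro e x y v w ⟨-, -, h⟩ ⟨-, -, h'⟩
    have : x ∈ ({v, w} : Set (Space n)) := by rw [← h', h]; exact Or.inl rfl
    exact this
  edge_mem_iff_exists_isLink := by
    refine fun e => ⟨fun ⟨he, hs⟩ => ?_, fun ⟨_, _, he, hs, _⟩ => ⟨he, hs⟩⟩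
    obtain ⟨γ, h⟩ := W.isSmoothArc e he
    exact ⟨_, _, he, hs, h.endpoints_eq⟩
  left_mem_of_isLink := by
    rintro e x y ⟨he, hs, h⟩
    have hx : x ∈ endpoints e := h ▸ Or.inl rfl
    exact ⟨hs hx, e, he, hx⟩

theorem interiorGraph_inc {W : EmbeddedGraph U} {e : Set (Space n)} {v : Space n} :
    W.interiorGraph.Inc e v ↔ e ∈ W.edges ∧ endpoints e ⊆ U ∧ v ∈ endpoints e := by
  constructor
  · rintro ⟨w, he, hU, h⟩
    exact ⟨he, hU, h ▸ Or.inl rfl⟩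
  · rintro ⟨he, hU, hv⟩
    obtain ⟨w, hw⟩ := (W.isSmoothArc e he).exists_endpoints_of_mem hv
    exact ⟨w, he, hU, hw⟩

theorem inner_inc {G : EucGraph n} {s : ℝ} {e : Set (Space n)} {v : Space n} :
    (G.inner s).Inc e v ↔ e ∈ G.edges ∧ e ⊆ Metric.ball 0 s ∧ v ∈ endpoints e := by
  constructor
  · rintro ⟨w, he, hU, h⟩
    exact ⟨he, hU, h ▸ Or.inl rfl⟩
  · rintro ⟨he, hU, hv⟩
    obtain ⟨w, hw⟩ := (G.isSmoothArc e he).exists_endpoints_of_mem hv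
    exact ⟨w, he, hU, hw⟩

end EmbeddedGraph

/-- `cellGraph` lives on the whole of `α ⊕ β`. Points that are not cells of `H` are isolated there,
so they do not enter the ball about a vertex. -/
theorem mem_of_cellGraph_edist_le {α β : Type*} {H : Graph α β} {k : ℕ} {v : α}
    (hv : v ∈ H.vertexSet) {c : α ⊕ β} (hc : (cellGraph H).edist (Sum.inl v) c ≤ k) :
    c ∈ Sum.inl '' H.vertexSet ∪ Sum.inr '' H.edgeSet := by
  cases k with
  | zero =>
    rw [← SimpleGraph.edist_eq_zero_iff.1 (le_antisymm hc zero_le)]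
    exact Or.inl (mem_image_of_mem _ hv)
  | succ k =>
    obtain ⟨d, hd, rfl | hdc⟩ := (edist_le_succ_iff _ _ _ _).1 hc
    · exact mem_of_cellGraph_edist_le hv hd
    · rcases d with d | d <;> rcases c with c | c
      · simp at hdc
      · exact Or.inr (mem_image_of_mem _ (cellGraph_adj_inl_inr.1 hdc).edge_mem)
      · obtain ⟨w, hw⟩ := cellGraph_adj_inr_inl.1 hdc
        exact Or.inl (mem_image_of_mem _ hw.left_mem)
      · simp at hdc

/-! ### Vertex properties that depend on the topological type only -/

section

variable {U : Set (Space n)}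

/-- The property `m` of vertices is invariant under isomorphisms of topological types. -/
def TypeInvariant (m : EmbeddedGraph U → Space n → Prop) : Prop :=
  ∀ (W W' : EmbeddedGraph U) (Φ : W.edges ≃ W'.edges) (Ψ : W.vertices ≃ W'.vertices),
    (∀ (e : W.edges) (v : W.vertices), (v : Space n) ∈ endpoints (e : Set (Space n)) ↔
      (Ψ v : Space n) ∈ endpoints (Φ e : Set (Space n))) →
    (∀ e : W.edges, endpoints (e : Set (Space n)) ⊆ U ↔ endpoints (Φ e : Set (Space n)) ⊆ U) →
    ∀ v : W.vertices, m W v ↔ m W' (Ψ v)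

theorem typeInvariant_degree (D : ℕ) :
    TypeInvariant (fun (W : EmbeddedGraph U) v => (D : ℕ∞) < W.degree v) := by
  intro W W' Φ Ψ hinc _ v
  have : W.degree v = W'.degree (Ψ v) := by
    refine encard_congr ⟨fun e => ⟨Φ ⟨e.1, e.2.1⟩, (Φ _).2, (hinc ⟨e.1, e.2.1⟩ v).1 e.2.2⟩,
      fun e => ⟨Φ.symm ⟨e.1, e.2.1⟩, (Φ.symm _).2, (hinc (Φ.symm ⟨e.1, e.2.1⟩) v).2
        (by simpa using e.2.2)⟩, fun e => by simp, fun e => by simp⟩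
  simp only [this]

/-- The interior graph keeps only edges with both ends in `U`; this is why invariance is asked under
bijections that also respect that condition on edges. -/
theorem typeInvariant_hasSwatchType (k : ℕ) (S : SwatchType) :
    TypeInvariant (fun (W : EmbeddedGraph U) v => HasSwatchType W.interiorGraph k S v) := by
  intro W W' Φ Ψ hinc hU v
  have key : (swatch W.interiorGraph k v).Isomorphic (swatch W'.interiorGraph k (Ψ v)) := by
    refine swatch_isomorphic (Z := W.vertices ⊕ W.edges) (z := Sum.inl v)
      (i := Sum.map (fun u => (u : Space n)) (fun e => (e : Set (Space n))))
      (i' := Sum.map (fun u => (Ψ u : Space n)) (fun e => (Φ e : Set (Space n))))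
      (Sum.map_injective.2 ⟨Subtype.val_injective, Subtype.val_injective⟩)
      (Sum.map_injective.2 ⟨Subtype.val_injective.comp Ψ.injective,
        Subtype.val_injective.comp Φ.injective⟩) ?_ ?_ rfl rfl ?_ ?_
    · have h : ∀ e u, W.interiorGraph.Inc (e : W.edges).1 (u : W.vertices).1 ↔
          W'.interiorGraph.Inc (Φ e).1 (Ψ u).1 := fun e u => by
        simp [EmbeddedGraph.interiorGraph_inc, ← hinc, ← hU]
      rintro (c | c) (d | d) <;> simp [h]
    · rintro (c | c) <;> rfl
    · intro c hc
      rcases mem_of_cellGraph_edist_le v.2 hc with ⟨u, hu, rfl⟩ | ⟨e, he, rfl⟩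
      · exact ⟨Sum.inl ⟨u, hu⟩, rfl⟩
      · exact ⟨Sum.inr ⟨e, he.1⟩, rfl⟩
    · intro c hc
      rcases mem_of_cellGraph_edist_le (Ψ v).2 hc with ⟨u, hu, rfl⟩ | ⟨e, he, rfl⟩
      · exact ⟨Sum.inl (Ψ.symm ⟨u, hu⟩), by simp⟩
      · exact ⟨Sum.inr (Φ.symm ⟨e, he.1⟩), by simp⟩
  exact ⟨fun ⟨A, hA, h⟩ => ⟨A, hA, key.symm.trans h⟩, fun ⟨A, hA, h⟩ => ⟨A, hA, key.trans h⟩⟩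

/-- All that the continuity proof needs from smooth closeness: a combinatorial isomorphism that
moves vertices by less than `ε`. Derivatives play no role. -/
theorem SmoothlyClose.exists_equiv {W W' : EmbeddedGraph U} {γ : W.edges → ℝ → Space n}
    (hγ : ∀ e, IsParam (γ e) (e : Set (Space n))) {k : ℕ} {ε : ℝ}
    (h : SmoothlyClose W γ k ε W') :
    ∃ (Φ : W.edges ≃ W'.edges) (Ψ : W.vertices ≃ W'.vertices),
      (∀ (e : W.edges) (v : W.vertices), (v : Space n) ∈ endpoints (e : Set (Space n)) ↔
        (Ψ v : Space n) ∈ endpoints (Φ e : Set (Space n))) ∧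
      (∀ e : W.edges, endpoints (e : Set (Space n)) ⊆ U ↔ endpoints (Φ e : Set (Space n)) ⊆ U) ∧
      ∀ v : W.vertices, dist (v : Space n) (Ψ v) < ε := by
  obtain ⟨Φ, Ψ, γ', hγ', hv, hc⟩ := h
  have hclose : ∀ e, ∀ t ∈ Icc (0 : ℝ) 1, dist (γ e t) (γ' e t) < ε := fun e t ht => by
    simpa [dist_eq_norm] using hc e 0 (Nat.zero_le _) t ht
  have z : (0 : ℝ) ∈ Icc (0 : ℝ) 1 := ⟨le_rfl, zero_le_one⟩
  have o : (1 : ℝ) ∈ Icc (0 : ℝ) 1 := ⟨zero_le_one, le_rfl⟩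
  have hend : ∀ e : W.edges, endpoints (e : Set (Space n)) = {γ e 0, γ e 1} :=
    fun e => (hγ e).endpoints_eq
  have hend' : ∀ e : W.edges, endpoints (Φ e : Set (Space n)) = {γ' e 0, γ' e 1} :=
    fun e => (hγ' e).endpoints_eq
  refine ⟨Φ, Ψ, ?_, ?_, ?_⟩
  · intro e v
    rw [hend, hend', mem_insert_iff, mem_singleton_iff, mem_insert_iff, mem_singleton_iff,
      eq_comm, (hv e v).1, eq_comm (b := γ e 1), (hv e v).2, eq_comm, eq_comm (a := γ' e 1)]
  -- An endpoint of an edge lies in `U` exactly when it is a vertex, and `Ψ` matches vertices with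
  -- vertices.
  · have key : ∀ e : W.edges, ∀ t, (∀ v : W.vertices, γ e t = v ↔ γ' e t = Ψ v) →
        γ e t ∈ endpoints (e : Set (Space n)) → γ' e t ∈ endpoints (Φ e : Set (Space n)) →
        (γ e t ∈ U ↔ γ' e t ∈ U) := by
      intro e t hvt h1 h2
      constructor
      · intro ht
        rw [(hvt ⟨γ e t, ht, e, e.2, h1⟩).1 rfl]
        exact (Ψ _).2.1
      · intro ht
        have := (hvt (Ψ.symm ⟨γ' e t, ht, Φ e, (Φ e).2, h2⟩)).2 (by simp)
        rw [this]
        exact (Ψ.symm _).2.1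
    intro e
    have k0 := key e 0 (fun v => (hv e v).1) (by simp [hend]) (by simp [hend'])
    have k1 := key e 1 (fun v => (hv e v).2) (by simp [hend]) (by simp [hend'])
    rw [hend, hend', insert_subset_iff, insert_subset_iff, singleton_subset_iff,
      singleton_subset_iff, k0, k1]
  · intro v
    obtain ⟨-, e, he, hve⟩ := v.2
    rw [hend ⟨e, he⟩] at hve
    rcases hve with hve | hve
    · have := (hv ⟨e, he⟩ v).1.1 hve.symm
      rw [← this, hve]; exact hclose _ _ z
    · have := (hv ⟨e, he⟩ v).2.1 (mem_singleton_iff.1 hve).symm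
      rw [← this, mem_singleton_iff.1 hve]; exact hclose _ _ o

/-- The sum of `φ` over the vertices with the property `m`. -/
noncomputable def markedSum (φ : Space n → ℝ) (m : EmbeddedGraph U → Space n → Prop)
    (W : EmbeddedGraph U) : ℝ :=
  ∑ᶠ v : W.vertices, {w | m W w}.indicator φ v

theorem markedSum_nonneg {φ : Space n → ℝ} (hφ : ∀ v, 0 ≤ φ v)
    (m : EmbeddedGraph U → Space n → Prop) (W : EmbeddedGraph U) : 0 ≤ markedSum φ m W :=
  finsum_nonneg fun _ => indicator_nonneg (fun _ _ => hφ _) _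

/-- Near `W` the topological type is fixed, so the same vertices carry the mark. Only the finitely
many vertices near the support of `φ` contribute, and each term changes by at most `L` times the
displacement. -/
theorem continuous_markedSum {R ρ : ℝ} (hρ : ρ < R) {φ : Space n → ℝ} {L : NNReal}
    (hφ : LipschitzWith L φ) (hsupp : ∀ v, ρ ≤ ‖v‖ → φ v = 0)
    {m : BallGraph n R → Space n → Prop} (hm : TypeInvariant m) :
    Continuous (markedSum φ m) := by
  rw [continuous_def]
  intro O hO W hW γ hγ
  obtain ⟨δ, hδ, hδO⟩ := Metric.isOpen_iff.1 hO _ hW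
  -- The gap between `ρ` and `ρ'` prevents a vertex outside radius `ρ'` from moving into the
  -- support; the gap between `ρ'` and `R` gives a compact ball inside the window, hence finiteness.
  obtain ⟨ρ', hρ1, hρ2⟩ := exists_between hρ
  have hfin : {v : W.vertices | ‖(v : Space n)‖ ≤ ρ'}.Finite := by
    have hK : Metric.closedBall (0 : Space n) ρ' ⊆ Metric.ball 0 R :=
      Metric.closedBall_subset_ball hρ2
    refine Finite.of_finite_image ((W.finite_vertices_inter hK
      (isCompact_closedBall _ _)).subset ?_) Subtype.val_injective.injOn
    rintro _ ⟨v, hv, rfl⟩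
    exact ⟨v.2, by simpa using hv⟩
  set T := hfin.toFinset with hT
  set ε : ℝ := min (ρ' - ρ) (δ / (T.card * L + 1)) with hε
  have hpos : (0 : ℝ) < T.card * L + 1 := by positivity
  have hε0 : 0 < ε := lt_min (sub_pos.2 hρ1) (div_pos hδ hpos)
  -- Closeness in C^0 suffices.
  refine ⟨0, ε, hε0, fun W' hW' => hδO ?_⟩
  obtain ⟨Φ, Ψ, hinc, hU, hd⟩ := hW'.exists_equiv hγ
  have hnot : ∀ v : W.vertices, v ∉ T → φ v = 0 ∧ φ (Ψ v) = 0 := by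
    intro v hv
    have hv' : ρ' < ‖(v : Space n)‖ := by simpa [hT] using hv
    refine ⟨hsupp _ (hρ1.trans hv').le, hsupp _ ?_⟩
    have h1 : ‖(v : Space n)‖ ≤ ‖(Ψ v : Space n)‖ + dist (v : Space n) (Ψ v) := by
      rw [dist_eq_norm]
      have := norm_add_le (Ψ v : Space n) (v - Ψ v)
      simpa using this
    have h2 := (hd v).trans_le (min_le_left _ _)
    linarith
  have hsum : markedSum φ m W = ∑ v ∈ T, {w | m W w}.indicator φ v := by
    refine finsum_eq_sum_of_support_subset _ fun v hv => ?_
    by_contra hvT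
    exact hv (by simp [indicator, (hnot v hvT).1])
  have hsum' : markedSum φ m W' = ∑ v ∈ T, {w | m W' w}.indicator φ (Ψ v) := by
    rw [markedSum, ← finsum_comp_equiv Ψ]
    refine finsum_eq_sum_of_support_subset _ fun v hv => ?_
    by_contra hvT
    exact hv (by simp [indicator, (hnot v hvT).2])
  rw [Metric.mem_ball, hsum, hsum']
  calc dist (∑ v ∈ T, {w | m W' w}.indicator φ (Ψ v)) (∑ v ∈ T, {w | m W w}.indicator φ v)
      ≤ ∑ v ∈ T, dist ({w | m W' w}.indicator φ (Ψ v)) ({w | m W w}.indicator φ v) :=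
        dist_sum_sum_le _ _ _
    _ ≤ ∑ _v ∈ T, L * ε := by
        refine Finset.sum_le_sum fun v _ => ?_
        by_cases hmv : m W v
        · rw [indicator_of_mem (show (v : Space n) ∈ {w | m W w} from hmv),
            indicator_of_mem (show (Ψ v : Space n) ∈ {w | m W' w} from (hm W W' Φ Ψ hinc hU v).1 hmv),
            dist_comm]
          refine (hφ.dist_le_mul _ _).trans ?_
          gcongr
          exact (hd v).le
        · rw [indicator_of_notMem (show (v : Space n) ∉ {w | m W w} from hmv),
            indicator_of_notMem (show (Ψ v : Space n) ∉ {w | m W' w} from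
              fun h => hmv ((hm W W' Φ Ψ hinc hU v).2 h)), dist_self]
          positivity
    _ = T.card * L * ε := by rw [Finset.sum_const, nsmul_eq_mul, mul_assoc]
    _ ≤ T.card * L * (δ / (T.card * L + 1)) := by
        gcongr
        exact min_le_right _ _
    _ < δ := by
        rw [mul_div_assoc', div_lt_iff₀ hpos]
        nlinarith

/-- The sum of `φ` over the vertices with the property `m`, cut off at `K`. -/
noncomputable def cutoffSum {R ρ : ℝ} (hρ : ρ < R) {φ : Space n → ℝ} {L : NNReal}
    (hφ : LipschitzWith L φ) (hφ0 : ∀ v, 0 ≤ φ v) (hsupp : ∀ v, ρ ≤ ‖v‖ → φ v = 0)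
    {m : BallGraph n R → Space n → Prop} (hm : TypeInvariant m) (K : ℝ) (hK : 0 ≤ K) :
    BoundedContinuousFunction (BallGraph n R) ℝ :=
  BoundedContinuousFunction.ofNormedAddCommGroup (fun W => min K (markedSum φ m W))
    (continuous_const.min (continuous_markedSum hρ hφ hsupp hm)) K fun W => by
      rw [Real.norm_of_nonneg (le_min hK (markedSum_nonneg hφ0 m W))]
      exact min_le_left _ _

end

/-! ### Windows -/

theorem isPiece_self {U e : Set (Space n)} (he : IsSmoothArc e) (heU : e ⊆ U) : IsPiece U e e :=
  ⟨he, subset_rfl, sdiff_subset.trans heU, subset_union_left⟩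

/-- A piece can stop before the end of `e` only at a point outside `U`. This identifies the edges of
a window that do not leave it with whole edges of the graph. -/
theorem IsPiece.eq_self {U e c : Set (Space n)} (hc : IsPiece U e c) (he : IsSmoothArc e)
    (hU : endpoints c ⊆ U) : c = e := by
  obtain ⟨γ, hγ⟩ := he
  obtain ⟨a, b, ha, hab, hb, rfl, -, h0, h1⟩ := hc.exists_interval hγ
  rw [hγ.endpoints_image ha hab hb] at hU
  have ha0 : a = 0 := h0.resolve_right (not_not.2 (hU (Or.inl rfl)))
  have hb1 : b = 1 := h1.resolve_right (not_not.2 (hU (Or.inr rfl)))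
  rw [ha0, hb1, hγ.image]

namespace EmbeddedGraph

variable {G : EucGraph n} {R s : ℝ} {x : Space n}

theorem mem_vertices_window {w : Space n} :
    w ∈ (G.window R x).vertices ↔ w + x ∈ G.vertices ∧ w ∈ Metric.ball 0 R := by
  constructor
  · rintro ⟨hw, c, ⟨_, ⟨e, he, rfl⟩, hc⟩, hwc⟩
    have h := (endpoints_translate _ _ _).1
      ((hc.endpoints_subset hwc).resolve_right (fun h => h hw))
    rw [neg_neg] at h
    exact ⟨⟨mem_univ _, e, he, h⟩, hw⟩
  · rintro ⟨⟨-, e, he, hwe⟩, hw⟩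
    have h : w ∈ endpoints ((· + -x) '' e) := (endpoints_translate _ _ _).2 (by rwa [neg_neg])
    obtain ⟨c, hc, hwc⟩ := IsPiece.exists_of_endpoint Metric.isOpen_ball h hw
    exact ⟨hw, c, ⟨_, ⟨e, he, rfl⟩, hc⟩, hwc⟩

theorem interiorGraph_window_inc {e : Set (Space n)} {w : Space n} :
    (G.window R x).interiorGraph.Inc ((· + -x) '' e) (w + -x) ↔
      e ∈ G.edges ∧ e ⊆ Metric.ball x R ∧ w ∈ endpoints e := by
  have hball : (· + -x) '' e ⊆ Metric.ball 0 R ↔ e ⊆ Metric.ball x R := by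
    rw [image_subset_iff]
    refine forall₂_congr fun p _ => ?_
    simp [dist_eq_norm, sub_eq_add_neg]
  have hend : w + -x ∈ endpoints ((· + -x) '' e) ↔ w ∈ endpoints e := by
    rw [endpoints_translate]; simp
  rw [interiorGraph_inc, hend]
  constructor
  · rintro ⟨⟨_, ⟨e', he', rfl⟩, hc⟩, hU, hw⟩
    have harc : IsSmoothArc ((· + -x) '' e') := by
      obtain ⟨γ, h⟩ := G.isSmoothArc e' he'
      exact ⟨_, h.translate (-x)⟩
    have hee : e = e' := (add_left_injective (-x)).image_injective (hc.eq_self harc hU)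
    subst hee
    refine ⟨he', hball.1 fun p hp => ?_, hw⟩
    by_cases hpe : p ∈ endpoints ((· + -x) '' e)
    · exact hU hpe
    · exact hc.interior_subset ⟨hp, hpe⟩
  · rintro ⟨he, heU, hw⟩
    have harc : IsSmoothArc ((· + -x) '' e) := by
      obtain ⟨γ, h⟩ := G.isSmoothArc e he
      exact ⟨_, h.translate (-x)⟩
    exact ⟨⟨_, ⟨e, he, rfl⟩, isPiece_self harc (hball.2 heU)⟩,
      (endpoints_subset _).trans (hball.2 heU), hw⟩

/-- Each edge at `v` leaves a piece in the window that ends at the translate of `v`. Different edges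
leave different pieces, since a piece is infinite while two edges share only endpoints. Hence high
degree is visible in every window that contains the vertex. -/
theorem degree_le_degree_window {v : Space n} (hv : v + -x ∈ Metric.ball 0 R) :
    G.degree v ≤ (G.window R x).degree (v + -x) := by
  have hex : ∀ e ∈ {e ∈ G.edges | v ∈ endpoints e},
      ∃ c, IsPiece (Metric.ball 0 R) ((· + -x) '' e) c ∧ v + -x ∈ endpoints c := fun e he =>
    IsPiece.exists_of_endpoint Metric.isOpen_ball
      ((endpoints_translate _ _ _).2 (by simpa using he.2)) hv
  choose! f hf1 hf2 using hex
  refine encard_le_encard_of_injOn (f := f)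
    (fun e he => ⟨⟨_, ⟨e, he.1, rfl⟩, hf1 e he⟩, hf2 e he⟩) ?_
  intro e₁ h₁ e₂ h₂ h12
  by_contra hne
  obtain ⟨γ, hγ⟩ := (hf1 e₁ h₁).isSmoothArc
  have hsub : (· + x) '' (f e₁) ⊆ endpoints e₁ := by
    rintro _ ⟨p, hp, rfl⟩
    obtain ⟨q, hq, hqp⟩ := (hf1 e₁ h₁).subset hp
    obtain ⟨q', hq', hqp'⟩ := (hf1 e₂ h₂).subset (h12 ▸ hp)
    have e1 : p + x = q := by rw [← hqp]; simp
    have e2 : p + x = q' := by rw [← hqp']; simp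
    exact (G.inter_subset e₁ h₁.1 e₂ h₂.1 hne ⟨by simpa [e1] using hq, by simpa [e2] using hq'⟩).1
  have hinf : (f e₁).Infinite := by
    rw [← hγ.image]
    exact (Icc_infinite zero_lt_one).image hγ.inj
  exact (hinf.image (add_left_injective x).injOn)
    ((G.isSmoothArc e₁ h₁.1).finite_endpoints.subset hsub)

/-- If the swatch at `v` in `I_s(G)` lies well inside a window, the window shows it. -/
theorem swatch_inner_isomorphic_window {k : ℕ} {v : Space n}
    (hsub : Metric.ball x R ⊆ Metric.ball 0 s)
    (hedge : ∀ e, (cellGraph (G.inner s)).edist (Sum.inl v) (Sum.inr e) ≤ k →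
      e ⊆ Metric.ball x R) :
    (swatch (G.inner s) k v).Isomorphic (swatch (G.window R x).interiorGraph k (v + -x)) := by
  -- Incidence in the window always comes from incidence in `I_s(G)`; the converse needs the edge to
  -- lie in the window, which `hedge` grants only inside the swatch.
  have hinc : ∀ e w, (G.window R x).interiorGraph.Inc ((· + -x) '' e) (w + -x) →
      (G.inner s).Inc e w := fun e w h => by
    rw [interiorGraph_window_inc] at h
    exact inner_inc.2 ⟨h.1, h.2.1.trans hsub, h.2.2⟩
  have hinc' : ∀ e w, (cellGraph (G.inner s)).edist (Sum.inl v) (Sum.inr e) ≤ k →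
      ((G.inner s).Inc e w ↔ (G.window R x).interiorGraph.Inc ((· + -x) '' e) (w + -x)) :=
    fun e w he => ⟨fun h => by
      rw [inner_inc] at h
      exact interiorGraph_window_inc.2 ⟨h.1, hedge e he, h.2.2⟩, hinc e w⟩
  set T : Space n ⊕ Set (Space n) → Space n ⊕ Set (Space n) :=
    Sum.map (· + -x) (fun e => (· + -x) '' e) with hT
  have hTinj : Function.Injective T :=
    Sum.map_injective.2 ⟨add_left_injective (-x), (add_left_injective (-x)).image_injective⟩
  have hTsurj : ∀ c, c ∈ range T := by
    rintro (w | e)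
    · exact ⟨Sum.inl (w + x), by simp [hT]⟩
    · exact ⟨Sum.inr ((· + x) '' e), by simp only [hT, Sum.map_inr, image_add_neg]⟩
  have hTadj : ∀ c d, (cellGraph (G.window R x).interiorGraph).Adj (T c) (T d) →
      (cellGraph (G.inner s)).Adj c d := by
    rintro (c | c) (d | d)
    · simp [hT]
    · simpa only [hT, Sum.map_inl, Sum.map_inr, cellGraph_adj_inl_inr] using hinc d c
    · simpa only [hT, Sum.map_inl, Sum.map_inr, cellGraph_adj_inr_inl] using hinc c d
    · simp [hT]
  refine swatch_isomorphic (Z := {c // (cellGraph (G.inner s)).edist (Sum.inl v) c ≤ k})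
    (i := Subtype.val) (i' := fun c => T c.1) (z := ⟨Sum.inl v, by simp⟩)
    Subtype.val_injective (hTinj.comp Subtype.val_injective) ?_ ?_ rfl rfl ?_ ?_
  · rintro ⟨c | c, hc⟩ ⟨d | d, hd⟩
    · simp [hT]
    · simpa only [hT, Sum.map_inl, Sum.map_inr, cellGraph_adj_inl_inr] using hinc' d c hd
    · simpa only [hT, Sum.map_inl, Sum.map_inr, cellGraph_adj_inr_inl] using hinc' c d hc
    · simp [hT]
  · rintro ⟨c | c, hc⟩ <;> rfl
  · exact fun c hc => ⟨⟨c, hc⟩, rfl⟩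
  · intro c' hc'
    obtain ⟨c, rfl⟩ := hTsurj c'
    -- Since `T` is onto and window adjacency implies adjacency in `I_s(G)`, a cell near the root in
    -- the window is near the root in `I_s(G)`.
    exact ⟨⟨c, edist_le_of_partial_map (i' := id) (z := Sum.inl v) hTinj hTadj
      (fun c _ => hTsurj c) hc'⟩, rfl⟩

/-- Swatches without long edges are small. -/
theorem subset_closedBall_of_edist_le {k : ℕ} {v : Space n} {L : ℝ} (hL : 0 ≤ L)
    (hshort : ∀ e, (cellGraph (G.inner s)).edist (Sum.inl v) (Sum.inr e) ≤ k →
      ∀ p ∈ e, ∀ q ∈ e, dist p q ≤ L) {e : Set (Space n)}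
    (he : (cellGraph (G.inner s)).edist (Sum.inl v) (Sum.inr e) ≤ k) :
    e ⊆ Metric.closedBall v (k * L) := by
  -- Only a step from a vertex to an edge costs `L`; the bound charges every step.
  have key : ∀ m : ℕ, m ≤ k → ∀ c, (cellGraph (G.inner s)).edist (Sum.inl v) c ≤ m →
      c.elim (fun u => dist u v ≤ m * L) (fun e => ∀ p ∈ e, dist p v ≤ m * L) := by
    intro m
    induction m with
    | zero =>
      intro _ c hc
      rw [← SimpleGraph.edist_eq_zero_iff.1 (le_antisymm hc zero_le)]
      simp
    | succ m ih =>
      intro hm c hc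
      have hc' := hc.trans (Nat.cast_le.2 hm)
      obtain ⟨d, hd, hdc⟩ := (edist_le_succ_iff _ _ _ _).1 hc
      have ihd := ih (Nat.le_of_succ_le hm) d hd
      have hmL : (m : ℝ) * L ≤ (m + 1 : ℕ) * L := by push_cast; nlinarith
      rcases hdc with rfl | hdc
      · rcases d with d | d
        · exact le_trans ihd hmL
        · exact fun p hp => (ihd p hp).trans hmL
      · rcases d with d | d <;> rcases c with c | c
        · simp at hdc
        · intro p hp
          have hdc' := (inner_inc.1 (cellGraph_adj_inl_inr.1 hdc)).2.2
          have h1 := hshort c hc' p hp d (endpoints_subset _ hdc')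
          have h2 : dist d v ≤ m * L := ihd
          have := dist_triangle p d v
          push_cast
          linarith
        · have hdc' := (inner_inc.1 (cellGraph_adj_inr_inl.1 hdc)).2.2
          exact (ihd c (endpoints_subset _ hdc')).trans hmL
        · simp at hdc
  exact fun p hp => key k le_rfl _ he p hp

end EmbeddedGraph

/-! ### Lengths -/

/-- The distance to `p` is 1-Lipschitz and maps the connected set `e` onto a set containing `[0,
dist p q]`; a 1-Lipschitz map does not increase Hausdorff measure. -/
theorem IsSmoothArc.ofReal_dist_le {e : Set (Space n)} (he : IsSmoothArc e) {p q : Space n}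
    (hp : p ∈ e) (hq : q ∈ e) : ENNReal.ofReal (dist p q) ≤ μH[1] e := by
  obtain ⟨γ, hγ⟩ := he
  have hconn : IsPreconnected e := by
    rw [← hγ.image]
    exact isPreconnected_Icc.image _ hγ.smooth.continuousOn
  have hlip : LipschitzWith 1 (fun y => dist p y) := LipschitzWith.dist_right p
  have h1 : Icc 0 (dist p q) ⊆ (fun y => dist p y) '' e := by
    have := (hconn.image _ hlip.continuous.continuousOn).Icc_subset
      (mem_image_of_mem (fun y => dist p y) hp) (mem_image_of_mem (fun y => dist p y) hq)
    simpa using this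
  have h2 := hlip.hausdorffMeasure_image_le zero_le_one e
  calc ENNReal.ofReal (dist p q) = volume (Icc 0 (dist p q)) := by simp
    _ = μH[1] (Icc 0 (dist p q)) := by rw [hausdorffMeasure_real]
    _ ≤ μH[1] ((fun y => dist p y) '' e) := measure_mono h1
    _ ≤ μH[1] e := by simpa using h2

/-- The maximum with 0 covers negative `M`, for which `ENNReal.ofReal M` is 0. -/
theorem IsSmoothArc.dist_le {e : Set (Space n)} (he : IsSmoothArc e) {M : ℝ}
    (hM : ¬ ENNReal.ofReal M < μH[1] e) {p q : Space n} (hp : p ∈ e) (hq : q ∈ e) :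
    dist p q ≤ max M 0 := by
  have h := (he.ofReal_dist_le hp hq).trans (not_lt.1 hM)
  rcases le_total M 0 with h0 | h0
  · rw [ENNReal.ofReal_of_nonpos h0, nonpos_iff_eq_zero, ENNReal.ofReal_eq_zero] at h
    exact h.trans (le_max_right _ _)
  · exact ((ENNReal.ofReal_le_ofReal_iff h0).1 h).trans (le_max_left _ _)

/-! ### Test functions -/

/-- A Lipschitz probability density that is bounded by `b` and vanishes outside the ball of radius
`ρ` about the origin. -/
structure IsTestFunction (φ : Space n → ℝ) (ρ : ℝ) (L : NNReal) (b : ℝ) : Prop where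
  lipschitz : LipschitzWith L φ
  nonneg : ∀ v, 0 ≤ φ v
  le : ∀ v, φ v ≤ b
  eq_zero : ∀ v, ρ ≤ ‖v‖ → φ v = 0
  integral : ∫ v, φ v = 1

theorem exists_isTestFunction (n : ℕ) {ρ : ℝ} (hρ : 0 < ρ) :
    ∃ (φ : Space n → ℝ) (L : NNReal) (b : ℝ), IsTestFunction φ ρ L b := by
  -- A cone of height `ρ`, normalized below by its integral.
  set g : Space n → ℝ := fun v => max (ρ - ‖v‖) 0 with hg
  have hg0 : ∀ v, 0 ≤ g v := fun v => le_max_right _ _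
  have hgz : ∀ v, ρ ≤ ‖v‖ → g v = 0 := fun v hv => max_eq_right (by linarith)
  have hgl : ∀ v w, dist (g v) (g w) ≤ dist v w := fun v w => by
    rw [Real.dist_eq, dist_eq_norm]
    refine (abs_max_sub_max_le_abs (ρ - ‖v‖) (ρ - ‖w‖) 0).trans ?_
    rw [sub_sub_sub_cancel_left, abs_sub_comm]
    exact abs_norm_sub_norm_le v w
  have hgc : Continuous g := by fun_prop
  have hgs : HasCompactSupport g := by
    refine HasCompactSupport.intro (isCompact_closedBall (0 : Space n) ρ) fun v hv => hgz v ?_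
    simp only [Metric.mem_closedBall, dist_zero_right, not_le] at hv
    exact hv.le
  have hpos : 0 < ∫ v, g v := by
    refine hgc.integral_pos_of_hasCompactSupport_nonneg_nonzero hgs hg0 (x := 0) ?_
    simp [hg, hρ.ne', hρ.le]
  set c := (∫ v, g v)⁻¹ with hc
  have hc0 : 0 ≤ c := inv_nonneg.2 hpos.le
  refine ⟨fun v => c * g v, c.toNNReal, c * ρ, ?_, fun v => mul_nonneg hc0 (hg0 v), fun v => ?_,
    fun v hv => by simp [hgz v hv], ?_⟩
  · refine LipschitzWith.of_dist_le_mul fun v w => ?_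
    rw [Real.coe_toNNReal _ hc0, Real.dist_eq, ← mul_sub, abs_mul, abs_of_nonneg hc0, ← Real.dist_eq]
    exact mul_le_mul_of_nonneg_left (hgl v w) hc0
  · refine mul_le_mul_of_nonneg_left ?_ hc0
    exact max_le (by linarith [norm_nonneg v]) hρ.le
  · rw [integral_const_mul, hc, inv_mul_cancel₀ hpos.ne']

namespace IsTestFunction

variable {φ : Space n → ℝ} {ρ : ℝ} {L : NNReal} {b : ℝ}

theorem bound_nonneg (h : IsTestFunction φ ρ L b) : 0 ≤ b := (h.nonneg 0).trans (h.le 0)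

theorem integrable (h : IsTestFunction φ ρ L b) : Integrable φ := by
  refine h.lipschitz.continuous.integrable_of_hasCompactSupport ?_
  refine HasCompactSupport.intro (isCompact_closedBall (0 : Space n) ρ) fun v hv => h.eq_zero v ?_
  simp only [Metric.mem_closedBall, dist_zero_right, not_le] at hv
  exact hv.le

theorem integrable_translate (h : IsTestFunction φ ρ L b) (v : Space n) :
    Integrable (fun x => φ (v + -x)) := by
  simpa only [sub_eq_add_neg] using h.integrable.comp_sub_left v

theorem integral_translate (h : IsTestFunction φ ρ L b) (v : Space n) :
    ∫ x, φ (v + -x) = 1 := by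
  rw [← h.integral]
  simpa only [sub_eq_add_neg] using integral_sub_left_eq_self φ volume v

/-- Exchange sum and integral: each vertex contributes the mass of a translated and reflected bump,
which is at most 1. -/
theorem setIntegral_sum_le (h : IsTestFunction φ ρ L b) (T : Finset (Space n))
    (s : Set (Space n)) : ∫ x in s, ∑ v ∈ T, φ (v + -x) ≤ T.card := by
  rw [integral_finsetSum _ fun v _ => (h.integrable_translate v).integrableOn]
  calc ∑ v ∈ T, ∫ x in s, φ (v + -x) ≤ ∑ _v ∈ T, (1 : ℝ) := by
        refine Finset.sum_le_sum fun v _ => ?_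
        rw [← h.integral_translate v]
        exact setIntegral_le_integral (h.integrable_translate v)
          (Eventually.of_forall fun x => h.nonneg _)
    _ = T.card := by simp

/-- Vertices at depth more than `ρ` inside the ball have their entire bump in the domain of
integration, so each contributes exactly 1. -/
theorem setIntegral_sum_eq (h : IsTestFunction φ ρ L b) {T : Finset (Space n)} {i : ℝ}
    (hT : ∀ v ∈ T, v ∈ Metric.ball (0 : Space n) (i - ρ)) :
    ∫ x in Metric.ball 0 i, ∑ v ∈ T, φ (v + -x) = T.card := by
  rw [integral_finsetSum _ fun v _ => (h.integrable_translate v).integrableOn]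
  calc ∑ v ∈ T, ∫ x in Metric.ball 0 i, φ (v + -x) = ∑ _v ∈ T, (1 : ℝ) := by
        refine Finset.sum_congr rfl fun v hv => ?_
        rw [← h.integral_translate v]
        refine setIntegral_eq_integral_of_forall_compl_eq_zero fun x hx => h.eq_zero _ ?_
        have h1 := hT v hv
        simp only [Metric.mem_ball, dist_zero_right, not_lt] at hx h1
        have h2 : ‖x‖ ≤ ‖v‖ + ‖v + -x‖ := by
          have := norm_sub_le v (v + -x)
          simpa using this
        linarith
    _ = T.card := by simp

end IsTestFunction

/-! ### Sums over the vertices in a window -/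

section

variable {G : EucGraph n} {R ρ : ℝ} {φ : Space n → ℝ} {L : NNReal} {b : ℝ}
  {m : BallGraph n R → Space n → Prop} {x : Space n}

theorem exists_markedSum_eq (hφ : IsTestFunction φ ρ L b) (hρ : ρ < R) (W : BallGraph n R) :
    ∃ V : Finset (Space n), (∀ w, w ∈ V ↔ w ∈ W.vertices ∧ m W w ∧ φ w ≠ 0) ∧
      markedSum φ m W = ∑ w ∈ V, φ w := by
  have hfin : (W.vertices ∩ Metric.closedBall 0 ρ).Finite :=
    W.finite_vertices_inter (Metric.closedBall_subset_ball hρ) (isCompact_closedBall _ _)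
  have hfin' : {w | w ∈ W.vertices ∧ m W w ∧ φ w ≠ 0}.Finite := by
    refine hfin.subset fun w hw => ⟨hw.1, ?_⟩
    by_contra hn
    simp only [Metric.mem_closedBall, dist_zero_right, not_le] at hn
    exact hw.2.2 (hφ.eq_zero w hn.le)
  refine ⟨hfin'.toFinset, fun w => hfin'.mem_toFinset, ?_⟩
  rw [markedSum, finsum_set_coe_eq_finsum_mem (f := fun w => {w | m W w}.indicator φ w) W.vertices,
    finsum_mem_eq_sum_of_inter_support_eq (t := hfin'.toFinset)]
  · refine Finset.sum_congr rfl fun w hw => indicator_of_mem ?_ _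
    exact (hfin'.mem_toFinset.1 hw).2.1
  · ext w
    simp only [mem_inter_iff, Function.mem_support, Set.Finite.coe_toFinset]
    by_cases hw : m W w <;> simp [hw]

theorem markedSum_window_le (hφ : IsTestFunction φ ρ L b) (hρ : ρ < R) {T : Finset (Space n)}
    (hT : ∀ v ∈ G.vertices, ‖v + -x‖ < ρ → m (G.window R x) (v + -x) → v ∈ T) :
    markedSum φ m (G.window R x) ≤ ∑ v ∈ T, φ (v + -x) := by
  obtain ⟨V, hV, hsum⟩ := exists_markedSum_eq (m := m) hφ hρ (G.window R x)
  have hmap : ∑ v ∈ T, φ (v + -x) = ∑ w ∈ T.map (addRightEmbedding (-x)), φ w := by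
    rw [Finset.sum_map]; rfl
  rw [hsum, hmap]
  refine Finset.sum_le_sum_of_subset_of_nonneg (fun w hw => ?_) fun w _ _ => hφ.nonneg w
  obtain ⟨hw1, hw2, hw3⟩ := (hV w).1 hw
  rw [Finset.mem_map]
  have hwx : w + x + -x = w := by simp
  refine ⟨w + x, hT _ (EmbeddedGraph.mem_vertices_window.1 hw1).1 ?_ (by rwa [hwx]), hwx⟩
  rw [hwx]
  by_contra hn
  exact hw3 (hφ.eq_zero w (not_lt.1 hn))

theorem le_markedSum_window (hφ : IsTestFunction φ ρ L b) (hρ : ρ < R) {T : Finset (Space n)}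
    (hT : ∀ v ∈ T, v ∈ G.vertices ∧ (‖v + -x‖ < ρ → m (G.window R x) (v + -x))) :
    ∑ v ∈ T, φ (v + -x) ≤ markedSum φ m (G.window R x) := by
  obtain ⟨V, hV, hsum⟩ := exists_markedSum_eq (m := m) hφ hρ (G.window R x)
  have hmap : ∑ v ∈ T, φ (v + -x) = ∑ w ∈ T.map (addRightEmbedding (-x)), φ w := by
    rw [Finset.sum_map]; rfl
  rw [hsum, hmap, ← Finset.sum_filter_ne_zero]
  refine Finset.sum_le_sum_of_subset_of_nonneg (fun w hw => ?_) fun w _ _ => hφ.nonneg w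
  obtain ⟨hw1, hw2⟩ := Finset.mem_filter.1 hw
  obtain ⟨v, hv, rfl⟩ := Finset.mem_map.1 hw1
  have hlt : ‖v + -x‖ < ρ := by
    by_contra hn
    exact hw2 (hφ.eq_zero _ (not_lt.1 hn))
  refine (hV _).2 ⟨EmbeddedGraph.mem_vertices_window.2 ⟨?_, ?_⟩, (hT v hv).2 hlt, hw2⟩
  · simpa using (hT v hv).1
  · rw [mem_ball_zero_iff]
    exact hlt.trans hρ

variable (hφ : IsTestFunction φ ρ L b) (hρ : ρ < R) (hm : TypeInvariant m) {K : ℝ} (hK : 0 ≤ K)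

/-- The truncated sum of a test function over the vertices with the property `m`. -/
noncomputable def vertexStatistic : BoundedContinuousFunction (BallGraph n R) ℝ :=
  cutoffSum hρ hφ.lipschitz hφ.nonneg hφ.eq_zero hm K hK

theorem vertexStatistic_apply (W : BallGraph n R) :
    vertexStatistic hφ hρ hm hK W = min K (markedSum φ m W) := rfl

theorem integrableOn_vertexStatistic {i : ℝ}
    (hmeas : AEMeasurable (G.window R) (volume.restrict (Metric.ball 0 i))) :
    IntegrableOn (fun x => vertexStatistic hφ hρ hm hK (G.window R x)) (Metric.ball 0 i) := by
  have : IsFiniteMeasure (volume.restrict (Metric.ball (0 : Space n) i)) :=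
    ⟨by simpa using Metric.isBounded_ball.measure_lt_top⟩
  refine Integrable.of_bound
    ((vertexStatistic hφ hρ hm hK).continuous.measurable.comp_aemeasurable
      hmeas).aestronglyMeasurable K (Eventually.of_forall fun x => ?_)
  rw [vertexStatistic_apply, Real.norm_of_nonneg (le_min hK (markedSum_nonneg hφ.nonneg m _))]
  exact min_le_left _ _

/-- Truncation only decreases the integrand, so no crowding hypothesis is needed for the upper
bound. -/
theorem setIntegral_vertexStatistic_le {i : ℝ}
    (hmeas : AEMeasurable (G.window R) (volume.restrict (Metric.ball 0 i))) {T : Finset (Space n)}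
    (hT : ∀ x ∈ Metric.ball (0 : Space n) i, ∀ v ∈ G.vertices, ‖v + -x‖ < ρ →
      m (G.window R x) (v + -x) → v ∈ T) :
    ∫ x in Metric.ball 0 i, vertexStatistic hφ hρ hm hK (G.window R x) ≤ T.card := by
  refine (setIntegral_mono_on (integrableOn_vertexStatistic hφ hρ hm hK hmeas)
    (integrable_finsetSum T fun v _ => hφ.integrable_translate v).integrableOn
    measurableSet_ball fun x hx => ?_).trans (hφ.setIntegral_sum_le T _)
  exact (min_le_right _ _).trans (markedSum_window_le hφ hρ (hT x hx))

/-- On uncrowded vertices the truncation is harmless. The members of `T` within `ρ` of a centre `x`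
lie within `2 * ρ` of one of them, so there are at most `N`, and their sum is at most `N * b ≤ K`.
-/
theorem card_le_setIntegral_vertexStatistic {i : ℝ}
    (hmeas : AEMeasurable (G.window R) (volume.restrict (Metric.ball 0 i))) {T : Finset (Space n)}
    {N : ℝ} (hN : 0 ≤ N) (hNK : N * b ≤ K)
    (hT : ∀ v ∈ T, v ∈ G.vertices ∧ v ∈ Metric.ball (0 : Space n) (i - ρ) ∧
      ∀ x, ‖v + -x‖ < ρ → m (G.window R x) (v + -x))
    (hcard : ∀ v ∈ T, ((G.vertices ∩ Metric.ball v (2 * ρ)).ncard : ℝ) ≤ N) :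
    (T.card : ℝ) ≤ ∫ x in Metric.ball 0 i, vertexStatistic hφ hρ hm hK (G.window R x) := by
  rw [← hφ.setIntegral_sum_eq fun v hv => (hT v hv).2.1]
  refine setIntegral_mono_on
    (integrable_finsetSum T fun v _ => hφ.integrable_translate v).integrableOn
    (integrableOn_vertexStatistic hφ hρ hm hK hmeas) measurableSet_ball fun x _ => ?_
  refine le_min (le_trans ?_ hNK)
    (le_markedSum_window hφ hρ fun v hv => ⟨(hT v hv).1, (hT v hv).2.2 x⟩)
  rw [← Finset.sum_filter_ne_zero]
  have hlt : ∀ v ∈ T.filter (fun v => φ (v + -x) ≠ 0), ‖v + -x‖ < ρ := fun v hv => by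
    by_contra hn
    exact (Finset.mem_filter.1 hv).2 (hφ.eq_zero _ (not_lt.1 hn))
  rcases (T.filter (fun v => φ (v + -x) ≠ 0)).eq_empty_or_nonempty with he | ⟨v₀, hv₀⟩
  · rw [he, Finset.sum_empty]
    exact mul_nonneg hN hφ.bound_nonneg
  · have hsub : ((T.filter (fun v => φ (v + -x) ≠ 0) : Finset (Space n)) : Set (Space n)) ⊆
        G.vertices ∩ Metric.ball v₀ (2 * ρ) := by
      intro v hv
      refine ⟨(hT v (Finset.mem_filter.1 hv).1).1, ?_⟩
      have h1 := hlt v hv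
      have h2 := hlt v₀ hv₀
      rw [Metric.mem_ball, dist_eq_norm]
      have h3 := norm_sub_le (v + -x) (v₀ + -x)
      rw [add_sub_add_right_eq_sub] at h3
      linarith
    have hfin : (G.vertices ∩ Metric.ball v₀ (2 * ρ)).Finite :=
      (G.finite_vertices_inter (subset_univ _) (isCompact_closedBall v₀ (2 * ρ))).subset
        (inter_subset_inter_right _ Metric.ball_subset_closedBall)
    have hle : ((T.filter (fun v => φ (v + -x) ≠ 0)).card : ℝ) ≤ N := by
      refine le_trans ?_ (hcard v₀ (Finset.mem_filter.1 hv₀).1)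
      rw [← ncard_coe_finset]
      exact_mod_cast ncard_le_ncard hsub hfin
    calc _ ≤ ∑ _v ∈ T.filter (fun v => φ (v + -x) ≠ 0), b := Finset.sum_le_sum fun v _ => hφ.le _
      _ = (T.filter (fun v => φ (v + -x) ≠ 0)).card * b := by rw [Finset.sum_const, nsmul_eq_mul]
      _ ≤ N * b := mul_le_mul_of_nonneg_right hle hφ.bound_nonneg

end

/-! ### Window laws -/

theorem aemeasurable_cond_ball_iff {X : Type*} [MeasurableSpace X] {f : Space n → X} {i : ℝ} :
    AEMeasurable f (ProbabilityTheory.cond volume (Metric.ball (0 : Space n) i)) ↔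
      AEMeasurable f (volume.restrict (Metric.ball 0 i)) := by
  rw [ProbabilityTheory.cond]
  -- Conditioning rescales the restricted measure by a factor that is nonzero because balls have
  -- finite volume.
  have h0 : (volume (Metric.ball (0 : Space n) i))⁻¹ ≠ 0 :=
    ENNReal.inv_ne_zero.2 Metric.isBounded_ball.measure_lt_top.ne
  constructor
  · intro h
    refine h.mono_ac ?_
    exact Measure.absolutelyContinuous_smul h0
  · exact fun h => h.smul_measure _

namespace EmbeddedGraph

variable {G : EucGraph n} {P : ∀ r : ℕ, Measure (BallGraph n r)}

/-- Measurability of the window map follows from convergence. `Measure.map` is zero for a map that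
is not almost everywhere measurable, while testing against the constant 1 shows that the total
masses tend to 1. -/
theorem HasSmoothGeometricCloth.eventually_aemeasurable (hP : G.HasSmoothGeometricCloth P)
    (hG : G.edges.Infinite) (R : ℕ) : ∀ᶠ i : ℕ in atTop,
      AEMeasurable (G.window (R : ℝ)) (volume.restrict (Metric.ball 0 (i : ℝ))) := by
  obtain ⟨hprob, hlim⟩ := hP.1 hG R
  have h1 := hlim (BoundedContinuousFunction.const _ 1)
  simp only [BoundedContinuousFunction.const_apply, integral_const, smul_eq_mul, mul_one,
    probReal_univ] at h1
  filter_upwards [h1.eventually_ne one_ne_zero] with i hi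
  rw [← aemeasurable_cond_ball_iff]
  by_contra hn
  rw [windowLaw, Measure.map_of_not_aemeasurable hn] at hi
  simp at hi

theorem HasSmoothGeometricCloth.tendsto_average (hP : G.HasSmoothGeometricCloth P)
    (hG : G.edges.Infinite) (R : ℕ) (f : BoundedContinuousFunction (BallGraph n R) ℝ) :
    Tendsto (fun i : ℕ => (∫ x in Metric.ball (0 : Space n) (i : ℝ), f (G.window R x)) /
      volume.real (Metric.ball (0 : Space n) i)) atTop (𝓝 (∫ W, f W ∂(P R))) := by
  refine ((hP.1 hG R).2 f).congr' ?_
  filter_upwards [hP.eventually_aemeasurable hG R] with i hi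
  rw [windowLaw, integral_map (aemeasurable_cond_ball_iff.2 hi)
    f.continuous.measurable.aestronglyMeasurable, ProbabilityTheory.cond, integral_smul_measure,
    smul_eq_mul, ENNReal.toReal_inv, div_eq_inv_mul]
  rfl

end EmbeddedGraph

namespace EmbeddedGraph

/-! ### Vertices with an irregular swatch -/

theorem finite_vertices_ball (G : EucGraph n) (v : Space n) (s : ℝ) :
    (G.vertices ∩ Metric.ball v s).Finite :=
  (G.finite_vertices_inter (subset_univ _) (isCompact_closedBall v s)).subset
    (inter_subset_inter_right _ Metric.ball_subset_closedBall)

theorem finite_vertexSet_inner (G : EucGraph n) (s : ℝ) : (G.inner s).vertexSet.Finite :=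
  G.finite_vertices_ball 0 s

theorem finite_edgeSet_inner (G : EucGraph n) (s : ℝ) : (G.inner s).edgeSet.Finite := by
  refine (G.locallyFinite _ (subset_univ _) (isCompact_closedBall (0 : Space n) s)).subset ?_
  rintro e ⟨he, hes⟩
  obtain ⟨γ, hγ⟩ := G.isSmoothArc e he
  obtain ⟨p, hp, -⟩ := hγ.exists_mem_sdiff
  exact ⟨he, p, hp, Metric.ball_subset_closedBall (hes hp)⟩

theorem mem_vertexSet_of_mem_endpoints {G : EucGraph n} {s : ℝ} {e : Set (Space n)}
    (he : e ∈ (G.inner s).edgeSet) {v : Space n} (hv : v ∈ endpoints e) :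
    v ∈ (G.inner s).vertexSet :=
  ⟨⟨mem_univ _, e, he.1, hv⟩, he.2 (endpoints_subset e hv)⟩

/-- The edges of `I_s(G)` of length greater than `M`. -/
def longEdges (G : EucGraph n) (s M : ℝ) : Set (Set (Space n)) :=
  {e ∈ (G.inner s).edgeSet | ENNReal.ofReal M < μH[1] e}

/-- The vertices of `I_s(G)` of degree greater than `D` in `G`. -/
def highDegree (G : EucGraph n) (s : ℝ) (D : ℕ) : Set (Space n) :=
  {v ∈ (G.inner s).vertexSet | (D : ℕ∞) < G.degree v}

/-- The vertices of `I_s(G)` with more than `N` vertices at distance less than `r`. -/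
def crowded (G : EucGraph n) (s r N : ℝ) : Set (Space n) :=
  {v ∈ (G.inner s).vertexSet | N < ((G.vertices ∩ Metric.ball v r).ncard : ℝ)}

/-- The vertices of `I_s(G)` that have high degree or end a long edge. -/
def irregular (G : EucGraph n) (s : ℝ) (D : ℕ) (M : ℝ) : Set (Space n) :=
  G.highDegree s D ∪ ⋃ e ∈ G.longEdges s M, endpoints e

/-- The vertices that can be reached from `A` along at most `i` edges of `I_s(G)`. -/
def reach (G : EucGraph n) (s : ℝ) (A : Set (Space n)) : ℕ → Set (Space n)
  | 0 => A
  | i + 1 => reach G s A i ∪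
      {u | ∃ w ∈ reach G s A i, ∃ e ∈ (G.inner s).edgeSet, u ∈ endpoints e ∧ w ∈ endpoints e}

variable {G : EucGraph n} {s r M : ℝ} {D : ℕ} {A : Set (Space n)} {k : ℕ} {v : Space n}

theorem irregular_subset : G.irregular s D M ⊆ (G.inner s).vertexSet := by
  refine union_subset (fun v hv => hv.1) (iUnion₂_subset fun e he v hv => ?_)
  exact mem_vertexSet_of_mem_endpoints he.1 hv

theorem subset_reach (i : ℕ) : A ⊆ G.reach s A i := by
  induction i with
  | zero => exact subset_rfl
  | succ i ih => exact ih.trans subset_union_left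

theorem reach_subset (hA : A ⊆ (G.inner s).vertexSet) (i : ℕ) :
    G.reach s A i ⊆ (G.inner s).vertexSet := by
  induction i with
  | zero => exact hA
  | succ i ih =>
    refine union_subset ih ?_
    rintro u ⟨w, -, e, he, hu, -⟩
    exact mem_vertexSet_of_mem_endpoints he hu

/-- Each step back towards `v` in the cell graph costs at most one application of `reach`. Hence,
outside `reach` of the irregular set after `k` steps, no swatch of radius `k` contains an irregular
vertex or a long edge. -/
theorem mem_reach_of_edist_le {i m : ℕ} {c : Space n ⊕ Set (Space n)}
    (hc : (cellGraph (G.inner s)).edist (Sum.inl v) c ≤ m)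
    (h : c.elim (fun u => u ∈ G.reach s A i)
      (fun e => e ∈ (G.inner s).edgeSet ∧ ∃ w ∈ endpoints e, w ∈ G.reach s A i)) :
    v ∈ G.reach s A (i + m) := by
  induction m generalizing i c with
  | zero =>
    rw [← SimpleGraph.edist_eq_zero_iff.1 (le_antisymm hc zero_le)] at h
    exact h
  | succ m ih =>
    obtain ⟨d, hd, rfl | hdc⟩ := (edist_le_succ_iff _ _ _ _).1 hc
    · exact subset_union_left (ih hd h)
    · have h1 : i + (m + 1) = i + 1 + m := by omega
      rw [h1]
      refine ih hd ?_
      rcases d with d | d <;> rcases c with c | c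
      · simp at hdc
      · have hdc' := inner_inc.1 (cellGraph_adj_inl_inr.1 hdc)
        obtain ⟨he, w, hw, hwr⟩ := h
        exact Or.inr ⟨w, hwr, c, he, hdc'.2.2, hw⟩
      · have hdc' := inner_inc.1 (cellGraph_adj_inr_inl.1 hdc)
        exact ⟨⟨hdc'.1, hdc'.2.1⟩, c, hdc'.2.2, subset_union_left h⟩
      · simp at hdc

section Regular

variable (hv : v ∈ (G.inner s).vertexSet) (hreg : v ∉ G.reach s (G.irregular s D M) k)

include hv hreg

theorem dist_le_of_not_mem_reach {e : Set (Space n)}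
    (he : (cellGraph (G.inner s)).edist (Sum.inl v) (Sum.inr e) ≤ k) {p q : Space n}
    (hp : p ∈ e) (hq : q ∈ e) : dist p q ≤ max M 0 := by
  have heE : e ∈ (G.inner s).edgeSet := by
    rcases mem_of_cellGraph_edist_le hv he with ⟨u, -, hu⟩ | ⟨e', he', h⟩
    · cases hu
    · cases h; exact he'
  refine (G.isSmoothArc e heE.1).dist_le (fun hlong => hreg ?_) hp hq
  obtain ⟨a, b, hab⟩ := (G.isSmoothArc e heE.1).exists_endpoints
  have ha : a ∈ endpoints e := hab ▸ Or.inl rfl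
  have := mem_reach_of_edist_le (A := G.irregular s D M) (i := 0) he
    ⟨heE, a, ha, Or.inr (mem_biUnion (⟨heE, hlong⟩ : e ∈ G.longEdges s M) ha)⟩
  simpa using this

/-- In such a swatch a vertex has at most `D` neighbouring cells and an edge at most 2, so `D + 2`
bounds both. -/
theorem encard_ball_le : {c | (cellGraph (G.inner s)).edist (Sum.inl v) c ≤ k}.encard ≤
    ((D + 2 + 1) ^ k : ℕ) := by
  refine finite_ball fun c hc => ?_
  rcases mem_of_cellGraph_edist_le hv hc with ⟨u, hu, rfl⟩ | ⟨e, he, rfl⟩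
  · have hdeg : G.degree u ≤ D := by
      by_contra hn
      have := mem_reach_of_edist_le (A := G.irregular s D M) (i := 0) hc
        (Or.inl ⟨hu, not_le.1 hn⟩)
      exact hreg (by simpa using this)
    have hsub : {x | (cellGraph (G.inner s)).Adj (Sum.inl u) x} ⊆
        Sum.inr '' {e ∈ G.edges | u ∈ endpoints e} := by
      rintro (x | x) hx
      · simp at hx
      · have := inner_inc.1 (cellGraph_adj_inl_inr.1 hx)
        exact ⟨x, ⟨this.1, this.2.2⟩, rfl⟩
    refine (encard_le_encard hsub).trans ((encard_image_le _ _).trans (le_trans hdeg ?_))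
    exact_mod_cast Nat.le_add_right D 2
  · have hsub : {x | (cellGraph (G.inner s)).Adj (Sum.inr e) x} ⊆ Sum.inl '' endpoints e := by
      rintro (x | x) hx
      · exact ⟨x, (inner_inc.1 (cellGraph_adj_inr_inl.1 hx)).2.2, rfl⟩
      · simp at hx
    refine (encard_le_encard hsub).trans ((encard_image_le _ _).trans
      ((G.isSmoothArc e he.1).encard_endpoints_le.trans ?_))
    exact_mod_cast Nat.le_add_left 2 D

end Regular

/-- Cover the ball of radius `L` by `q` balls of radius `r / 2`. If one of them contains an
uncrowded vertex `u`, it lies in the ball of radius `r` about `u` and so holds at most `N` vertices.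
The number `q` is independent of the graph. -/
theorem exists_ncard_uncrowded_le (n : ℕ) (L : ℝ) {r : ℝ} (hr : 0 < r) :
    ∃ q : ℕ, ∀ (G : EucGraph n) (w : Space n) (N : ℕ),
      {u ∈ G.vertices | dist u w ≤ L ∧ (G.vertices ∩ Metric.ball u r).ncard ≤ N}.ncard ≤
        q * N := by
  obtain ⟨t, -, htf, ht⟩ := (isCompact_closedBall (0 : Space n) L).finite_cover_balls (half_pos hr)
  refine ⟨htf.toFinset.card, fun G w N => ?_⟩
  set A := {u ∈ G.vertices | dist u w ≤ L ∧ (G.vertices ∩ Metric.ball u r).ncard ≤ N} with hA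
  have hAfin : A.Finite :=
    (G.finite_vertices_inter (subset_univ _) (isCompact_closedBall w L)).subset
      fun u hu => ⟨hu.1, hu.2.1⟩
  have hsub : A ⊆ ⋃ p ∈ htf.toFinset, A ∩ Metric.ball (w + p) (r / 2) := by
    intro u hu
    have h1 : u - w ∈ Metric.closedBall (0 : Space n) L := by
      rw [mem_closedBall_zero_iff, ← dist_eq_norm]; exact hu.2.1
    obtain ⟨p, hp, hup⟩ := mem_iUnion₂.1 (ht h1)
    refine mem_iUnion₂.2 ⟨p, htf.mem_toFinset.2 hp, hu, ?_⟩
    rw [Metric.mem_ball, dist_eq_norm] at hup ⊢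
    rwa [← sub_sub]
  have hone : ∀ p ∈ htf.toFinset, (A ∩ Metric.ball (w + p) (r / 2)).ncard ≤ N := by
    intro p _
    rcases (A ∩ Metric.ball (w + p) (r / 2)).eq_empty_or_nonempty with he | ⟨u, hu, hup⟩
    · rw [he]; simp
    · refine le_trans (ncard_le_ncard ?_ (G.finite_vertices_ball u r)) hu.2.2
      rintro u' ⟨hu', hup'⟩
      refine ⟨hu'.1, ?_⟩
      rw [Metric.mem_ball] at hup hup' ⊢
      have := dist_triangle_right u' u (w + p)
      linarith
  calc A.ncard ≤ (⋃ p ∈ htf.toFinset, A ∩ Metric.ball (w + p) (r / 2)).ncard :=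
        ncard_le_ncard hsub (htf.toFinset.finite_toSet.biUnion fun p _ =>
          hAfin.subset inter_subset_left)
    _ ≤ ∑ p ∈ htf.toFinset, (A ∩ Metric.ball (w + p) (r / 2)).ncard :=
        Finset.set_ncard_biUnion_le _ _
    _ ≤ ∑ _p ∈ htf.toFinset, N := Finset.sum_le_sum hone
    _ = htf.toFinset.card * N := by simp

theorem ncard_biUnion_le_mul {α β : Type*} {S : Set α} (hS : S.Finite) {f : α → Set β} {d : ℕ}
    (hf : ∀ a ∈ S, (f a).ncard ≤ d) : (⋃ a ∈ S, f a).ncard ≤ S.ncard * d := by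
  have h : ⋃ a ∈ S, f a = ⋃ a ∈ hS.toFinset, f a := by simp
  rw [h, ncard_eq_toFinset_card S hS]
  calc _ ≤ ∑ a ∈ hS.toFinset, (f a).ncard := Finset.set_ncard_biUnion_le _ _
    _ ≤ ∑ _a ∈ hS.toFinset, d := Finset.sum_le_sum fun a ha => hf a (hS.mem_toFinset.1 ha)
    _ = _ := by simp

theorem ncard_endpoints_le {e : Set (Space n)} (he : IsSmoothArc e) : (endpoints e).ncard ≤ 2 := by
  obtain ⟨a, b, hab⟩ := he.exists_endpoints
  rw [hab]
  exact (ncard_insert_le _ _).trans (by simp)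

theorem ncard_irregular_le :
    (G.irregular s D M).ncard ≤ (G.highDegree s D).ncard + (G.longEdges s M).ncard * 2 :=
  (ncard_union_le _ _).trans <| Nat.add_le_add_left
    (ncard_biUnion_le_mul ((G.finite_edgeSet_inner s).subset fun _ he => he.1) fun e he =>
      ncard_endpoints_le (G.isSmoothArc e he.1.1)) _

theorem ncard_neighbors_le {w : Space n} (hw : G.degree w ≤ D) :
    {u | ∃ e ∈ (G.inner s).edgeSet, u ∈ endpoints e ∧ w ∈ endpoints e}.ncard ≤ D * 2 := by
  have hfin : {e ∈ G.edges | w ∈ endpoints e}.Finite := finite_of_encard_le_coe hw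
  have hcard : {e ∈ G.edges | w ∈ endpoints e}.ncard ≤ D := by
    rw [← Nat.cast_le (α := ℕ∞), hfin.cast_ncard_eq]; exact hw
  have hsub : {u | ∃ e ∈ (G.inner s).edgeSet, u ∈ endpoints e ∧ w ∈ endpoints e} ⊆
      ⋃ e ∈ {e ∈ G.edges | w ∈ endpoints e}, endpoints e := by
    rintro u ⟨e, he, hu, hwe⟩
    exact mem_biUnion (⟨he.1, hwe⟩ : e ∈ {e ∈ G.edges | w ∈ endpoints e}) hu
  refine (ncard_le_ncard hsub (hfin.biUnion fun e he =>
    (G.isSmoothArc e he.1).finite_endpoints)).trans ?_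
  refine (ncard_biUnion_le_mul hfin fun e he => ncard_endpoints_le (G.isSmoothArc e he.1)).trans ?_
  exact Nat.mul_le_mul_right _ hcard

/-- A new vertex has a neighbour reached before. If that neighbour has degree at most `D`, it
accounts for at most `2 * D` vertices. Otherwise the joining edge is long and its ends are already
irregular, or the new vertex is crowded, or it is one of the at most `q` uncrowded vertices near a
vertex of high degree. -/
theorem ncard_reach_succ_le {q N' : ℕ}
    (hq : ∀ w, {u ∈ G.vertices | dist u w ≤ max M 0 ∧
      (G.vertices ∩ Metric.ball u r).ncard ≤ N'}.ncard ≤ q) (i : ℕ) :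
    (G.reach s (G.irregular s D M) (i + 1)).ncard ≤
      (2 * D + 1) * (G.reach s (G.irregular s D M) i).ncard +
        ((G.highDegree s D).ncard * q + (G.crowded s r N').ncard) := by
  set Y := G.reach s (G.irregular s D M) with hY
  have hYfin : ∀ i, (Y i).Finite := fun i =>
    (G.finite_vertexSet_inner s).subset (reach_subset irregular_subset i)
  have hHfin : (G.highDegree s D).Finite := (G.finite_vertexSet_inner s).subset fun _ h => h.1
  have hCfin : (G.crowded s r N').Finite := (G.finite_vertexSet_inner s).subset fun _ h => h.1
  have hLfin : {w ∈ Y i | G.degree w ≤ D}.Finite := (hYfin i).subset fun _ h => h.1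
  set B₁ := ⋃ w ∈ {w ∈ Y i | G.degree w ≤ D},
    {u | ∃ e ∈ (G.inner s).edgeSet, u ∈ endpoints e ∧ w ∈ endpoints e} with hB₁
  set B₂ := ⋃ w ∈ G.highDegree s D, {u ∈ G.vertices | dist u w ≤ max M 0 ∧
      (G.vertices ∩ Metric.ball u r).ncard ≤ N'} with hB₂
  have hsub : Y (i + 1) ⊆ Y i ∪ B₁ ∪ (B₂ ∪ G.crowded s r N') := by
    rintro u (hu | ⟨w, hw, e, he, hue, hwe⟩)
    · exact Or.inl (Or.inl hu)
    · by_cases hdeg : G.degree w ≤ D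
      · exact Or.inl (Or.inr (mem_biUnion
          (⟨hw, hdeg⟩ : w ∈ {w ∈ Y i | G.degree w ≤ D}) ⟨e, he, hue, hwe⟩))
      · by_cases hlong : ENNReal.ofReal M < μH[1] e
        · exact Or.inl (Or.inl (subset_reach i
            (Or.inr (mem_biUnion (⟨he, hlong⟩ : e ∈ G.longEdges s M) hue))))
        · have huV := mem_vertexSet_of_mem_endpoints he hue
          have hwV := mem_vertexSet_of_mem_endpoints he hwe
          by_cases hc : (N' : ℝ) < ((G.vertices ∩ Metric.ball u r).ncard : ℝ)
          · exact Or.inr (Or.inr ⟨huV, hc⟩)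
          · refine Or.inr (Or.inl (mem_biUnion
              (⟨hwV, not_le.1 hdeg⟩ : w ∈ G.highDegree s D) ⟨huV.1, ?_, ?_⟩))
            · exact (G.isSmoothArc e he.1).dist_le hlong (endpoints_subset _ hue)
                (endpoints_subset _ hwe)
            · exact_mod_cast not_lt.1 hc
  have hB₁fin : B₁.Finite := (G.finite_vertexSet_inner s).subset <| by
    refine iUnion₂_subset fun w _ => ?_
    rintro u ⟨e, he, hu, -⟩
    exact mem_vertexSet_of_mem_endpoints he hu
  have hB₂fin : B₂.Finite := hHfin.biUnion fun w _ =>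
    (G.finite_vertices_inter (subset_univ _) (isCompact_closedBall w (max M 0))).subset
      fun u hu => ⟨hu.1, hu.2.1⟩
  have h1 : B₁.ncard ≤ (Y i).ncard * (D * 2) :=
    (ncard_biUnion_le_mul hLfin fun w hw => ncard_neighbors_le hw.2).trans
      (Nat.mul_le_mul_right _ (ncard_le_ncard (fun _ h => h.1) (hYfin i)))
  have h2 : B₂.ncard ≤ (G.highDegree s D).ncard * q := ncard_biUnion_le_mul hHfin fun w _ => hq w
  have h3 := ncard_le_ncard hsub (((hYfin i).union hB₁fin).union (hB₂fin.union hCfin))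
  have h4 := ncard_union_le (Y i ∪ B₁) (B₂ ∪ G.crowded s r N')
  have h5 := ncard_union_le (Y i) B₁
  have h6 := ncard_union_le B₂ (G.crowded s r N')
  nlinarith

theorem ncard_reach_le {q N' : ℕ}
    (hq : ∀ w, {u ∈ G.vertices | dist u w ≤ max M 0 ∧
      (G.vertices ∩ Metric.ball u r).ncard ≤ N'}.ncard ≤ q) (k : ℕ) :
    (G.reach s (G.irregular s D M) k).ncard ≤ (2 * D + 2) ^ k *
      ((G.irregular s D M).ncard +
        ((G.highDegree s D).ncard * q + (G.crowded s r N').ncard)) := by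
  induction k with
  | zero => simp [reach]
  | succ k ih =>
    refine (ncard_reach_succ_le hq k).trans ?_
    -- The factor `2 * D + 2`, one more than the growth rate, absorbs the additive term `b` at each
    -- step.
    set b := (G.highDegree s D).ncard * q + (G.crowded s r N').ncard
    have h1 : b ≤ (2 * D + 2) ^ k * ((G.irregular s D M).ncard + b) :=
      (Nat.le_add_left _ _).trans (Nat.le_mul_of_pos_left _ (by positivity))
    calc _ ≤ (2 * D + 1) * ((2 * D + 2) ^ k * ((G.irregular s D M).ncard + b)) +
          (2 * D + 2) ^ k * ((G.irregular s D M).ncard + b) := by gcongr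
      _ = _ := by ring

end EmbeddedGraph

/-! ### Volumes and vertex densities -/

/-- The volume of the ball of radius `s` in `n`-space. -/
noncomputable def ballVolume (n : ℕ) (s : ℝ) : ℝ := volume.real (Metric.ball (0 : Space n) s)

theorem ballVolume_eq (n : ℕ) {s : ℝ} (hs : 0 < s) : ballVolume n s = s ^ n * ballVolume n 1 := by
  rw [ballVolume, ballVolume, measureReal_def, measureReal_def, Measure.addHaar_ball_of_pos _ _ hs,
    ENNReal.toReal_mul, ENNReal.toReal_ofReal (by positivity), finrank_euclideanSpace_fin]

theorem ballVolume_pos (n : ℕ) {s : ℝ} (hs : 0 < s) : 0 < ballVolume n s :=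
  ENNReal.toReal_pos (Metric.measure_ball_pos volume 0 hs).ne'
    Metric.isBounded_ball.measure_lt_top.ne

/-- Volume is a fixed power of the radius, so a bounded change of radius is negligible. This makes
both shells and rounding to integer radii harmless. -/
theorem tendsto_ballVolume_div {g : ℝ → ℝ} {C : ℝ} (hg : ∀ᶠ s in atTop, |g s - s| ≤ C) :
    Tendsto (fun s => ballVolume n (g s) / ballVolume n s) atTop (𝓝 1) := by
  have h1 : Tendsto (fun s => (g s - s) / s) atTop (𝓝 0) := by
    refine squeeze_zero_norm' (a := fun s => C / s) ?_ (tendsto_const_nhds.div_atTop tendsto_id)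
    filter_upwards [hg, eventually_gt_atTop 0] with s hs h0
    rw [norm_div, Real.norm_eq_abs, Real.norm_of_nonneg h0.le]
    gcongr
  have h2 : Tendsto (fun s => (1 + (g s - s) / s) ^ n) atTop (𝓝 1) := by
    simpa using (h1.const_add 1).pow n
  refine h2.congr' ?_
  filter_upwards [hg, eventually_gt_atTop 0, eventually_gt_atTop C] with s hs h0 hC
  have hgs : 0 < g s := by have := abs_le.1 hs; linarith
  rw [ballVolume_eq n hgs, ballVolume_eq n h0,
    mul_div_mul_right _ _ (ballVolume_pos n one_pos).ne', ← div_pow]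
  congr 1
  field_simp
  ring

namespace EmbeddedGraph

/-- The number of vertices of `G` in the ball of radius `s` about the origin. -/
noncomputable def vertexCount (G : EucGraph n) (s : ℝ) : ℝ := (G.vertices ∩ Metric.ball 0 s).ncard

theorem vertexCount_nonneg (G : EucGraph n) (s : ℝ) : 0 ≤ G.vertexCount s := Nat.cast_nonneg _

theorem ncard_vertexSet_inner (G : EucGraph n) (s : ℝ) :
    ((G.inner s).vertexSet.ncard : ℝ) = G.vertexCount s := rfl

variable {G : EucGraph n} {C ε : ℝ}

/-- Applied to two shifted radii, this bounds the number of vertices in the shell between them by `4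
* ε` times the volume. -/
theorem eventually_vertexCount_div
    (h : ∀ᶠ s in atTop, |G.vertexCount s / ballVolume n s - C| < ε) (hε : 0 < ε)
    {g : ℝ → ℝ} {c : ℝ} (hg : ∀ᶠ s in atTop, |g s - s| ≤ c) :
    ∀ᶠ s in atTop, |G.vertexCount (g s) - C * ballVolume n s| ≤ 2 * ε * ballVolume n s := by
  have hgt : Tendsto g atTop atTop := by
    refine tendsto_atTop_mono' atTop ?_ (tendsto_atTop_add_const_right atTop (-c) tendsto_id)
    filter_upwards [hg] with s hs
    have := (abs_le.1 hs).1
    simp only [id]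
    linarith
  -- This is the error from replacing the volume at radius `g s` by that at `s`; the quotient of
  -- vertex count and volume is at most `|C| + ε`.
  have hlim : Tendsto (fun s => (|C| + ε) * |ballVolume n (g s) / ballVolume n s - 1|)
      atTop (𝓝 0) := by
    have := ((tendsto_ballVolume_div (n := n) hg).sub_const 1).abs.const_mul (|C| + ε)
    simpa using this
  filter_upwards [hgt.eventually h, hgt.eventually_gt_atTop 0, eventually_gt_atTop 0,
    hlim.eventually_lt_const hε] with s h1 h2 h3 h4
  have v1 := ballVolume_pos n h2
  have v2 := ballVolume_pos n h3
  set a := G.vertexCount (g s)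
  set v := ballVolume n (g s)
  set w := ballVolume n s
  have hav : |a / v| ≤ |C| + ε := by
    have := abs_add_le (a / v - C) C
    rw [sub_add_cancel] at this
    linarith
  have e1 : a - C * w = ((a / v) * (v / w - 1) + (a / v - C)) * w := by
    field_simp
    ring
  rw [e1, abs_mul, abs_of_pos v2]
  refine mul_le_mul_of_nonneg_right ?_ v2.le
  refine (abs_add_le _ _).trans ?_
  rw [abs_mul]
  have := mul_le_mul_of_nonneg_right hav (abs_nonneg (v / w - 1))
  linarith

/-- A finite graph has vertex density tending to 0, so positive density puts the graph in the
infinite case of the definition of the cloth. -/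
theorem edges_infinite (hC : 0 < C) (hε : ε ≤ C / 2)
    (h : ∀ᶠ s in atTop, |G.vertexCount s / ballVolume n s - C| < ε) : G.edges.Infinite := by
  intro hfin
  -- In dimension 0 volumes do not grow, but there are no immersed arcs either.
  have hn : n ≠ 0 := by
    rintro rfl
    have hE : G.edges = ∅ := by
      by_contra hne
      obtain ⟨e, he⟩ := nonempty_iff_ne_empty.2 hne
      obtain ⟨γ, hγ⟩ := G.isSmoothArc e he
      exact hγ.immersed 0 ⟨le_rfl, zero_le_one⟩ (Subsingleton.elim _ _)
    obtain ⟨s, hs⟩ := h.exists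
    have hV : G.vertices = ∅ := by
      ext v
      simp [vertices, hE]
    rw [vertexCount, hV] at hs
    simp only [empty_inter, ncard_empty, Nat.cast_zero, zero_div, zero_sub, abs_neg] at hs
    rw [abs_of_pos hC] at hs
    linarith
  have hV : G.vertices.Finite := by
    refine (hfin.biUnion fun e he => (G.isSmoothArc e he).finite_endpoints).subset ?_
    rintro v ⟨-, e, he, hv⟩
    exact mem_biUnion he hv
  have hvol : Tendsto (fun s => ballVolume n s) atTop atTop := by
    refine ((tendsto_pow_atTop hn).atTop_mul_const (ballVolume_pos n one_pos)).congr' ?_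
    filter_upwards [eventually_gt_atTop 0] with s hs
    exact (ballVolume_eq n hs).symm
  have hlim : Tendsto (fun s => (G.vertices.ncard : ℝ) / ballVolume n s) atTop (𝓝 0) :=
    tendsto_const_nhds.div_atTop hvol
  obtain ⟨s, hs, hs2, hs3⟩ := (h.and ((hlim.eventually_lt_const (half_pos hC)).and
    (eventually_gt_atTop 0))).exists
  have h1 : G.vertexCount s / ballVolume n s ≤ G.vertices.ncard / ballVolume n s := by
    refine div_le_div_of_nonneg_right ?_ (ballVolume_pos n hs3).le
    exact Nat.cast_le.2 (ncard_le_ncard inter_subset_left hV)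
  have := (abs_lt.1 hs).1
  linarith

/-! ### Consequences of the control conditions -/

section Controlled

variable {M N r s : ℝ} (h : G.ControlledAt C M N r ε s)

include h

theorem ControlledAt.abs_vertexCount_div_sub_lt :
    |G.vertexCount s / ballVolume n s - C| < ε := h.density

theorem ControlledAt.ncard_longEdges_le {B : ℝ} (hε : 0 ≤ ε)
    (hB : ((G.inner s).edgeSet.ncard : ℝ) ≤ B * ((G.inner s).vertexSet.ncard : ℝ)) :
    ((G.longEdges s M).ncard : ℝ) ≤ ε * B * G.vertexCount s := by
  have h1 : ((G.longEdges s M).ncard : ℝ) / ((G.inner s).edgeSet.ncard : ℝ) < ε := h.edgeLength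
  have h2 : (G.longEdges s M).ncard ≤ (G.inner s).edgeSet.ncard :=
    ncard_le_ncard (fun _ h => h.1) (G.finite_edgeSet_inner s)
  have h3 : ((G.longEdges s M).ncard : ℝ) ≤ ε * ((G.inner s).edgeSet.ncard : ℝ) := by
    -- Without edges the fraction is 0/0 = 0 and carries no information, but then there are no long
    -- edges.
    rcases Nat.eq_zero_or_pos (G.inner s).edgeSet.ncard with h0 | h0
    · have h4 : (G.longEdges s M).ncard = 0 := by omega
      rw [h0, h4]; simp
    · exact ((div_lt_iff₀ (by exact_mod_cast h0)).1 h1).le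
  refine h3.trans ?_
  rw [mul_assoc]
  exact mul_le_mul_of_nonneg_left hB hε

theorem ControlledAt.ncard_crowded_le {N' : ℝ} (hN : N ≤ N') :
    ((G.crowded s r N').ncard : ℝ) ≤ ε * G.vertexCount s := by
  have h1 : ((G.crowded s r N).ncard : ℝ) / G.vertexCount s < ε := h.crowding
  have h2 : (G.crowded s r N).ncard ≤ (G.inner s).vertexSet.ncard :=
    ncard_le_ncard (fun _ h => h.1) (G.finite_vertexSet_inner s)
  have h3 : (G.crowded s r N').ncard ≤ (G.crowded s r N).ncard :=
    ncard_le_ncard (fun _ h => ⟨h.1, hN.trans_lt h.2⟩)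
      ((G.finite_vertexSet_inner s).subset fun _ h => h.1)
  have h4 : ((G.crowded s r N).ncard : ℝ) ≤ ε * G.vertexCount s := by
    rw [← ncard_vertexSet_inner] at h1 ⊢
    rcases Nat.eq_zero_or_pos (G.inner s).vertexSet.ncard with h0 | h0
    · have h4 : (G.crowded s r N).ncard = 0 := by omega
      rw [h0, h4]; simp
    · exact ((div_lt_iff₀ (by exact_mod_cast h0)).1 h1).le
  exact le_trans (by exact_mod_cast h3) h4

end Controlled

/-- The statistic that marks vertices of degree above `D` has integral 0 against the local
distribution, so its averages over large balls tend to 0. They bound the number of uncrowded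
vertices of high degree; crowded vertices supply the second `ε`. -/
theorem eventually_ncard_highDegree_le {P : ∀ r : ℕ, Measure (BallGraph n r)}
    (hP : G.HasSmoothGeometricCloth P) (hG : G.edges.Infinite) {D : ℕ}
    (hD : G.DegreesAlmostSurelyLE D) {M N r : ℝ} (hr : 0 < r) (hC : 0 < C) (hε : 0 < ε)
    (hεC : ε ≤ C / 2) (hctrl : ∀ᶠ s in atTop, G.ControlledAt C M N r ε s) :
    ∀ᶠ s in atTop, ((G.highDegree s D).ncard : ℝ) ≤ 2 * ε * G.vertexCount s := by
  obtain ⟨φ, L, b, hφ⟩ := exists_isTestFunction n (half_pos hr)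
  obtain ⟨R, hR⟩ := exists_nat_gt (r / 2)
  set N' := max N 0 with hN'
  have hK : 0 ≤ N' * b := mul_nonneg (le_max_right _ _) hφ.bound_nonneg
  set f := vertexStatistic hφ hR (typeInvariant_degree D) hK with hf
  have hf0 : ∫ W, f W ∂(P R) = 0 := by
    refine integral_eq_zero_of_ae ?_
    filter_upwards [hD P hP R] with W hW
    have h0 : markedSum φ (fun (W : BallGraph n R) v => (D : ℕ∞) < W.degree v) W = 0 := by
      refine finsum_eq_zero_of_forall_eq_zero fun v => indicator_of_notMem ?_ _
      exact not_lt.2 (hW v v.2)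
    rw [hf, vertexStatistic_apply, h0]
    exact min_eq_right hK
  have hlim := hP.tendsto_average hG R f
  rw [hf0] at hlim
  -- The integer radius is at least `s + r / 2`, so the bumps of all vertices of `I_s(G)` lie in the
  -- domain of integration.
  have hceil : Tendsto (fun s : ℝ => ⌈s + r / 2⌉₊) atTop atTop :=
    tendsto_nat_ceil_atTop.comp (tendsto_atTop_add_const_right atTop _ tendsto_id)
  have hg : ∀ᶠ s : ℝ in atTop, |(⌈s + r / 2⌉₊ : ℝ) - s| ≤ r / 2 + 1 := by
    filter_upwards [eventually_ge_atTop 0] with s hs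
    have h1 := Nat.le_ceil (s + r / 2)
    have h2 := Nat.ceil_lt_add_one (a := s + r / 2) (by linarith)
    rw [abs_le]
    constructor <;> linarith
  -- The rounded ball has less than twice the volume of `B_s`, and the vertex count is at least `C /
  -- 2` times the volume of `B_s`.
  have hη : (0 : ℝ) < ε * C / 4 := by positivity
  filter_upwards [hctrl, hceil.eventually (hlim.eventually_lt_const hη),
    hceil.eventually (hP.eventually_aemeasurable hG R), eventually_gt_atTop 0,
    (tendsto_ballVolume_div (n := n) hg).eventually_lt_const (one_lt_two)] with s h1 h2 h3 h4 h5
  have hvol := ballVolume_pos n h4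
  have hi0 : (0 : ℝ) < ⌈s + r / 2⌉₊ := lt_of_lt_of_le (by linarith) (Nat.le_ceil _)
  have hvol' := ballVolume_pos n hi0
  have hfin : (G.highDegree s D \ G.crowded s r N').Finite :=
    (G.finite_vertexSet_inner s).subset fun _ h => h.1.1
  have hcount := card_le_setIntegral_vertexStatistic hφ hR (typeInvariant_degree D) hK h3
    (T := hfin.toFinset) (N := N') (le_max_right _ _) le_rfl (fun v hv => by
      have hv' := (hfin.mem_toFinset.1 hv).1
      refine ⟨hv'.1.1, ?_, fun x hx => ?_⟩
      · have h6 := hv'.1.2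
        have h7 := Nat.le_ceil (s + r / 2)
        rw [mem_ball_zero_iff] at h6 ⊢
        linarith
      · exact lt_of_lt_of_le hv'.2 (degree_le_degree_window
          (mem_ball_zero_iff.2 (hx.trans hR)))) (fun v hv => by
      have hv' := hfin.mem_toFinset.1 hv
      rw [mul_div_cancel₀ _ two_ne_zero]
      exact not_lt.1 fun hlt => hv'.2 ⟨hv'.1.1, hlt⟩)
  rw [← ncard_eq_toFinset_card _ hfin] at hcount
  have hle : ((G.highDegree s D).ncard : ℝ) ≤
      (G.highDegree s D \ G.crowded s r N').ncard + (G.crowded s r N').ncard := by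
    have hfin' : (G.crowded s r N').Finite :=
      (G.finite_vertexSet_inner s).subset fun _ h => h.1
    exact_mod_cast ncard_le_ncard_sdiff_add_ncard _ _ hfin'
  have hc := h1.ncard_crowded_le (le_max_left N 0)
  have h6 : (G.highDegree s D \ G.crowded s r N').ncard ≤ ε * C / 4 * ballVolume n ⌈s + r / 2⌉₊ :=
    hcount.trans ((div_lt_iff₀ hvol').1 h2).le
  have h7 : ballVolume n ⌈s + r / 2⌉₊ ≤ 2 * ballVolume n s := ((div_lt_iff₀ hvol).1 h5).le
  have h8 : C / 2 * ballVolume n s ≤ G.vertexCount s := by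
    have h9 := (abs_lt.1 h1.abs_vertexCount_div_sub_lt).1
    exact ((lt_div_iff₀ hvol).1 (by linarith)).le
  have h10 : ε * C / 4 * ballVolume n ⌈s + r / 2⌉₊ ≤ ε * C / 4 * (2 * ballVolume n s) := by gcongr
  have h11 : ε * (C / 2 * ballVolume n s) ≤ ε * G.vertexCount s := by gcongr
  linarith

end EmbeddedGraph

namespace EmbeddedGraph

variable {G : EucGraph n}

/-! ### Swatch counts and window averages -/

/-- The edges of a regular swatch stay within `k * max M 0` of `v`, and `v` is within `r / 2` of
`x`, so `hR` puts them in the window, while `hvs` puts the window in `B_s`. -/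
theorem hasSwatchType_window_iff {s R r M : ℝ} {D k : ℕ} {v x : Space n} {S : SwatchType}
    (hv : v ∈ (G.inner s).vertexSet) (hreg : v ∉ G.reach s (G.irregular s D M) k)
    (hR : r / 2 + k * max M 0 < R) (hvs : v ∈ Metric.ball (0 : Space n) (s - (R + r / 2)))
    (hx : ‖v + -x‖ < r / 2) :
    HasSwatchType (G.window R x).interiorGraph k S (v + -x) ↔ HasSwatchType (G.inner s) k S v := by
  have hvx : dist v x < r / 2 := by rwa [dist_eq_norm, sub_eq_add_neg]
  have hsub : Metric.ball x R ⊆ Metric.ball 0 s := by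
    refine Metric.ball_subset_ball' ?_
    rw [mem_ball_zero_iff] at hvs
    have h1 : dist x 0 ≤ dist v x + ‖v‖ := by
      rw [← dist_zero_right v]; exact dist_triangle_left _ _ _
    linarith
  have key := swatch_inner_isomorphic_window (G := G) (x := x) (k := k) (v := v) hsub fun e he =>
    (subset_closedBall_of_edist_le (L := max M 0) (le_max_right _ _)
      (fun e he p hp q hq => dist_le_of_not_mem_reach hv hreg he hp hq) he).trans
      (Metric.closedBall_subset_ball' (by linarith))
  exact ⟨fun ⟨A, hA, h⟩ => ⟨A, hA, key.trans h⟩, fun ⟨A, hA, h⟩ => ⟨A, hA, key.symm.trans h⟩⟩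

/-- For regular vertices deep inside `B_s`, the type seen in a window is the true one. The errors
are the irregular swatches, the crowded vertices (only in the lower bound on the integral) and the
shell where a window may leave `B_s`. The hypothesis `1 ≤ R` absorbs the difference between `s` and
`i`. -/
theorem abs_ncard_sub_setIntegral_le {s R r M N b i : ℝ} {D k : ℕ} {S : SwatchType}
    {φ : Space n → ℝ} {L : NNReal} (hφ : IsTestFunction φ (r / 2) L b) (hr : 0 < r)
    (hR : r / 2 + k * max M 0 < R) (hR1 : 1 ≤ R) (hρR : r / 2 < R) (hN : 0 ≤ N)
    (hK : 0 ≤ N * b) (his : i ≤ s) (hsi : s - 1 ≤ i)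
    (hmeas : AEMeasurable (G.window R) (volume.restrict (Metric.ball 0 i))) :
    |({v ∈ (G.inner s).vertexSet | HasSwatchType (G.inner s) k S v}.ncard : ℝ) -
      ∫ x in Metric.ball 0 i, vertexStatistic hφ hρR (typeInvariant_hasSwatchType k S) hK
        (G.window R x)| ≤
      (G.reach s (G.irregular s D M) k).ncard + (G.crowded s r N).ncard +
        (G.vertexCount (s + r / 2) - G.vertexCount (s - (R + r / 2))) := by
  set A := {v ∈ (G.inner s).vertexSet | HasSwatchType (G.inner s) k S v} with hA
  set Y := G.reach s (G.irregular s D M) k with hY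
  set V₀ := G.vertices ∩ Metric.ball (0 : Space n) (s - (R + r / 2)) with hV₀
  set V₁ := G.vertices ∩ Metric.ball (0 : Space n) (s + r / 2) with hV₁
  have hVfin := G.finite_vertexSet_inner s
  have hAfin : A.Finite := hVfin.subset fun _ h => h.1
  have hYfin : Y.Finite := hVfin.subset (reach_subset irregular_subset k)
  have hCfin : (G.crowded s r N).Finite := hVfin.subset fun _ h => h.1
  have hV₁fin : V₁.Finite := G.finite_vertices_ball 0 _
  have hV₀V : V₀ ⊆ (G.inner s).vertexSet :=
    inter_subset_inter_right _ (Metric.ball_subset_ball (by linarith))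
  have hVV₁ : (G.inner s).vertexSet ⊆ V₁ :=
    inter_subset_inter_right _ (Metric.ball_subset_ball (by linarith))
  have hshell : ((V₁ \ V₀).ncard : ℝ) =
      G.vertexCount (s + r / 2) - G.vertexCount (s - (R + r / 2)) := by
    have := ncard_sdiff_add_ncard_of_subset (hV₀V.trans hVV₁) hV₁fin
    rw [vertexCount, vertexCount, ← this]
    push_cast
    ring
  rw [← hshell]
  have hgood : ∀ v ∈ V₀, v ∉ Y → ∀ x, ‖v + -x‖ < r / 2 →
      (HasSwatchType (G.window R x).interiorGraph k S (v + -x) ↔ v ∈ A) := by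
    intro v hv hvY x hx
    rw [hasSwatchType_window_iff (hV₀V hv) hvY hR hv.2 hx]
    exact ⟨fun h => ⟨hV₀V hv, h⟩, fun h => h.2⟩
  have hupper : ∫ x in Metric.ball 0 i, vertexStatistic hφ hρR (typeInvariant_hasSwatchType k S) hK
        (G.window R x) ≤ A.ncard + Y.ncard + (V₁ \ V₀).ncard := by
    have hfin : (A ∪ Y ∪ (V₁ \ V₀)).Finite :=
      (hAfin.union hYfin).union (hV₁fin.subset sdiff_subset)
    refine (setIntegral_vertexStatistic_le hφ hρR (typeInvariant_hasSwatchType k S) hK hmeas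
      (T := hfin.toFinset) fun x hx v hv hvx hm => hfin.mem_toFinset.2 ?_).trans ?_
    · by_cases hv₀ : v ∈ V₀
      · by_cases hvY : v ∈ Y
        · exact Or.inl (Or.inr hvY)
        · exact Or.inl (Or.inl ((hgood v hv₀ hvY x hvx).1 hm))
      · refine Or.inr ⟨⟨hv, ?_⟩, hv₀⟩
        rw [mem_ball_zero_iff] at hx ⊢
        have := norm_add_le (v + -x) x
        rw [neg_add_cancel_right] at this
        linarith
    · rw [← ncard_eq_toFinset_card _ hfin]
      have h1 := ncard_union_le (A ∪ Y) (V₁ \ V₀)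
      have h2 := ncard_union_le A Y
      exact_mod_cast h1.trans (Nat.add_le_add_right h2 _)
  have hlower : (A.ncard : ℝ) ≤ (∫ x in Metric.ball 0 i,
      vertexStatistic hφ hρR (typeInvariant_hasSwatchType k S) hK (G.window R x)) +
        (Y.ncard + (G.crowded s r N).ncard + (V₁ \ V₀).ncard) := by
    have hfin : ((A ∩ V₀) \ (Y ∪ G.crowded s r N)).Finite := hAfin.subset fun _ h => h.1.1
    have h1 := card_le_setIntegral_vertexStatistic hφ hρR (typeInvariant_hasSwatchType k S) hK hmeas
      (T := hfin.toFinset) (N := N) hN le_rfl (fun v hv => by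
        have hv' := hfin.mem_toFinset.1 hv
        refine ⟨hv'.1.2.1, Metric.ball_subset_ball (by linarith) hv'.1.2.2, fun x hx => ?_⟩
        exact (hgood v hv'.1.2 (fun h => hv'.2 (Or.inl h)) x hx).2 hv'.1.1) (fun v hv => by
        have hv' := hfin.mem_toFinset.1 hv
        rw [mul_div_cancel₀ _ two_ne_zero]
        exact not_lt.1 fun hlt => hv'.2 (Or.inr ⟨hv'.1.1.1, hlt⟩))
    rw [← ncard_eq_toFinset_card _ hfin] at h1
    have hsub : A ⊆ ((A ∩ V₀) \ (Y ∪ G.crowded s r N)) ∪ ((Y ∪ G.crowded s r N) ∪ (V₁ \ V₀)) := by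
      intro v hv
      by_cases h2 : v ∈ Y ∪ G.crowded s r N
      · exact Or.inr (Or.inl h2)
      · by_cases h3 : v ∈ V₀
        · exact Or.inl ⟨⟨hv, h3⟩, h2⟩
        · exact Or.inr (Or.inr ⟨hVV₁ hv.1, h3⟩)
    have h2 := ncard_le_ncard hsub (hfin.union ((hYfin.union hCfin).union
      (hV₁fin.subset sdiff_subset)))
    have h3 := ncard_union_le ((A ∩ V₀) \ (Y ∪ G.crowded s r N))
      ((Y ∪ G.crowded s r N) ∪ (V₁ \ V₀))
    have h4 := ncard_union_le (Y ∪ G.crowded s r N) (V₁ \ V₀)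
    have h5 := ncard_union_le Y (G.crowded s r N)
    have h6 : (A.ncard : ℝ) ≤ ((A ∩ V₀) \ (Y ∪ G.crowded s r N)).ncard +
        (Y.ncard + (G.crowded s r N).ncard + (V₁ \ V₀).ncard) := by
      exact_mod_cast h2.trans (h3.trans (Nat.add_le_add_left (h4.trans (Nat.add_le_add_right h5 _)) _))
    linarith
  have hC0 : (0 : ℝ) ≤ (G.crowded s r N).ncard := Nat.cast_nonneg _
  rw [abs_le]
  constructor <;> linarith

/-! ### Irregular swatches are rare -/

/-- The two scales are chosen in order: `ε` makes the long edges and crowded vertices contribute at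
most half of `κ`; this fixes `M ε` and `N ε`, hence the covering bound `q * N'`, and `ε'` is then
small enough that vertices of high degree contribute at most the other half. -/
theorem exists_forall_eventually_ncard_reach_le (n D k : ℕ) {B C r κ : ℝ} (hB : 0 ≤ B) (hC : 0 < C)
    (hr : 0 < r) (hκ : 0 < κ) (M N : ℝ → ℝ) :
    ∃ ε > 0, ε ≤ κ ∧ ∃ ε' > 0, ∀ (G : EucGraph n) (P : ∀ r : ℕ, Measure (BallGraph n r)),
      G.HasSmoothGeometricCloth P → G.edges.Infinite → G.DegreesAlmostSurelyLE D →
      (∀ᶠ s : ℝ in atTop,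
        ((G.inner s).edgeSet.ncard : ℝ) ≤ B * ((G.inner s).vertexSet.ncard : ℝ)) →
      (∀ᶠ s in atTop, G.ControlledAt C (M ε) (N ε) r ε s) →
      (∀ᶠ s in atTop, G.ControlledAt C (M ε') (N ε') r ε' s) →
      ∀ᶠ s in atTop,
        ((G.reach s (G.irregular s D (M ε)) k).ncard : ℝ) ≤ κ * G.vertexCount s := by
  set Q : ℝ := (2 * D + 2) ^ k with hQ
  have hQ0 : 0 < Q := by positivity
  have hQB : 0 < 2 * (Q * (2 * B + 1)) := by positivity
  set ε := min κ (κ / (2 * (Q * (2 * B + 1)))) with hε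
  have hε0 : 0 < ε := lt_min hκ (div_pos hκ hQB)
  obtain ⟨q, hq⟩ := exists_ncard_uncrowded_le n (max (M ε) 0) hr
  set N' := ⌈N ε⌉₊ with hN'
  have hQq : 0 < 2 * (Q * (1 + q * N') * 2) := by positivity
  set ε' := min (C / 2) (κ / (2 * (Q * (1 + q * N') * 2))) with hε'
  have hε'0 : 0 < ε' := lt_min (half_pos hC) (div_pos hκ hQq)
  refine ⟨ε, hε0, min_le_left _ _, ε', hε'0, fun G P hP hG hD hBG hctrl hctrl' => ?_⟩
  filter_upwards [hBG, hctrl, eventually_ncard_highDegree_le hP hG hD hr hC hε'0 (min_le_left _ _)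
    hctrl'] with s h1 h2 h3
  have hV := G.vertexCount_nonneg s
  have h4 : ((G.reach s (G.irregular s D (M ε)) k).ncard : ℝ) ≤ Q *
      ((G.irregular s D (M ε)).ncard +
        ((G.highDegree s D).ncard * (q * N') + (G.crowded s r N').ncard)) := by
    have := ncard_reach_le (s := s) (D := D) (r := r) (fun w => hq G w N') k
    rw [hQ]
    exact_mod_cast this
  have h5 : ((G.irregular s D (M ε)).ncard : ℝ) ≤
      (G.highDegree s D).ncard + (G.longEdges s (M ε)).ncard * 2 := by
    exact_mod_cast ncard_irregular_le
  have h6 := h2.ncard_longEdges_le hε0.le h1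
  have h7 := h2.ncard_crowded_le (Nat.le_ceil (N ε))
  have h8 : ε * (2 * (Q * (2 * B + 1))) ≤ κ := (le_div_iff₀ hQB).1 (min_le_right _ _)
  have h9 : ε' * (2 * (Q * (1 + q * N') * 2)) ≤ κ := (le_div_iff₀ hQq).1 (min_le_right _ _)
  have hqN : (0 : ℝ) ≤ q * N' := by positivity
  calc ((G.reach s (G.irregular s D (M ε)) k).ncard : ℝ)
      ≤ Q * ((G.irregular s D (M ε)).ncard +
        ((G.highDegree s D).ncard * (q * N') + (G.crowded s r N').ncard)) := h4
    _ ≤ Q * ((2 * ε' * G.vertexCount s + ε * B * G.vertexCount s * 2) +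
        (2 * ε' * G.vertexCount s * (q * N') + ε * G.vertexCount s)) := by
        gcongr
        linarith
    _ = (ε * (2 * (Q * (2 * B + 1))) + ε' * (2 * (Q * (1 + q * N') * 2))) / 2 *
        G.vertexCount s := by ring
    _ ≤ κ * G.vertexCount s := by
        refine mul_le_mul_of_nonneg_right ?_ hV
        linarith

/-! ### Swatch frequencies -/

/-- This is the tightness estimate: every vertex outside the exceptional set has one of finitely
many swatch types. -/
theorem vertexCount_sub_le_sum (s κ : ℝ) (D k : ℕ) (M : ℝ)
    (h : ((G.reach s (G.irregular s D M) k).ncard : ℝ) ≤ κ * G.vertexCount s) :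
    (1 - κ) * G.vertexCount s ≤ ∑ S ∈ swatchTypesLE ((D + 2 + 1) ^ k),
      ({v ∈ (G.inner s).vertexSet | HasSwatchType (G.inner s) k S v}.ncard : ℝ) := by
  have hVfin := G.finite_vertexSet_inner s
  set T := swatchTypesLE ((D + 2 + 1) ^ k)
  have hsub : (G.inner s).vertexSet ⊆ G.reach s (G.irregular s D M) k ∪
      ⋃ S ∈ T, {v ∈ (G.inner s).vertexSet | HasSwatchType (G.inner s) k S v} := by
    intro v hv
    by_cases hreg : v ∈ G.reach s (G.irregular s D M) k
    · exact Or.inl hreg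
    · obtain ⟨S, hS, hvS⟩ := exists_hasSwatchType (encard_ball_le hv hreg)
      exact Or.inr (mem_biUnion (show S ∈ (T : Set SwatchType) from hS) ⟨hv, hvS⟩)
  have h1 := ncard_le_ncard hsub ((hVfin.subset (reach_subset irregular_subset k)).union
    (T.finite_toSet.biUnion fun S _ => hVfin.subset fun _ h => h.1))
  have h2 := h1.trans ((ncard_union_le _ _).trans
    (Nat.add_le_add_left (Finset.set_ncard_biUnion_le _ _) _))
  have h3 : G.vertexCount s ≤ (G.reach s (G.irregular s D M) k).ncard + ∑ S ∈ T,
      ({v ∈ (G.inner s).vertexSet | HasSwatchType (G.inner s) k S v}.ncard : ℝ) := by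
    rw [← ncard_vertexSet_inner]
    exact_mod_cast h2
  linarith

/-- The swatch frequencies of controlled graphs are concentrated on a finite set of types, and are
approximated by integrals of bounded continuous functions of a window. -/
theorem exists_swatchFrequency_approx (n D k : ℕ) {B C r δ : ℝ} (hB : 0 ≤ B) (hC : 0 < C)
    (hr : 0 < r) (hδ : 0 < δ) (M N : ℝ → ℝ) :
    ∃ ε > 0, ∃ ε' > 0, ∃ (R : ℕ) (f : SwatchType → BoundedContinuousFunction (BallGraph n R) ℝ)
      (T : Finset SwatchType),
    ∀ (G : EucGraph n) (P : ∀ r : ℕ, Measure (BallGraph n r)),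
      G.HasSmoothGeometricCloth P → G.DegreesAlmostSurelyLE D →
      (∀ᶠ s : ℝ in atTop,
        ((G.inner s).edgeSet.ncard : ℝ) ≤ B * ((G.inner s).vertexSet.ncard : ℝ)) →
      (∀ᶠ s in atTop, G.ControlledAt C (M ε) (N ε) r ε s) →
      (∀ᶠ s in atTop, G.ControlledAt C (M ε') (N ε') r ε' s) →
      (∀ᶠ s in atTop, 1 - δ ≤ ∑ S ∈ T, swatchFrequency (G.inner s) k S) ∧
      ∀ S, ∀ᶠ s in atTop, |swatchFrequency (G.inner s) k S - (∫ W, f S W ∂(P R)) / C| ≤ δ := by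
  -- The bound `C / 2` keeps the density positive, `δ` serves tightness, and `4 * C + 6` collects
  -- all errors in the comparison of frequencies.
  set κ := min (C / 2) (min δ (δ * C / (4 * C + 6))) with hκ
  have hκ0 : 0 < κ := by positivity
  have hκC : κ ≤ C / 2 := min_le_left _ _
  have hκδ : κ ≤ δ := (min_le_right _ _).trans (min_le_left _ _)
  have hκC' : κ * (4 * C + 6) ≤ δ * C :=
    (le_div_iff₀ (by positivity)).1 ((min_le_right _ _).trans (min_le_right _ _))
  obtain ⟨ε, hε0, hεκ, ε', hε'0, hY⟩ :=
    exists_forall_eventually_ncard_reach_le n D k hB hC hr hκ0 M N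
  obtain ⟨φ, L, b, hφ⟩ := exists_isTestFunction n (half_pos hr)
  -- The summand 1 ensures `1 ≤ R`, as rounding `s` down to an integer requires.
  obtain ⟨R, hR⟩ := exists_nat_gt (r / 2 + k * max (M ε) 0 + 1)
  have hkM : 0 ≤ k * max (M ε) 0 := by positivity
  have hR1 : (1 : ℝ) ≤ R := by linarith
  have hρR : r / 2 < R := by linarith
  set N' := max (N ε) 0 with hN'
  have hK : 0 ≤ N' * b := mul_nonneg (le_max_right _ _) hφ.bound_nonneg
  set f : SwatchType → BoundedContinuousFunction (BallGraph n R) ℝ := fun S =>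
    vertexStatistic hφ hρR (typeInvariant_hasSwatchType k S) hK with hf
  refine ⟨ε, hε0, ε', hε'0, R, f, swatchTypesLE ((D + 2 + 1) ^ k),
    fun G P hP hD hBG hctrl hctrl' => ?_⟩
  have hdens : ∀ᶠ s in atTop, |G.vertexCount s / ballVolume n s - C| < κ :=
    hctrl.mono fun s h => h.abs_vertexCount_div_sub_lt.trans_le hεκ
  have hG : G.edges.Infinite := edges_infinite hC hκC hdens
  have hY' := hY G P hP hG hD hBG hctrl hctrl'
  have hpos : ∀ᶠ s in atTop, 0 < G.vertexCount s := by
    filter_upwards [hdens, eventually_gt_atTop 0] with s h1 h2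
    have h3 := (abs_lt.1 h1).1
    by_contra h4
    have h5 := div_nonpos_of_nonpos_of_nonneg (not_lt.1 h4) (ballVolume_pos n h2).le
    linarith
  refine ⟨?_, fun S => ?_⟩
  · filter_upwards [hY', hpos] with s h1 h2
    have h3 := vertexCount_sub_le_sum s κ D k (M ε) h1
    simp only [swatchFrequency_eq, ncard_vertexSet_inner]
    rw [← Finset.sum_div, le_div_iff₀ h2]
    refine le_trans ?_ h3
    gcongr
  · have hfloor : ∀ᶠ s : ℝ in atTop, |(⌊s⌋₊ : ℝ) - s| ≤ 1 := by
      filter_upwards [eventually_ge_atTop 0] with s hs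
      have h1 := Nat.floor_le hs
      have h2 := Nat.lt_floor_add_one s
      rw [abs_le]
      constructor <;> linarith
    have hg₁ : ∀ᶠ s : ℝ in atTop, |(s + r / 2) - s| ≤ r / 2 :=
      Eventually.of_forall fun s => by rw [add_sub_cancel_left, abs_of_pos (half_pos hr)]
    have hg₀ : ∀ᶠ s : ℝ in atTop, |(s - (R + r / 2)) - s| ≤ R + r / 2 :=
      Eventually.of_forall fun s => by
        rw [sub_sub_cancel_left, abs_neg, abs_of_nonneg (by positivity)]
    have hlim : Tendsto (fun s : ℝ => (∫ x in Metric.ball (0 : Space n) (⌊s⌋₊ : ℝ),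
        f S (G.window R x)) / ballVolume n s) atTop (𝓝 (∫ W, f S W ∂(P R))) := by
      have h1 := ((hP.tendsto_average hG R (f S)).comp
        (tendsto_nat_floor_atTop (α := ℝ))).mul (tendsto_ballVolume_div (n := n) hfloor)
      rw [mul_one] at h1
      refine h1.congr' ?_
      filter_upwards [tendsto_nat_floor_atTop.eventually (eventually_gt_atTop 0)] with s hs
      have h2 := ballVolume_pos n (s := (⌊s⌋₊ : ℝ)) (by exact_mod_cast hs)
      simp only [Function.comp_apply]
      exact div_mul_div_cancel₀ h2.ne'
    filter_upwards [hctrl, hdens, hY', hpos, eventually_gt_atTop 0, hfloor,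
      tendsto_nat_floor_atTop.eventually (hP.eventually_aemeasurable hG R),
      eventually_vertexCount_div hdens hκ0 hg₁, eventually_vertexCount_div hdens hκ0 hg₀,
      Metric.tendsto_nhds.1 hlim κ hκ0] with s h1 h2 h3 h4 h5 h6 h7 h8 h9 h10
    have hw := ballVolume_pos n h5
    have hmain := abs_ncard_sub_setIntegral_le (G := G) (D := D) (M := M ε) (k := k) (S := S)
      hφ hr (by linarith) hR1 hρR (le_max_right _ _) hK (Nat.floor_le h5.le)
      (by have := (abs_le.1 h6).1; linarith) h7
    have hc := h1.ncard_crowded_le (le_max_left (N ε) 0)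
    rw [Real.dist_eq] at h10
    rw [swatchFrequency_eq, ncard_vertexSet_inner]
    have haV : ({v ∈ (G.inner s).vertexSet | HasSwatchType (G.inner s) k S v}.ncard : ℝ) ≤
        G.vertexCount s := by
      rw [← ncard_vertexSet_inner]
      exact Nat.cast_le.2 (ncard_le_ncard (fun _ h => h.1) (G.finite_vertexSet_inner s))
    have ha0 : (0 : ℝ) ≤ ({v ∈ (G.inner s).vertexSet | HasSwatchType (G.inner s) k S v}.ncard : ℝ) :=
      Nat.cast_nonneg _
    set a := ({v ∈ (G.inner s).vertexSet | HasSwatchType (G.inner s) k S v}.ncard : ℝ)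
    set w := ballVolume n s
    set V := G.vertexCount s
    set I := ∫ W, f S W ∂(P R)
    set J := ∫ x in Metric.ball (0 : Space n) (⌊s⌋₊ : ℝ), f S (G.window R x)
    have hVw : V ≤ 2 * C * w := by
      have := (abs_lt.1 h2).2
      have h11 : V / w < 2 * C := by linarith
      exact ((div_lt_iff₀ hw).1 h11).le
    -- Irregular swatches and crowded vertices give `κ * V` each, at most `4 * C * κ * w` together;
    -- the shell gives `4 * κ * w`.
    have hshell : |a - J| ≤ κ * (4 * C + 4) * w := by
      have e1 : ((G.crowded s r N').ncard : ℝ) ≤ κ * V :=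
        hc.trans (mul_le_mul_of_nonneg_right hεκ h4.le)
      have e2 := (abs_le.1 h8).2
      have e3 := (abs_le.1 h9).1
      have e4 := mul_le_mul_of_nonneg_left hVw hκ0.le
      refine hmain.trans ?_
      linarith
    have hJ : |J - I * w| ≤ κ * w := by
      have e1 : J - I * w = (J / w - I) * w := by field_simp
      rw [e1, abs_mul, abs_of_pos hw]
      exact mul_le_mul_of_nonneg_right h10.le hw.le
    have hCV : |C * w - V| ≤ κ * w := by
      have e1 : C * w - V = -((V / w - C) * w) := by field_simp; ring
      rw [e1, abs_neg, abs_mul, abs_of_pos hw]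
      exact mul_le_mul_of_nonneg_right h2.le hw.le
    have hp0 : 0 ≤ a / V := div_nonneg ha0 h4.le
    have hp1 : a / V ≤ 1 := (div_le_one h4).2 haV
    -- The three errors are: vertex count against `C` times volume, swatch count against integral,
    -- and average against its limit.
    have hkey : (a / V - I / C) * (C * w) = a / V * (C * w - V) + (a - J) + (J - I * w) := by
      field_simp
      ring
    have hCw : 0 < C * w := mul_pos hC hw
    refine le_of_mul_le_mul_right ?_ hCw
    rw [← abs_of_pos hCw, ← abs_mul, hkey, abs_of_pos hCw]
    have t1 : |a / V * (C * w - V)| ≤ κ * w := by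
      rw [abs_mul, abs_of_nonneg hp0]
      exact (mul_le_of_le_one_left (abs_nonneg _) hp1).trans hCV
    have t2 := abs_add_le (a / V * (C * w - V) + (a - J)) (J - I * w)
    have t3 := abs_add_le (a / V * (C * w - V)) (a - J)
    have t4 := mul_le_mul_of_nonneg_right hκC' hw.le
    linarith

end EmbeddedGraph

/-! ### Convergence of probability distributions on a discrete set -/

/-- A tight family of probability distributions converges if each of its values is Cauchy. -/
theorem exists_pmf_tendsto {ι α : Type*} {l : Filter ι} [l.NeBot] {q : ι → α → ℝ}
    (hq : ∀ i a, 0 ≤ q i a) (hsum : ∀ i (T : Finset α), ∑ a ∈ T, q i a ≤ 1)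
    (hcauchy : ∀ δ > 0, ∀ a, ∃ c, ∀ᶠ i in l, |q i a - c| ≤ δ)
    (htight : ∀ δ > 0, ∃ T : Finset α, ∀ᶠ i in l, 1 - δ ≤ ∑ a ∈ T, q i a) :
    ∃ p : PMF α, ∀ a, Tendsto (fun i => q i a) l (𝓝 (p a).toReal) := by
  have hlim : ∀ a, ∃ x, Tendsto (fun i => q i a) l (𝓝 x) := fun a => by
    refine cauchy_map_iff_exists_tendsto.1 (Metric.cauchy_iff.2 ⟨inferInstance, fun δ hδ => ?_⟩)
    obtain ⟨c, hc⟩ := hcauchy (δ / 3) (by positivity) a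
    -- The value `c` may vary with `δ`; two frequencies near the same `c` differ by at most `2 * δ /
    -- 3 < δ`.
    refine ⟨{x | |x - c| ≤ δ / 3}, hc, fun x hx y hy => ?_⟩
    have hx' : dist x c ≤ δ / 3 := hx
    have hy' : dist y c ≤ δ / 3 := hy
    have := dist_triangle_right x y c
    linarith
  choose x hx using hlim
  have hx0 : ∀ a, 0 ≤ x a := fun a => ge_of_tendsto' (hx a) fun i => hq i a
  have hxT : ∀ T : Finset α, Tendsto (fun i => ∑ a ∈ T, q i a) l (𝓝 (∑ a ∈ T, x a)) :=
    fun T => tendsto_finsetSum T fun a _ => hx a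
  have hone : HasSum x 1 := by
    -- Finite sums pass to the limit; tightness prevents loss of mass, so their supremum is exactly
    -- 1.
    refine hasSum_of_isLUB_of_nonneg 1 hx0 ⟨?_, fun u hu => ?_⟩
    · rintro _ ⟨T, rfl⟩
      exact le_of_tendsto' (hxT T) fun i => hsum i T
    · refine le_of_forall_sub_le fun δ hδ => ?_
      obtain ⟨T, hT⟩ := htight δ hδ
      exact (ge_of_tendsto (hxT T) hT).trans (hu ⟨T, rfl⟩)
  refine ⟨⟨fun a => ENNReal.ofReal (x a), ?_⟩, fun a => ?_⟩
  · rw [ENNReal.summable.hasSum_iff, ← ENNReal.ofReal_tsum_of_nonneg hx0 hone.summable,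
      hone.tsum_eq, ENNReal.ofReal_one]
  · have : (ENNReal.ofReal (x a)).toReal = x a := ENNReal.toReal_ofReal (hx0 a)
    exact this ▸ hx a

theorem swatchFrequency_nonneg {α β : Type*} (H : Graph α β) (k : ℕ) (S : SwatchType) :
    0 ≤ swatchFrequency H k S := by
  rw [swatchFrequency]; positivity

/-- A vertex has at most one swatch type, so the counted sets are disjoint. For a graph without
vertices all frequencies are 0. -/
theorem sum_swatchFrequency_le_one {α β : Type*} {H : Graph α β} (hH : H.vertexSet.Finite) (k : ℕ)
    (T : Finset SwatchType) : ∑ S ∈ T, swatchFrequency H k S ≤ 1 := by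
  classical
  simp only [swatchFrequency_eq]
  rw [← Finset.sum_div]
  refine div_le_one_of_le₀ ?_ (Nat.cast_nonneg _)
  have h1 : ∀ S, {v ∈ H.vertexSet | HasSwatchType H k S v}.ncard =
      (hH.toFinset.filter (HasSwatchType H k S)).card := fun S => by
    rw [← ncard_coe_finset]
    congr 1
    ext v
    simp
  have h2 : ∑ S ∈ T, (hH.toFinset.filter (HasSwatchType H k S)).card ≤ hH.toFinset.card := by
    rw [← Finset.card_biUnion]
    · refine Finset.card_le_card (Finset.biUnion_subset.2 fun S _ => Finset.filter_subset _ _)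
    · intro S _ S' _ hne
      refine Finset.disjoint_left.2 fun v hv hv' => hne ?_
      exact (Finset.mem_filter.1 hv).2.unique (Finset.mem_filter.1 hv').2
  rw [ncard_eq_toFinset_card _ hH]
  simp only [h1]
  exact_mod_cast h2

theorem neBot_curry {α β : Type*} (l : Filter α) (l' : Filter β) [l.NeBot] [l'.NeBot] :
    (l.curry l').NeBot := by
  refine ⟨fun h => ?_⟩
  have h1 : ∀ᶠ _p in l.curry l', False := eventually_false_iff_eq_bot.2 h
  rw [eventually_curry_iff] at h1
  simp only [eventually_const] at h1

end EmbeddedGraphs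

/-! ### The limit in `s` for one graph, and the iterated limit in `s` and `j` -/

open EmbeddedGraphs in
theorem mainTheorem9 {n : ℕ} (G : ℕ → EucGraph n) (hG : LocallyGeometricallyConvergent G)
    (D : ℕ) (hD : ∀ j, (G j).DegreesAlmostSurelyLE D)
    (B : ℝ) (hB : ∀ j, ∀ᶠ s : ℝ in atTop,
      (((G j).inner s).edgeSet.ncard : ℝ) ≤ B * (((G j).inner s).vertexSet.ncard : ℝ))
    (C₁ : ℝ) (hC₁ : 0 < C₁) (M N : ℝ → ℝ) (r : ℝ) (hr : 0 < r)
    (hctrl : ∀ ε > 0, ∀ᶠ j in atTop, ∀ᶠ s in atTop,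
      (G j).ControlledAt C₁ (M ε) (N ε) r ε s) :
    (∀ j, (∀ ε > 0, ∀ᶠ s in atTop, (G j).ControlledAt C₁ (M ε) (N ε) r ε s) →
      ∃ σ : TopologicalCloth, (G j).HasInnerRegularCloth σ) ∧
    ∃ τ : TopologicalCloth,
      LocallyTopologicallyConverges (fun p : ℕ × ℝ => (G p.1).inner p.2)
        (Filter.curry atTop atTop) τ ∧
      ∀ σ : ℕ → TopologicalCloth, (∀ᶠ j in atTop, (G j).HasInnerRegularCloth (σ j)) →
        ∀ k S, Tendsto (fun j => σ j k S) atTop (𝓝 (τ k S)) := by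
  obtain ⟨P, hP, Ξ, hΞ⟩ := hG
  -- `|B|` replaces `B` because the estimates use a nonnegative constant.
  have hB' : ∀ j, ∀ᶠ s : ℝ in atTop, (((G j).inner s).edgeSet.ncard : ℝ) ≤
      |B| * (((G j).inner s).vertexSet.ncard : ℝ) := fun j => (hB j).mono fun s hs =>
    hs.trans (mul_le_mul_of_nonneg_right (le_abs_self B) (Nat.cast_nonneg _))
  refine ⟨fun j hj => ?_, ?_⟩
  · have key : ∀ k, ∃ p : PMF SwatchType, ∀ S,
        Tendsto (fun s : ℝ => swatchFrequency ((G j).inner s) k S) atTop (𝓝 (p S).toReal) := by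
      intro k
      refine exists_pmf_tendsto (fun s S => swatchFrequency_nonneg _ k S)
        (fun s => sum_swatchFrequency_le_one ((G j).finite_vertexSet_inner s) k) ?_ ?_
      all_goals
        intro δ hδ
        obtain ⟨ε, hε, ε', hε', R, f, T, h⟩ :=
          EmbeddedGraph.exists_swatchFrequency_approx n D k (abs_nonneg B) hC₁ hr hδ M N
        have h' := h (G j) (P j) (hP j) (hD j) (hB' j) (hj ε hε) (hj ε' hε')
      · exact fun S => ⟨_, h'.2 S⟩
      · exact ⟨T, h'.1⟩
    choose σ hσ using key
    exact ⟨σ, hσ⟩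
  · have hne : (Filter.curry (atTop : Filter ℕ) (atTop : Filter ℝ)).NeBot := neBot_curry _ _
    have key : ∀ k, ∃ p : PMF SwatchType, ∀ S,
        Tendsto (fun p : ℕ × ℝ => swatchFrequency ((G p.1).inner p.2) k S)
          (Filter.curry atTop atTop) (𝓝 (p S).toReal) := by
      intro k
      refine exists_pmf_tendsto (fun p S => swatchFrequency_nonneg _ k S)
        (fun p => sum_swatchFrequency_le_one ((G p.1).finite_vertexSet_inner p.2) k) ?_ ?_
      all_goals
        intro δ hδ
        obtain ⟨ε, hε, ε', hε', R, f, T, h⟩ :=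
          EmbeddedGraph.exists_swatchFrequency_approx n D k (abs_nonneg B) hC₁ hr (half_pos hδ) M N
        have h' := fun j => h (G j) (P j) (hP j) (hD j) (hB' j)
      · intro S
        -- Half of `δ` goes to approximating the frequency by the integral for the `j`-th graph,
        -- half to the convergence of these integrals, which is local geometric convergence tested
        -- on `f S`.
        refine ⟨(∫ W, f S W ∂(Ξ R)) / C₁, eventually_curry_iff.2 ?_⟩
        have hlim := ((hΞ R).2 (f S)).div_const C₁
        filter_upwards [hctrl ε hε, hctrl ε' hε', Metric.tendsto_nhds.1 hlim (δ / 2) (half_pos hδ)]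
          with j h1 h2 h3
        filter_upwards [(h' j h1 h2).2 S] with s hs
        rw [Real.dist_eq] at h3
        have := abs_sub_le (swatchFrequency ((G j).inner s) k S) ((∫ W, f S W ∂(P j R)) / C₁)
          ((∫ W, f S W ∂(Ξ R)) / C₁)
        linarith
      · refine ⟨T, eventually_curry_iff.2 ?_⟩
        filter_upwards [hctrl ε hε, hctrl ε' hε'] with j h1 h2
        filter_upwards [(h' j h1 h2).1] with s hs
        linarith
    choose τ hτ using key
    refine ⟨τ, hτ, fun σ hσ k S => ?_⟩
    rw [← ENNReal.tendsto_toReal_iff (fun j => PMF.apply_ne_top _ _) (PMF.apply_ne_top _ _),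
      Metric.tendsto_nhds]
    intro δ hδ
    filter_upwards [hσ, eventually_curry_iff.1 (Metric.tendsto_nhds.1 (hτ k S) (δ / 2)
      (half_pos hδ))] with j h1 h2
    -- For fixed `j` the bound holds for all large `s`, so it survives the limit that defines the
    -- cloth of the `j`-th graph.
    have h3 : dist (σ j k S).toReal (τ k S).toReal ≤ δ / 2 :=
      le_of_tendsto ((h1 k S).dist tendsto_const_nhds) (h2.mono fun s hs => hs.le)
    linarith
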